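/- Write points of $\mathbb C^3$ as $(x,\mathbf y)=(x,y_1,y_2)$ and put $\|\mathbf y\|=\max(|y_1|,|y_2|)$. For $r>0$ and $\alpha<\beta$ let $S(r,\alpha,\beta)=\{x\in\mathbb C : 0<|x|<r,\ \alpha<\arg x<\beta\}$ (for some determination of $\arg x$). A sectorial neighborhood of the origin in the direction $\theta$ with opening $\eta$ is an open set $\mathcal S\subset\mathbb C^3$ containing $S(r,\theta-\frac{\eta}{2}-\epsilon,\theta+\frac{\eta}{2}+\epsilon)\times\mathbf D(0,\mathbf r)$ for some $r,\epsilon>0$ and some open polydisc $\mathbf D(0,\mathbf r)\subset\mathbb C^2$ of positive poly-radius centered at $0$. Denote by $\mathrm{Diff}_{\mathrm{fib}}(\mathcal S_{\theta,\eta};\mathrm{Id})$ the set of germs of biholomorphisms $\Phi:\mathcal S\to\Phi(\mathcal S)$, $\mathcal S$ such a neighborhood, of the form $\Phi(x,\mathbf y)=(x,\phi(x,\mathbf y))$ with $\Phi(x,\mathbf y)-(x,\mathbf y)=O(\|(x,\mathbf y)\|^2)$ as $(x,\mathbf y)\to 0$ in $\mathcal S$. Let $\lambda\in\mathbb C\setminus\{0\}$,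 let $a_1,a_2\in\mathbb C$ with $\mathrm{Re}(a_1+a_2)>0$, let $N\ge 1$ be an integer, and let $c$ be a germ of analytic function at $0\in\mathbb C$ with $c(0)=0$. Put $\vec{\mathcal C}=-y_1\partial_{y_1}+y_2\partial_{y_2}$, $\vec{\mathcal R}=y_1\partial_{y_1}+y_2\partial_{y_2}$ and $Y_0=\lambda\vec{\mathcal C}+x\,(x\partial_x+a_1y_1\partial_{y_1}+a_2y_2\partial_{y_2})$. Let $\eta\in\,]\pi,2\pi[$, and for each sign $\pm$ let $$Y_\pm^{(N+2)}=Y_0+\bigl(c(y_1y_2)+x^{N+2}D_\pm(x,\mathbf y)\bigr)\vec{\mathcal C}+x^{N+2}R_\pm(x,\mathbf y)\,\vec{\mathcal R},$$ where $D_\pm$ and $R_\pm$ are holomorphic in a sectorial neighborhood of the origin in the direction $\arg(\pm i\lambda)$ with opening $\eta$ and are of order at least one with respect to $\mathbf y$, in the sense that they are bounded there by a constant times $\|\mathbf y\|$. Then there exist $\Psi_+\in\mathrm{Diff}_{\mathrm{fib}}(\mathcal S_{\arg(i\lambda),\eta};\mathrm{Id})$ and $\Psi_-\in\mathrm{Diff}_{\mathrm{fib}}(\mathcal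 S_{\arg(-i\lambda),\eta};\mathrm{Id})$, of the form $\Psi_\pm(x,\mathbf y)=(x,\mathbf y+O(\|\mathbf y\|^2))$, which conjugate $Y_\pm^{(N+2)}$ to $$Y_{\mathrm{norm}}=x^2\partial_x+\bigl(-\lambda+a_1x-c(y_1y_2)\bigr)y_1\partial_{y_1}+\bigl(\lambda+a_2x+c(y_1y_2)\bigr)y_2\partial_{y_2},$$ i.e. $(\Psi_\pm)_*(Y_\pm^{(N+2)}):=(\mathrm D\Psi_\pm\cdot Y_\pm^{(N+2)})\circ\Psi_\pm^{-1}=Y_{\mathrm{norm}}$. Moreover $\Psi_\pm$ can be chosen such that $$\Psi_\pm(x,\mathbf y)=(x,\mathbf y)+x^N\,(0,P_{1,\pm}(x,\mathbf y),P_{2,\pm}(x,\mathbf y)),$$ where $P_{1,\pm},P_{2,\pm}$ are holomorphic in $S\bigl(r,\arg(\pm i\lambda)-\frac{\pi}{2}-\epsilon,\arg(\pm i\lambda)+\frac{\pi}{2}+\epsilon\bigr)\times\mathbf D(0,\mathbf r)$ for some $r>0$, some $\epsilon\in\,]0,\frac{\pi}{2}[$ with $\pi+2\epsilon>\eta$ and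 some polydisc $\mathbf D(0,\mathbf r)$, and are of order at least two with respect to $\mathbf y$, i.e. bounded there by a constant times $\|\mathbf y\|^2$. -/

import Mathlib

open Set Filter Topology Asymptotics

noncomputable section

namespace SaddleNode

/-- The phase space `ℂ³`, with points `p = (x, 𝐲) = (x, (y₁, y₂))`; thus `p.1 = x`, `p.2 = 𝐲`.
All norms on products are maximum norms, so `‖p.2‖ = max |y₁| |y₂|`. -/
abbrev Phase : Type := ℂ × ℂ × ℂ

/-- The open sector `S(r, α, β)`: all `x` with `0 < |x| < r` having an argument in `]α, β[`. -/
def sector (r α β : ℝ) : Set ℂ :=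
  {x | 0 < ‖x‖ ∧ ‖x‖ < r ∧ ∃ t ∈ Ioo α β, x = (‖x‖ : ℂ) * Complex.exp ((t : ℂ) * Complex.I)}

/-- The open polydisc of poly-radius `(ρ₁, ρ₂)` centred at the origin of `ℂ²`. -/
def polydisc (ρ₁ ρ₂ : ℝ) : Set (ℂ × ℂ) :=
  {y | ‖y.1‖ < ρ₁ ∧ ‖y.2‖ < ρ₂}

/-- `S` is a sectorial neighbourhood of the origin of `ℂ³` in the direction `θ` with
opening `η`. -/
def IsSectorialNhd (θ η : ℝ) (S : Set Phase) : Prop :=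
  IsOpen S ∧ ∃ r > 0, ∃ ρ₁ > 0, ∃ ρ₂ > 0, ∃ ε > 0,
    sector r (θ - η / 2 - ε) (θ + η / 2 + ε) ×ˢ polydisc ρ₁ ρ₂ ⊆ S

/-- `f` represents a germ of holomorphic function in a sectorial neighbourhood of the origin
in the direction `θ` with opening `η`, and is of order at least one with respect to `𝐲`,
i.e. dominated by `‖𝐲‖` there. -/
def IsSectorialRemainder (θ η : ℝ) (f : Phase → ℂ) : Prop :=
  ∃ S, IsSectorialNhd θ η S ∧ DifferentiableOn ℂ f S ∧
    ∃ L : ℝ, ∀ p ∈ S, ‖f p‖ ≤ L * ‖p.2‖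

/-- `Φ`, with domain `Φ.source` and image `Φ.target`, represents a germ of sectorial fibered
diffeomorphism in the direction `θ` with opening `η`, tangent to the identity. -/
structure IsSectorialDiffeo (θ η : ℝ) (Φ : OpenPartialHomeomorph Phase Phase) : Prop where
  source_mem : IsSectorialNhd θ η Φ.source
  holomorphic : DifferentiableOn ℂ Φ Φ.source
  holomorphic_symm : DifferentiableOn ℂ Φ.symm Φ.target
  fibered : ∀ p ∈ Φ.source, (Φ p).1 = p.1
  tangent_id : (fun p => Φ p - p) =O[𝓝[Φ.source] 0] fun p => ‖p‖ ^ 2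

/-- The push-forward `Φ_* Y = (DΦ · Y) ∘ Φ⁻¹`, meaningful on `Φ.target`. -/
def pushforward (Φ : OpenPartialHomeomorph Phase Phase) (Y : Phase → Phase) : Phase → Phase :=
  fun q => fderiv ℂ Φ (Φ.symm q) (Y (Φ.symm q))

/-- `𝒞 = -y₁ ∂/∂y₁ + y₂ ∂/∂y₂`. -/
def fieldC (p : Phase) : Phase := (0, -p.2.1, p.2.2)

/-- `ℛ = y₁ ∂/∂y₁ + y₂ ∂/∂y₂`. -/
def fieldR (p : Phase) : Phase := (0, p.2.1, p.2.2)

/-- `Y₀ = l 𝒞 + x (x ∂/∂x + a₁ y₁ ∂/∂y₁ + a₂ y₂ ∂/∂y₂)`. -/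
def fieldY₀ (l a₁ a₂ : ℂ) (p : Phase) : Phase :=
  l • fieldC p + p.1 • ((p.1, a₁ * p.2.1, a₂ * p.2.2) : Phase)

/-- The vector field normalized up to order `M`, with remainders `D` and `R`:
`Y₀ + (c(y₁y₂) + x^M D) 𝒞 + x^M R ℛ`. -/
def normalizedUpTo (M : ℕ) (l a₁ a₂ : ℂ) (c : ℂ → ℂ) (D R : Phase → ℂ) (p : Phase) : Phase :=
  fieldY₀ l a₁ a₂ p + (c (p.2.1 * p.2.2) + p.1 ^ M * D p) • fieldC p
    + (p.1 ^ M * R p) • fieldR p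

/-- The normal form
`x² ∂/∂x + (-l + a₁ x - c(y₁y₂)) y₁ ∂/∂y₁ + (l + a₂ x + c(y₁y₂)) y₂ ∂/∂y₂`. -/
def normalForm (l a₁ a₂ : ℂ) (c : ℂ → ℂ) (p : Phase) : Phase :=
  (p.1 ^ 2, (-l + a₁ * p.1 - c (p.2.1 * p.2.2)) * p.2.1,
    (l + a₂ * p.1 + c (p.2.1 * p.2.2)) * p.2.2)

/-- The direction `arg (± i l)`, the sign being `σ : ℤˣ`. -/
def direction (l : ℂ) (σ : ℤˣ) : ℝ :=
  Complex.arg (((σ : ℤ) : ℂ) * (Complex.I * l))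

/-- The sectors `S_±(r, ε)`, of opening `π + 2 ε` and bisected by `± i l`. -/
def wideSector (l : ℂ) (σ : ℤˣ) (r ε : ℝ) : Set ℂ :=
  sector r (direction l σ - Real.pi / 2 - ε) (direction l σ + Real.pi / 2 + ε)

end SaddleNode

end

/-!
After multiplication by a suitable unit, the trajectories of `Y = Y_±^{(N+2)}` in real time obey
`h' = -h² (1 + small)` in the variable `h = x / (± i l)`, while the linear parts of the equations
for `y₁` and `y₂` have purely imaginary leading coefficients. Hence the trajectories stay in a
sector of opening less than `2 π` and tend to `0` like the inverse of the time, and `𝐲` stays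
bounded along them because `0 ≤ Re (a₁ + a₂)`. Integrating along the trajectories therefore solves
the homological equation `Y χ = f` for `f = O(x^{m+2} 𝐲)`, with `χ = O(x^{m+1} 𝐲)`.

The conjugacy is `(x, y₁ e^{χ₁}, y₂ e^{χ₂})`. With `v = y₁ y₂`, the sum `s = χ₁ + χ₂` solves
`Y s = -2 x^{N+2} R`, and once `s` is known `χ₁` solves
`Y χ₁ = x^{N+2} (D - R) + c(v) - c(v e^s)`, whose right-hand side is `O(x^{N+1} 𝐲)` because `s` is.
The resulting map is biholomorphic on a small domain since it differs from the identity by a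
contraction in each fibre `x = const`.
-/

noncomputable section

namespace SaddleNode

open MeasureTheory Metric

/-! ### Holomorphic maps between normed spaces -/

section SeveralVariables

theorem exists_ball_bounded {E F : Type*} [PseudoMetricSpace E] [SeminormedAddCommGroup F]
    {f : E → F} {U : Set E} (hU : IsOpen U) (hf : ContinuousOn f U) {x : E} (hx : x ∈ U) :
    ∃ r > 0, ball x r ⊆ U ∧ ∃ M : ℝ, ∀ z ∈ ball x r, ‖f z‖ ≤ M := by
  have hbdd : ∀ᶠ z in 𝓝 x, ‖f z‖ < ‖f x‖ + 1 :=
    (hf.continuousAt (hU.mem_nhds hx)).norm.eventually_lt continuousAt_const (by linarith)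
  obtain ⟨r, hr, hsub⟩ := Metric.mem_nhds_iff.1 (hbdd.and (hU.mem_nhds hx))
  exact ⟨r, hr, fun z hz => (hsub hz).2, _, fun z hz => (hsub hz).1.le⟩

variable {E F : Type*} [NormedAddCommGroup E] [NormedSpace ℂ E] [NormedAddCommGroup F]
  [NormedSpace ℂ F]

theorem norm_fderiv_le_of_bounded {f : E → F} {c : E} {r M : ℝ} (hr : 0 < r)
    (hd : DifferentiableOn ℂ f (ball c r)) (hM : ∀ z ∈ ball c r, ‖f z‖ ≤ M) :
    ‖fderiv ℂ f c‖ ≤ 2 * M / r := by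
  refine Complex.norm_fderiv_le_div_of_mapsTo_ball hd (fun z hz => ?_) hr
  rw [mem_closedBall, dist_eq_norm]
  linarith [norm_sub_le (f z) (f c), hM z hz, hM c (mem_ball_self hr)]

theorem norm_sub_le_of_bounded {f : E → F} {c : E} {r M : ℝ} (hr : 0 < r)
    (hd : DifferentiableOn ℂ f (ball c (2 * r))) (hM : ∀ z ∈ ball c (2 * r), ‖f z‖ ≤ M)
    {x y : E} (hx : x ∈ closedBall c r) (hy : y ∈ closedBall c r) :
    ‖f x - f y‖ ≤ 2 * M / r * ‖x - y‖ := by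
  have hsub : ∀ z ∈ closedBall c r, ball z r ⊆ ball c (2 * r) := fun z hz =>
    ball_subset_ball' (by rw [mem_closedBall] at hz; linarith)
  let : NormedSpace ℝ E := NormedSpace.restrictScalars ℝ ℂ E
  refine (convex_closedBall c r).norm_image_sub_le_of_norm_fderiv_le (𝕜 := ℂ) (fun z hz => ?_)
    (fun z hz => ?_) hy hx
  · exact hd.differentiableAt (isOpen_ball.mem_nhds (hsub z hz (mem_ball_self hr)))
  · exact norm_fderiv_le_of_bounded hr (hd.mono (hsub z hz)) fun w hw => hM w (hsub z hz hw)

theorem norm_fderiv_sub_fderiv_le_of_bounded {f : E → F} {c : E} {r M : ℝ} (hr : 0 < r)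
    (hd : DifferentiableOn ℂ f (ball c (4 * r))) (hM : ∀ z ∈ ball c (4 * r), ‖f z‖ ≤ M)
    {y : E} (hy : y ∈ ball c r) :
    ‖fderiv ℂ f y - fderiv ℂ f c‖ ≤ 2 * M / r ^ 2 * ‖y - c‖ := by
  have hfour : 2 * (2 * r) = 4 * r := by ring
  have hclosed : closedBall c (2 * r) ⊆ ball c (4 * r) := closedBall_subset_ball (by linarith)
  have hda : ∀ z ∈ closedBall c (2 * r), DifferentiableAt ℂ f z := fun z hz =>
    hd.differentiableAt (isOpen_ball.mem_nhds (hclosed hz))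
  have hmem : ∀ z ∈ ball c r, z ∈ closedBall c (2 * r) ∧ z + (y - c) ∈ closedBall c (2 * r) := by
    intro z hz
    rw [mem_ball, dist_eq_norm] at hz hy
    rw [mem_closedBall, mem_closedBall, dist_eq_norm, dist_eq_norm, add_sub_right_comm]
    exact ⟨by linarith, by linarith [norm_add_le (z - c) (y - c)]⟩
  have hderiv : ∀ z ∈ ball c r, HasFDerivAt (fun w => f (w + (y - c)) - f w)
      (fderiv ℂ f (z + (y - c)) - fderiv ℂ f z) z := fun z hz =>
    ((hasFDerivAt_comp_add_right (y - c)).2 (hda _ (hmem z hz).2).hasFDerivAt).sub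
      (hda z (hmem z hz).1).hasFDerivAt
  have hbound : ∀ z ∈ ball c r, ‖f (z + (y - c)) - f z‖ ≤ 2 * M / (2 * r) * ‖y - c‖ := by
    intro z hz
    simpa using norm_sub_le_of_bounded (by positivity) (hfour ▸ hd) (hfour ▸ hM)
      (hmem z hz).2 (hmem z hz).1
  have hc := norm_fderiv_le_of_bounded hr
    (fun z hz => (hderiv z hz).differentiableAt.differentiableWithinAt) hbound
  rw [(hderiv c (mem_ball_self hr)).fderiv, add_sub_cancel] at hc
  exact hc.trans_eq (by field_simp)

theorem hasStrictFDerivAt_of_differentiableOn {f : E → F} {U : Set E} (hU : IsOpen U)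
    (hf : DifferentiableOn ℂ f U) {x : E} (hx : x ∈ U) :
    HasStrictFDerivAt f (fderiv ℂ f x) x := by
  obtain ⟨r, hr, hsub, M, hM⟩ := exists_ball_bounded hU hf.continuousOn hx
  have hfour : 4 * (r / 4) = r := by ring
  refine hasStrictFDerivAt_of_hasFDerivAt_of_continuousAt (f' := fderiv ℂ f) ?_ ?_
  · filter_upwards [hU.mem_nhds hx] with z hz using
      (hf.differentiableAt (hU.mem_nhds hz)).hasFDerivAt
  · refine continuousAt_of_locally_lipschitz (by positivity : 0 < r / 4)
      (2 * M / (r / 4) ^ 2) fun y hy => ?_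
    rw [dist_eq_norm, dist_eq_norm]
    exact norm_fderiv_sub_fderiv_le_of_bounded (by positivity) (by rw [hfour]; exact hf.mono hsub)
      (by rwa [hfour]) hy

theorem locallyLipschitzOn_of_differentiableOn {f : E → F} {U : Set E} (hU : IsOpen U)
    (hf : DifferentiableOn ℂ f U) : LocallyLipschitzOn U f := by
  intro x hx
  obtain ⟨K, s, hs, hK⟩ := (hasStrictFDerivAt_of_differentiableOn hU hf hx).exists_lipschitzOnWith
  exact ⟨K, s, mem_nhdsWithin_of_mem_nhds hs, hK⟩

theorem uniformCauchySeqOn_fderiv {f : ℕ → E → F} {U V : Set E} {r : ℝ} (hr : 0 < r)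
    (hV : ∀ y ∈ V, ball y r ⊆ U) (hf : ∀ n, DifferentiableOn ℂ (f n) U)
    (hcauchy : UniformCauchySeqOn f atTop U) :
    UniformCauchySeqOn (fun n => fderiv ℂ (f n)) atTop V := by
  rw [Metric.uniformCauchySeqOn_iff] at hcauchy ⊢
  intro ε hε
  obtain ⟨N, hN⟩ := hcauchy (ε * r / 4) (by positivity)
  refine ⟨N, fun m hm n hn y hy => ?_⟩
  have hdiff : ∀ k, DifferentiableAt ℂ (f k) y := fun k =>
    ((hf k).mono (hV y hy)).differentiableAt (ball_mem_nhds y hr)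
  have hle := norm_fderiv_le_of_bounded (f := fun z => f m z - f n z) (M := ε * r / 4) hr
    (((hf m).sub (hf n)).mono (hV y hy)) fun z hz => by
      rw [← dist_eq_norm]; exact (hN m hm n hn z (hV y hy hz)).le
  rw [fderiv_fun_sub (hdiff m) (hdiff n), ← dist_eq_norm] at hle
  refine hle.trans_lt ?_
  rw [div_lt_iff₀ hr]
  nlinarith [mul_pos hε hr]

theorem differentiableOn_of_tendstoUniformlyOn [CompleteSpace F] {f : ℕ → E → F} {g : E → F}
    {U : Set E} (hU : IsOpen U) (hf : ∀ n, DifferentiableOn ℂ (f n) U)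
    (hlim : TendstoUniformlyOn f g atTop U) : DifferentiableOn ℂ g U := by
  intro x hx
  obtain ⟨r, hr, hsub⟩ := Metric.isOpen_iff.1 hU x hx
  have hr2 : 0 < r / 2 := by positivity
  have hballs : ∀ y ∈ ball x (r / 2), ball y (r / 2) ⊆ U := fun y hy =>
    (ball_subset_ball' (by rw [mem_ball] at hy; linarith)).trans hsub
  have hmem : ∀ y ∈ ball x (r / 2), y ∈ U := fun y hy => hballs y hy (mem_ball_self hr2)
  have hcauchy := uniformCauchySeqOn_fderiv hr2 hballs hf hlim.uniformCauchySeqOn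
  choose! L hL using fun y (hy : y ∈ ball x (r / 2)) =>
    cauchySeq_tendsto_of_complete (hcauchy.cauchySeq hy)
  exact (hasFDerivAt_of_tendstoUniformlyOn isOpen_ball (hcauchy.tendstoUniformlyOn_of_tendsto hL)
    (fun n y hy => ((hf n).differentiableAt (hU.mem_nhds (hmem y hy))).hasFDerivAt)
    (fun y hy => hlim.tendsto_at (hmem y hy))
    (mem_ball_self hr2)).differentiableAt.differentiableWithinAt

section Integral

variable {α : Type*} [MeasurableSpace α] {μ : Measure α}

theorem aestronglyMeasurable_of_apply [FiniteDimensional ℂ E] {T : α → E →L[ℂ] F}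
    (hT : ∀ v, AEStronglyMeasurable (fun a => T a v) μ) : AEStronglyMeasurable T μ := by
  set b := Module.finBasis ℂ E
  have hsum : T = fun a =>
      ∑ i, (b.coord i).toContinuousLinearMap.smulRight (T a (b i)) := by
    ext a v
    simp only [FunLike.coe_sum, Finset.sum_apply, ContinuousLinearMap.smulRight_apply,
      LinearMap.coe_toContinuousLinearMap', Module.Basis.coord_apply]
    conv_lhs => rw [← b.sum_repr v]
    simp only [map_sum, map_smul]
  rw [hsum]
  exact Finset.aestronglyMeasurable_fun_sum _ fun i _ =>
    (ContinuousLinearMap.smulRightL ℂ E F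
      (b.coord i).toContinuousLinearMap).continuous.comp_aestronglyMeasurable (hT _)

theorem aestronglyMeasurable_fderiv_apply {f : E → α → F} {U : Set E} {x : E} (hU : U ∈ 𝓝 x)
    (hmeas : ∀ p ∈ U, AEStronglyMeasurable (f p) μ)
    (hd : ∀ᵐ a ∂μ, DifferentiableAt ℂ (fun p => f p a) x) (v : E) :
    AEStronglyMeasurable (fun a => fderiv ℂ (fun p => f p a) x v) μ := by
  have hcast : Tendsto (fun n : ℕ => ((n : ℂ) + 1)⁻¹) atTop (𝓝 0) := by
    simpa [one_div] using tendsto_one_div_add_atTop_nhds_zero_nat (𝕜 := ℂ)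
  have hlim : Tendsto (fun n : ℕ => x + ((n : ℂ) + 1)⁻¹ • v) atTop (𝓝 x) := by
    simpa using (hcast.smul_const v).const_add x
  obtain ⟨n₀, hn₀⟩ := (hlim.eventually hU).exists_forall_of_atTop
  refine aestronglyMeasurable_of_tendsto_ae atTop
    (f := fun (n : ℕ) a => (((n + n₀ : ℕ) : ℂ) + 1) •
      (f (x + (((n + n₀ : ℕ) : ℂ) + 1)⁻¹ • v) a - f x a)) (fun n => ?_) ?_
  · exact ((hmeas _ (hn₀ _ (by omega))).sub (hmeas x (mem_of_mem_nhds hU))).const_smul _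
  · have hinv : Tendsto (fun n : ℕ => ‖((n : ℂ) + 1)‖) atTop atTop := by
      have hnorm : ∀ n : ℕ, ‖((n : ℂ) + 1)‖ = (n : ℝ) + 1 := fun n => by
        exact_mod_cast Complex.norm_natCast (n + 1)
      simp only [hnorm]
      exact tendsto_atTop_add_const_right _ _ tendsto_natCast_atTop_atTop
    filter_upwards [hd] with a ha
    exact ha.hasFDerivAt.lim v (c := fun n : ℕ => ((n + n₀ : ℕ) : ℂ) + 1) (l := atTop)
      (hinv.comp (tendsto_add_atTop_nat n₀))

theorem differentiableOn_integral [FiniteDimensional ℂ E] [CompleteSpace F]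
    {f : E → α → F} {bound : α → ℝ} {U : Set E}
    (hU : IsOpen U) (hmeas : ∀ p ∈ U, AEStronglyMeasurable (f p) μ)
    (hd : ∀ᵐ a ∂μ, DifferentiableOn ℂ (fun p => f p a) U)
    (hb : ∀ᵐ a ∂μ, ∀ p ∈ U, ‖f p a‖ ≤ bound a) (hbi : Integrable bound μ) :
    DifferentiableOn ℂ (fun p => ∫ a, f p a ∂μ) U := by
  intro x hx
  have hda : ∀ᵐ a ∂μ, DifferentiableAt ℂ (fun p => f p a) x := by
    filter_upwards [hd] with a ha using ha.differentiableAt (hU.mem_nhds hx)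
  obtain ⟨r, hr, hsub⟩ := Metric.isOpen_iff.1 hU x hx
  have hr2 : 0 < r / 2 := by positivity
  have htwo : 2 * (r / 2) = r := by ring
  refine ((hasFDerivAt_integral_of_dominated_loc_of_lip' (𝕜 := ℂ)
    (bound := fun a => 2 * bound a / (r / 2)) (ball_mem_nhds x hr2)
    (fun y hy => hmeas y (hsub (ball_subset_ball (by linarith) hy)))
    (hbi.mono' (hmeas x hx) (by filter_upwards [hb] with a ha using ha x hx))
    (aestronglyMeasurable_of_apply
      (aestronglyMeasurable_fderiv_apply (hU.mem_nhds hx) hmeas hda)) ?_ ?_ ?_).2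
      ).differentiableAt.differentiableWithinAt
  · filter_upwards [hd, hb] with a ha hba y hy
    exact norm_sub_le_of_bounded (f := fun p => f p a) hr2 (by rw [htwo]; exact ha.mono hsub)
      (fun z hz => hba z (hsub (htwo ▸ hz))) (ball_subset_closedBall hy)
      (mem_closedBall_self hr2.le)
  · simpa only [div_eq_mul_inv] using (hbi.const_mul 2).mul_const (r / 2)⁻¹
  · filter_upwards [hda] with a ha using ha.hasFDerivAt

end Integral

end SeveralVariables

/-! ### Holomorphic families of curves -/

section HolomorphicFamilies

variable {E V : Type*} [NormedAddCommGroup E] [NormedSpace ℂ E] [NormedAddCommGroup V]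
  [NormedSpace ℂ V] {Ω : Set E} {κ : ℝ}

/-- Families of curves `τ ↦ ξ τ p`, `τ ≥ 0`, depending holomorphically on `p ∈ Ω` and bounded
by `κ`. -/
structure IsHolomorphicFamily (Ω : Set E) (κ : ℝ) (ξ : ℝ → E → V) : Prop where
  continuousOn : ContinuousOn (fun q : ℝ × E => ξ q.1 q.2) (Ici 0 ×ˢ Ω)
  differentiableOn : ∀ τ ≥ 0, DifferentiableOn ℂ (ξ τ) Ω
  bound : ∀ τ ≥ 0, ∀ p ∈ Ω, ‖ξ τ p‖ ≤ κ

theorem IsHolomorphicFamily.of_norm_sub_le [CompleteSpace V] (hΩ : IsOpen Ω)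
    {u : ℕ → ℝ → E → V} {ξ : ℝ → E → V} {b : ℕ → ℝ} (hu : ∀ n, IsHolomorphicFamily Ω κ (u n))
    (hb : Tendsto b atTop (𝓝 0)) (hle : ∀ n, ∀ τ ≥ 0, ∀ p ∈ Ω, ‖u n τ p - ξ τ p‖ ≤ b n) :
    IsHolomorphicFamily Ω κ ξ := by
  have hunif : TendstoUniformlyOn (fun n (q : ℝ × E) => u n q.1 q.2) (fun q => ξ q.1 q.2) atTop
      (Ici 0 ×ˢ Ω) := by
    rw [Metric.tendstoUniformlyOn_iff]
    intro ε hε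
    filter_upwards [hb.eventually_lt_const hε] with n hn q hq
    rw [dist_comm, dist_eq_norm]
    exact (hle n q.1 hq.1 q.2 hq.2).trans_lt hn
  refine ⟨hunif.continuousOn (Frequently.of_forall fun n => (hu n).continuousOn),
    fun τ hτ => ?_, fun τ hτ p hp => ?_⟩
  · exact differentiableOn_of_tendstoUniformlyOn hΩ (fun n => (hu n).differentiableOn τ hτ)
      ((hunif.comp (fun p => (τ, p))).mono fun p hp => ⟨hτ, hp⟩)
  · exact le_of_tendsto (hunif.tendsto_at (x := (τ, p)) ⟨hτ, hp⟩).norm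
      (Eventually.of_forall fun n => (hu n).bound τ hτ p hp)

theorem exists_norm_sub_le_of_geometric {ι V : Type*} [NormedAddCommGroup V] [CompleteSpace V]
    {s : Set ι} {C : ℝ} {u : ℕ → ι → V} (hu : ∀ n, ∀ x ∈ s, ‖u n x - u (n + 1) x‖ ≤ C / 2 / 2 ^ n) :
    ∃ v : ι → V, ∀ n, ∀ x ∈ s, ‖u n x - v x‖ ≤ C / 2 ^ n := by
  have hdist : ∀ x ∈ s, ∀ n, dist (u n x) (u (n + 1) x) ≤ C / 2 / 2 ^ n := fun x hx n => by
    rw [dist_eq_norm]; exact hu n x hx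
  choose! v hv using fun x (hx : x ∈ s) =>
    cauchySeq_tendsto_of_complete (cauchySeq_of_le_geometric_two (hdist x hx))
  refine ⟨v, fun n x hx => ?_⟩
  rw [← dist_eq_norm]
  exact dist_le_of_le_geometric_two_of_tendsto (hdist x hx) (hv x hx) n

theorem exists_fixedPoint_of_contraction [CompleteSpace V] (hΩ : IsOpen Ω)
    (hκ : 0 ≤ κ) (T : (ℝ → E → V) → ℝ → E → V)
    (hT : ∀ ξ, IsHolomorphicFamily Ω κ ξ → IsHolomorphicFamily Ω κ (T ξ))
    (hc : ∀ ξ ζ, IsHolomorphicFamily Ω κ ξ → IsHolomorphicFamily Ω κ ζ → ∀ d : ℝ,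
      (∀ τ ≥ 0, ∀ p ∈ Ω, ‖ξ τ p - ζ τ p‖ ≤ d) → ∀ τ ≥ 0, ∀ p ∈ Ω, ‖T ξ τ p - T ζ τ p‖ ≤ d / 2) :
    ∃ ξ, IsHolomorphicFamily Ω κ ξ ∧ ∀ τ ≥ 0, ∀ p ∈ Ω, T ξ τ p = ξ τ p := by
  set u : ℕ → ℝ → E → V := fun n => T^[n] 0 with hu
  have hsucc : ∀ n, u (n + 1) = T (u n) := fun n => Function.iterate_succ_apply' _ _ _
  have hfam : ∀ n, IsHolomorphicFamily Ω κ (u n) := by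
    intro n
    induction n with
    | zero =>
      exact ⟨continuousOn_const, fun _ _ => differentiableOn_const _, fun _ _ _ _ => by simpa [hu]⟩
    | succ n ih => rw [hsucc]; exact hT _ ih
  have hstep : ∀ n, ∀ τ ≥ 0, ∀ p ∈ Ω, ‖u n τ p - u (n + 1) τ p‖ ≤ 4 * κ / 2 / 2 ^ n := by
    intro n
    induction n with
    | zero =>
      intro τ hτ p hp
      linarith [norm_sub_le (u 0 τ p) (u 1 τ p), (hfam 0).bound τ hτ p hp,
        (hfam 1).bound τ hτ p hp]
    | succ n ih =>
      rw [hsucc n, hsucc (n + 1), pow_succ, ← div_div]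
      exact hc _ _ (hfam n) (hfam (n + 1)) _ ih
  obtain ⟨ξ, hξ⟩ := exists_norm_sub_le_of_geometric (s := Ici (0 : ℝ) ×ˢ Ω)
    (u := fun n q => u n q.1 q.2) fun n q hq => hstep n q.1 hq.1 q.2 hq.2
  have hclose : ∀ n, ∀ τ ≥ 0, ∀ p ∈ Ω, ‖u n τ p - ξ (τ, p)‖ ≤ 4 * κ / 2 ^ n :=
    fun n τ hτ p hp => hξ n (τ, p) ⟨hτ, hp⟩
  have hsmall : Tendsto (fun n : ℕ => 4 * κ / 2 ^ n) atTop (𝓝 0) :=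
    tendsto_const_nhds.div_atTop (tendsto_pow_atTop_atTop_of_one_lt one_lt_two)
  have hlim : IsHolomorphicFamily Ω κ fun τ p => ξ (τ, p) := .of_norm_sub_le hΩ hfam hsmall hclose
  refine ⟨_, hlim, fun τ hτ p hp => tendsto_nhds_unique (f := fun n => u (n + 1) τ p) (l := atTop)
    ?_ ?_⟩
  · rw [tendsto_iff_norm_sub_tendsto_zero]
    refine squeeze_zero (fun _ => norm_nonneg _) (fun n => ?_) (by simpa using hsmall.div_const 2)
    rw [hsucc]
    exact hc _ _ (hfam n) hlim _ (hclose n) τ hτ p hp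
  · rw [tendsto_iff_norm_sub_tendsto_zero]
    exact squeeze_zero (fun _ => norm_nonneg _) (fun n => hclose (n + 1) τ hτ p hp)
      (hsmall.comp (tendsto_add_atTop_nat 1))

namespace IsHolomorphicFamily

variable {ξ : ℝ → E → V}

theorem mono_bound {κ' : ℝ} (h : IsHolomorphicFamily Ω κ ξ) (hκ : κ ≤ κ') :
    IsHolomorphicFamily Ω κ' ξ :=
  ⟨h.continuousOn, h.differentiableOn, fun τ hτ p hp => (h.bound τ hτ p hp).trans hκ⟩

theorem comp {W : Type*} [NormedAddCommGroup W] [NormedSpace ℂ W] {U : Set V} {φ : V → W} {C : ℝ}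
    (h : IsHolomorphicFamily Ω κ ξ) (hφ : DifferentiableOn ℂ φ U) (hC : ∀ v ∈ U, ‖φ v‖ ≤ C)
    (hmaps : ∀ τ ≥ 0, ∀ p ∈ Ω, ξ τ p ∈ U) : IsHolomorphicFamily Ω C fun τ p => φ (ξ τ p) :=
  ⟨hφ.continuousOn.comp h.continuousOn fun _ hq => hmaps _ hq.1 _ hq.2,
    fun τ hτ => hφ.comp (h.differentiableOn τ hτ) fun p hp => hmaps τ hτ p hp,
    fun τ hτ p hp => hC _ (hmaps τ hτ p hp)⟩

theorem continuousOn_time (h : IsHolomorphicFamily Ω κ ξ) {p : E} (hp : p ∈ Ω) :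
    ContinuousOn (fun s => ξ s p) (Ici 0) :=
  h.continuousOn.comp (f := fun s : ℝ => (s, p)) (by fun_prop) fun _ hs => ⟨hs, hp⟩

theorem intervalIntegrable (h : IsHolomorphicFamily Ω κ ξ) {p : E} (hp : p ∈ Ω) {a b : ℝ}
    (ha : 0 ≤ a) (hb : 0 ≤ b) : IntervalIntegrable (fun s => ξ s p) volume a b :=
  ((h.continuousOn_time hp).mono fun _ hs => (le_min ha hb).trans hs.1).intervalIntegrable

theorem norm_integral_le (h : IsHolomorphicFamily Ω κ ξ) {p : E} (hp : p ∈ Ω) {a b : ℝ}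
    (ha : 0 ≤ a) (hb : 0 ≤ b) : ‖∫ s in a..b, ξ s p‖ ≤ κ * |b - a| :=
  intervalIntegral.norm_integral_le_of_norm_le_const fun s hs =>
    h.bound s ((le_min ha hb).trans hs.1.le) p hp

theorem differentiableOn_primitive [FiniteDimensional ℂ E] [CompleteSpace V] (hΩ : IsOpen Ω)
    (h : IsHolomorphicFamily Ω κ ξ) {τ : ℝ} (hτ : 0 ≤ τ) :
    DifferentiableOn ℂ (fun p => ∫ s in (0 : ℝ)..τ, ξ s p) Ω := by
  simp only [intervalIntegral.integral_of_le hτ]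
  refine differentiableOn_integral (bound := fun _ => κ) hΩ (fun p hp => ?_) ?_ ?_
    (integrable_const _)
  · exact ((h.continuousOn_time hp).mono fun s hs => hs.1.le).aestronglyMeasurable
      measurableSet_Ioc
  · filter_upwards [ae_restrict_mem measurableSet_Ioc] with s hs
      using h.differentiableOn s hs.1.le
  · filter_upwards [ae_restrict_mem measurableSet_Ioc] with s hs p hp using h.bound s hs.1.le p hp

theorem continuousOn_primitive [FiniteDimensional ℂ E] [CompleteSpace V] (hΩ : IsOpen Ω)
    (h : IsHolomorphicFamily Ω κ ξ) :
    ContinuousOn (fun q : ℝ × E => ∫ s in (0 : ℝ)..q.1, ξ s q.2) (Ici 0 ×ˢ Ω) := by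
  rintro ⟨τ₀, p₀⟩ ⟨hτ₀, hp₀⟩
  have hspace : ContinuousWithinAt (fun q : ℝ × E => ∫ s in (0 : ℝ)..τ₀, ξ s q.2) (Ici 0 ×ˢ Ω)
      (τ₀, p₀) :=
    ContinuousWithinAt.comp (g := fun p => ∫ s in (0 : ℝ)..τ₀, ξ s p) (f := Prod.snd) (t := Ω)
      ((h.differentiableOn_primitive hΩ hτ₀).continuousOn p₀ hp₀)
      continuous_snd.continuousWithinAt fun q hq => hq.2
  have htime : Tendsto (fun q : ℝ × E => (∫ s in (0 : ℝ)..q.1, ξ s q.2) -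
      ∫ s in (0 : ℝ)..τ₀, ξ s q.2) (𝓝[Ici 0 ×ˢ Ω] (τ₀, p₀)) (𝓝 0) := by
    have hzero : Tendsto (fun q : ℝ × E => κ * |q.1 - τ₀|) (𝓝[Ici 0 ×ˢ Ω] (τ₀, p₀)) (𝓝 0) := by
      have hcont : Continuous fun q : ℝ × E => κ * |q.1 - τ₀| := by fun_prop
      simpa using (hcont.tendsto (τ₀, p₀)).mono_left nhdsWithin_le_nhds
    refine squeeze_zero_norm' ?_ hzero
    filter_upwards [self_mem_nhdsWithin] with q hq
    rw [intervalIntegral.integral_interval_sub_left (h.intervalIntegrable hq.2 le_rfl hq.1)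
      (h.intervalIntegrable hq.2 le_rfl hτ₀)]
    exact h.norm_integral_le hq.2 hτ₀ hq.1
  simpa [ContinuousWithinAt] using htime.add hspace

end IsHolomorphicFamily

end HolomorphicFamilies

/-! ### Sectors of opening less than `2π` -/

section Geometry

/-- The sector `0 < |h| < r`, `cos (arg h) > -γ`. Unlike a description by an interval of
arguments, this one needs no determination of `arg`. -/
def cosSector (γ r : ℝ) : Set ℂ := {h | 0 < ‖h‖ ∧ ‖h‖ < r ∧ -γ * ‖h‖ < h.re}

/-- The product of `cosSector γ r` and of the polydisc of poly-radius `(ρ, ρ)`. -/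
def cosDomain (γ r ρ : ℝ) : Set Phase := {p | p.1 ∈ cosSector γ r ∧ ‖p.2‖ < ρ}

theorem isOpen_cosSector (γ r : ℝ) : IsOpen (cosSector γ r) :=
  (isOpen_lt continuous_const continuous_norm).inter
    ((isOpen_lt continuous_norm continuous_const).inter
      (isOpen_lt (continuous_const.mul continuous_norm) Complex.continuous_re))

theorem isOpen_cosDomain (γ r ρ : ℝ) : IsOpen (cosDomain γ r ρ) :=
  ((isOpen_cosSector γ r).preimage continuous_fst).inter
    (isOpen_lt continuous_snd.norm continuous_const)

theorem cosSector_mono {γ γ' r r' : ℝ} (hγ : γ ≤ γ') (hr : r ≤ r') :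
    cosSector γ r ⊆ cosSector γ' r' := by
  rintro h ⟨hpos, hlt, hre⟩
  exact ⟨hpos, hlt.trans_le hr, by nlinarith⟩

theorem cosDomain_mono {γ γ' r r' ρ ρ' : ℝ} (hγ : γ ≤ γ') (hr : r ≤ r') (hρ : ρ ≤ ρ') :
    cosDomain γ r ρ ⊆ cosDomain γ' r' ρ' :=
  fun _ hp => ⟨cosSector_mono hγ hr hp.1, hp.2.trans_le hρ⟩

theorem one_add_mem_slitPlane {z : ℂ} (hz : ‖z‖ ≤ 1 / 2) : 1 + z ∈ Complex.slitPlane :=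
  Complex.mem_slitPlane_of_norm_lt_one (by linarith)

theorem one_sub_norm_le_norm_one_add (z : ℂ) : 1 - ‖z‖ ≤ ‖1 + z‖ := by
  simpa using norm_sub_norm_le (1 : ℂ) (-z)

variable {γ : ℝ} {z : ℂ}

theorem neg_mul_norm_inv_lt_re_inv_iff (hz : z ≠ 0) : -γ * ‖z⁻¹‖ < z⁻¹.re ↔ -γ * ‖z‖ < z.re := by
  rw [Complex.inv_re, Complex.normSq_eq_norm_sq, norm_inv, lt_div_iff₀ (by positivity)]
  rw [show -γ * ‖z‖⁻¹ * ‖z‖ ^ 2 = -γ * ‖z‖ by field_simp]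

theorem neg_mul_norm_add_lt_re (hγ0 : 0 ≤ γ) (hγ1 : γ ≤ 1) (hz : -γ * ‖z‖ < z.re) {τ : ℝ}
    (hτ : 0 ≤ τ) : -γ * ‖z + τ‖ < (z + τ).re := by
  have hnorm : ‖z‖ ≤ ‖z + τ‖ + τ := by
    simpa [abs_of_nonneg hτ] using norm_sub_le (z + τ) (τ : ℂ)
  rw [Complex.add_re, Complex.ofReal_re]
  nlinarith

theorem neg_mul_norm_mul_lt_re {γ' : ℝ} {ω : ℂ} (hγ' : 0 ≤ γ') (hz : -γ * ‖z‖ < z.re)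
    (hω : γ + ‖ω‖ * (1 + γ') ≤ γ') : -γ' * ‖z * (1 + ω)‖ < (z * (1 + ω)).re := by
  have hre : z.re - ‖z‖ * ‖ω‖ ≤ (z * (1 + ω)).re := by
    rw [mul_add, mul_one, Complex.add_re, ← norm_mul]
    linarith [neg_abs_le (z * ω).re, Complex.abs_re_le_norm (z * ω)]
  have hnorm : ‖z‖ * (1 - ‖ω‖) ≤ ‖z * (1 + ω)‖ := by
    rw [norm_mul]
    exact mul_le_mul_of_nonneg_left (one_sub_norm_le_norm_one_add ω) (norm_nonneg z)
  nlinarith [mul_le_mul_of_nonneg_left hnorm hγ', mul_le_mul_of_nonneg_left hω (norm_nonneg z)]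

variable {r : ℝ} {h : ℂ}

theorem cosSector_subset_slitPlane (hγ : γ ≤ 1) : cosSector γ r ⊆ Complex.slitPlane := by
  rintro h ⟨hpos, -, hre⟩
  by_contra hslit
  rw [Complex.mem_slitPlane_iff, not_or, not_lt, not_not] at hslit
  have hnorm := Complex.abs_re_eq_norm.2 hslit.2
  rw [abs_of_nonpos hslit.1] at hnorm
  nlinarith

theorem one_add_mul_mem_slitPlane (hγ : γ ≤ 1) (hh : h ∈ cosSector γ r) {τ : ℝ}
    (hτ : 0 ≤ τ) : 1 + τ * h ∈ Complex.slitPlane := by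
  rcases hτ.eq_or_lt with rfl | hτ
  · simp
  simp only [Complex.mem_slitPlane_iff, Complex.add_re, Complex.one_re, Complex.re_ofReal_mul,
    Complex.add_im, Complex.one_im, Complex.im_ofReal_mul, zero_add]
  exact (cosSector_subset_slitPlane hγ hh).imp (fun hre => by positivity)
    (fun him => mul_ne_zero hτ.ne' him)

theorem le_norm_one_add_mul (hγ0 : 0 ≤ γ) (hγ1 : γ < 1) (hh : h ∈ cosSector γ r) {τ : ℝ}
    (hτ : 0 ≤ τ) : (1 - γ) / 2 * (1 + τ * ‖h‖) ≤ ‖1 + τ * h‖ := by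
  obtain ⟨-, -, hre⟩ := hh
  have hsq : ‖1 + τ * h‖ ^ 2 = 1 + 2 * (τ * h.re) + (τ * ‖h‖) ^ 2 := by
    rw [mul_pow, ← Complex.normSq_eq_norm_sq, ← Complex.normSq_eq_norm_sq, Complex.normSq_apply,
      Complex.normSq_apply]
    simp only [Complex.add_re, Complex.one_re, Complex.re_ofReal_mul, Complex.add_im,
      Complex.one_im, Complex.im_ofReal_mul]
    ring
  have hτre : -γ * (τ * ‖h‖) ≤ τ * h.re := by nlinarith
  refine le_of_sq_le_sq ?_ (norm_nonneg _)
  rw [hsq]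
  nlinarith [mul_nonneg (by linarith : 0 ≤ 1 + γ) (sq_nonneg (1 - τ * ‖h‖)),
    mul_nonneg (mul_nonneg (by linarith : 0 ≤ 1 - γ) (by linarith : 0 ≤ 1 + γ))
      (sq_nonneg (1 + τ * ‖h‖))]

theorem norm_div_one_add_mul_le (hγ0 : 0 ≤ γ) (hγ1 : γ < 1) (hh : h ∈ cosSector γ r) {τ : ℝ}
    (hτ : 0 ≤ τ) {ω : ℂ} (hω : ‖ω‖ ≤ 1 / 2) :
    ‖h / ((1 + τ * h) * (1 + ω))‖ ≤ 4 / (1 - γ) * (‖h‖ / (1 + τ * ‖h‖)) := by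
  have hfactor := le_norm_one_add_mul hγ0 hγ1 hh hτ
  have hhalf : 1 / 2 ≤ ‖1 + ω‖ := by linarith [one_sub_norm_le_norm_one_add ω]
  have hγ' : 0 < 1 - γ := by linarith
  rw [norm_div, norm_mul]
  calc ‖h‖ / (‖1 + τ * h‖ * ‖1 + ω‖)
      ≤ ‖h‖ / ((1 - γ) / 2 * (1 + τ * ‖h‖) * (1 / 2)) := by gcongr
    _ = 4 / (1 - γ) * (‖h‖ / (1 + τ * ‖h‖)) := by field_simp; norm_num

theorem div_one_add_mul_mem_cosSector {γ₁ r₁ : ℝ} (hγ0 : 0 ≤ γ) (hγ1 : γ < 1)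
    (hh : h ∈ cosSector γ r) {τ : ℝ} (hτ : 0 ≤ τ) {ω : ℂ} (hω : ‖ω‖ ≤ 1 / 2)
    (hωγ : γ + ‖ω‖ * (1 + γ₁) ≤ γ₁) (hr : 4 / (1 - γ) * r ≤ r₁) :
    h / ((1 + τ * h) * (1 + ω)) ∈ cosSector γ₁ r₁ := by
  have hle := norm_div_one_add_mul_le hγ0 hγ1 hh hτ hω
  have hτh := Complex.slitPlane_ne_zero (one_add_mul_mem_slitPlane hγ1.le hh hτ)
  have hω1 := Complex.slitPlane_ne_zero (one_add_mem_slitPlane hω)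
  obtain ⟨hpos, hlt, hre⟩ := hh
  have hne : h ≠ 0 := norm_pos_iff.1 hpos
  refine ⟨norm_pos_iff.2 (div_ne_zero hne (mul_ne_zero hτh hω1)), ?_, ?_⟩
  · refine hle.trans_lt (lt_of_lt_of_le ?_ hr)
    gcongr
    exact (div_le_self hpos.le (le_add_of_nonneg_right (by positivity))).trans_lt hlt
  · have hinv : h / ((1 + τ * h) * (1 + ω)) = ((h⁻¹ + τ) * (1 + ω))⁻¹ := by field_simp
    have hsum : h⁻¹ + τ ≠ 0 := by
      rw [show h⁻¹ + τ = (1 + τ * h) / h by field_simp]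
      exact div_ne_zero hτh hne
    have hγ₁ : 0 ≤ γ₁ := by nlinarith [norm_nonneg ω]
    rw [hinv, neg_mul_norm_inv_lt_re_inv_iff (mul_ne_zero hsum hω1)]
    exact neg_mul_norm_mul_lt_re hγ₁ (neg_mul_norm_add_lt_re hγ0 hγ1.le
      ((neg_mul_norm_inv_lt_re_inv_iff hne).2 hre) hτ) hωγ

/-- The exponent `A log ((1 + τ h) (1 + ω))` by which the `𝐲`-coordinates decay along the flow; the
logarithm is split so as to be holomorphic. -/
def flowExponent (A : ℂ) (τ : ℝ) (h ω : ℂ) : ℂ :=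
  A * (Complex.log (1 + τ * h) + Complex.log (1 + ω))

/-- A bound of the growth of the `𝐲`-coordinates along the flow. -/
def growthBound (γ : ℝ) (A : ℂ) : ℝ :=
  Real.exp (-A.re * Real.log ((1 - γ) / 2) + |A.im| * Real.pi + ‖A‖ + 1)

theorem growthBound_pos (γ : ℝ) (A : ℂ) : 0 < growthBound γ A := Real.exp_pos _

theorem le_re_flowExponent {A : ℂ} (hA : 0 ≤ A.re) (hγ0 : 0 ≤ γ) (hγ1 : γ < 1)
    (hh : h ∈ cosSector γ r) {τ : ℝ} (hτ : 0 ≤ τ) {ω : ℂ} (hω : ‖ω‖ ≤ 1 / 2) :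
    A.re * Real.log ((1 - γ) / 2) - |A.im| * Real.pi - ‖A‖ ≤ (flowExponent A τ h ω).re := by
  have hmodulus : Real.log ((1 - γ) / 2) ≤ Real.log ‖1 + τ * h‖ := by
    refine Real.log_le_log (by linarith) (le_trans ?_ (le_norm_one_add_mul hγ0 hγ1 hh hτ))
    exact le_mul_of_one_le_right (by linarith) (le_add_of_nonneg_right (by positivity))
  have hargument : A.im * (1 + τ * h).arg ≤ |A.im| * Real.pi := by
    refine (le_abs_self _).trans ?_
    rw [abs_mul]
    gcongr
    exact Complex.abs_arg_le_pi _
  have hperturbation : -‖A‖ ≤ (A * Complex.log (1 + ω)).re := by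
    have hlog : ‖Complex.log (1 + ω)‖ ≤ 1 := by
      linarith [Complex.norm_log_one_add_half_le_self hω]
    have hle := Complex.abs_re_le_norm (A * Complex.log (1 + ω))
    rw [norm_mul] at hle
    linarith [neg_abs_le (A * Complex.log (1 + ω)).re,
      mul_le_of_le_one_right (norm_nonneg A) hlog]
  rw [flowExponent, mul_add, Complex.add_re, Complex.mul_re, Complex.log_re, Complex.log_im]
  nlinarith [mul_le_mul_of_nonneg_left hmodulus hA]

theorem norm_exp_sub_flowExponent_le {A : ℂ} (hA : 0 ≤ A.re) (hγ0 : 0 ≤ γ) (hγ1 : γ < 1)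
    (hh : h ∈ cosSector γ r) {τ : ℝ} (hτ : 0 ≤ τ) {ω e j : ℂ} (hω : ‖ω‖ ≤ 1 / 2) (he : ‖e‖ ≤ 1)
    (hj : j.re = 0) :
    ‖Complex.exp (j * τ - flowExponent A τ h ω + e)‖ ≤ growthBound γ A := by
  have hjτ : (j * (τ : ℂ)).re = 0 := by simp [hj]
  rw [Complex.norm_exp, growthBound, Real.exp_le_exp, Complex.add_re, Complex.sub_re, hjτ]
  linarith [le_re_flowExponent hA hγ0 hγ1 hh hτ hω, (Complex.re_le_norm e).trans he]

end Geometry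

/-! ### Perturbed trajectories -/

section Weight

variable {a : ℝ}

theorem hasDerivAt_neg_div_one_add_mul (ha : 0 ≤ a) {s : ℝ} (hs : 0 ≤ s) :
    HasDerivAt (fun s : ℝ => -(a / (1 + s * a))) ((a / (1 + s * a)) ^ 2) s := by
  have hden : HasDerivAt (fun s : ℝ => 1 + s * a) a s := by
    simpa using ((hasDerivAt_id s).mul_const a).const_add 1
  refine ((hasDerivAt_const s a).fun_div hden (by positivity)).fun_neg.congr_deriv ?_
  rw [div_pow]
  ring

theorem tendsto_div_one_add_mul (ha : 0 < a) :
    Tendsto (fun s : ℝ => a / (1 + s * a)) atTop (𝓝 0) :=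
  (tendsto_atTop_add_const_left _ _ (tendsto_id.atTop_mul_const ha)).const_div_atTop a

theorem integrableOn_div_one_add_mul_sq (ha : 0 < a) :
    IntegrableOn (fun s : ℝ => (a / (1 + s * a)) ^ 2) (Ioi 0) :=
  integrableOn_Ioi_deriv_of_nonneg' (fun _ hs => hasDerivAt_neg_div_one_add_mul ha.le hs)
    (fun _ _ => sq_nonneg _) (tendsto_div_one_add_mul ha).neg

theorem integral_div_one_add_mul_sq (ha : 0 < a) :
    ∫ s in Ioi (0 : ℝ), (a / (1 + s * a)) ^ 2 = a := by
  rw [integral_Ioi_of_hasDerivAt_of_nonneg'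
    (fun _ hs => hasDerivAt_neg_div_one_add_mul ha.le hs) (fun _ _ => sq_nonneg _)
    (tendsto_div_one_add_mul ha).neg]
  simp

theorem norm_setIntegral_le_mul {F : Type*} [NormedAddCommGroup F] [NormedSpace ℝ F] {f : ℝ → F}
    {M : ℝ} (ha : 0 < a) (hM : 0 ≤ M) {S : Set ℝ} (hS : MeasurableSet S) (hS0 : S ⊆ Ioi 0)
    (hf : ∀ s ∈ S, ‖f s‖ ≤ M * (a / (1 + s * a)) ^ 2) : ‖∫ s in S, f s‖ ≤ M * a := by
  have hint : IntegrableOn (fun s : ℝ => M * (a / (1 + s * a)) ^ 2) (Ioi 0) :=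
    (integrableOn_div_one_add_mul_sq ha).const_mul M
  calc ‖∫ s in S, f s‖
      ≤ ∫ s in S, M * (a / (1 + s * a)) ^ 2 :=
        norm_integral_le_of_norm_le (hint.mono_set hS0)
          (by filter_upwards [ae_restrict_mem hS] with s hs using hf s hs)
    _ ≤ ∫ s in Ioi 0, M * (a / (1 + s * a)) ^ 2 :=
        setIntegral_mono_set hint (Eventually.of_forall fun s => by positivity) hS0.eventuallyLE
    _ = M * a := by rw [integral_const_mul, integral_div_one_add_mul_sq ha]

end Weight

section Flow

/-- The perturbed position at time `τ` of the trajectory issued from `p`, the perturbation being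
encoded by `ξ = (ω, e₁, e₂)`. -/
def flowMap (j A : ℂ) (τ : ℝ) (p ξ : Phase) : Phase :=
  (p.1 / ((1 + τ * p.1) * (1 + ξ.1)),
    p.2.1 * Complex.exp (-j * τ - flowExponent A τ p.1 ξ.1 + ξ.2.1),
    p.2.2 * Complex.exp (j * τ - flowExponent A τ p.1 ξ.1 + ξ.2.2))

/-- Constants for which `flowMap j A` maps `cosDomain γ₀ r₀ ρ₀` into `cosDomain γ₁ r₁ ρ₁` for all
perturbations of norm at most `2 κ`. -/
structure IsFlowConstants (j A : ℂ) (γ₀ γ₁ r₀ r₁ ρ₀ ρ₁ κ : ℝ) : Prop where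
  j_re : j.re = 0
  A_nonneg : 0 ≤ A.re
  γ₀_nonneg : 0 ≤ γ₀
  γ₀_lt : γ₀ < 1
  κ_pos : 0 < κ
  κ_le : 2 * κ ≤ 1 / 2
  angle : γ₀ + 2 * κ * (1 + γ₁) ≤ γ₁
  radius : 4 / (1 - γ₀) * r₀ ≤ r₁
  polyradius : growthBound γ₀ A * ρ₀ ≤ ρ₁

variable {j A : ℂ}

theorem differentiableAt_flowMap {τ : ℝ} {q : Phase × Phase}
    (hτ : 1 + τ * q.1.1 ∈ Complex.slitPlane) (hω : 1 + q.2.1 ∈ Complex.slitPlane) :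
    DifferentiableAt ℂ (fun q : Phase × Phase => flowMap j A τ q.1 q.2) q := by
  have hne : (1 + τ * q.1.1) * (1 + q.2.1) ≠ 0 :=
    mul_ne_zero (Complex.slitPlane_ne_zero hτ) (Complex.slitPlane_ne_zero hω)
  have : DifferentiableAt ℂ (fun q : Phase × Phase => Complex.log (1 + τ * q.1.1)) q :=
    DifferentiableAt.clog (f := fun q : Phase × Phase => 1 + τ * q.1.1) (by fun_prop) hτ
  have : DifferentiableAt ℂ (fun q : Phase × Phase => Complex.log (1 + q.2.1)) q :=
    DifferentiableAt.clog (f := fun q : Phase × Phase => 1 + q.2.1) (by fun_prop) hω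
  unfold flowMap flowExponent
  refine DifferentiableAt.prodMk ?_ (DifferentiableAt.prodMk (by fun_prop) (by fun_prop))
  simp only [div_eq_mul_inv]
  exact DifferentiableAt.fun_mul (by fun_prop) (DifferentiableAt.fun_inv
    (h := fun q : Phase × Phase => (1 + τ * q.1.1) * (1 + q.2.1)) (by fun_prop) hne)

theorem continuousAt_flowMap {q : ℝ × Phase × Phase}
    (hτ : 1 + q.1 * q.2.1.1 ∈ Complex.slitPlane) (hω : 1 + q.2.2.1 ∈ Complex.slitPlane) :
    ContinuousAt (fun q : ℝ × Phase × Phase => flowMap j A q.1 q.2.1 q.2.2) q := by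
  have hne : (1 + q.1 * q.2.1.1) * (1 + q.2.2.1) ≠ 0 :=
    mul_ne_zero (Complex.slitPlane_ne_zero hτ) (Complex.slitPlane_ne_zero hω)
  have hlogτ : ContinuousAt (fun q : ℝ × Phase × Phase => Complex.log (1 + q.1 * q.2.1.1)) q :=
    ContinuousAt.clog (f := fun q : ℝ × Phase × Phase => 1 + (q.1 : ℂ) * q.2.1.1)
      (by fun_prop) hτ
  have hlogω : ContinuousAt (fun q : ℝ × Phase × Phase => Complex.log (1 + q.2.2.1)) q :=
    ContinuousAt.clog (f := fun q : ℝ × Phase × Phase => 1 + q.2.2.1) (by fun_prop) hω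
  unfold flowMap flowExponent
  refine ContinuousAt.prodMk ?_ (ContinuousAt.prodMk ?_ ?_)
  · exact ContinuousAt.div (by fun_prop) (by fun_prop) hne
  · fun_prop
  · fun_prop

namespace IsFlowConstants

variable {γ₀ γ₁ r₀ r₁ ρ₀ ρ₁ κ : ℝ}

theorem norm_flowMap_snd_le (hk : IsFlowConstants j A γ₀ γ₁ r₀ r₁ ρ₀ ρ₁ κ) {p : Phase}
    (hp : p.1 ∈ cosSector γ₀ r₀) {τ : ℝ} (hτ : 0 ≤ τ) {ξ : Phase} (hξ : ‖ξ‖ ≤ 2 * κ) :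
    ‖(flowMap j A τ p ξ).2‖ ≤ growthBound γ₀ A * ‖p.2‖ := by
  have hξ' : ‖ξ‖ ≤ 1 / 2 := hξ.trans hk.κ_le
  have hexp : ∀ i e : ℂ, i.re = 0 → ‖e‖ ≤ ‖ξ.2‖ →
      ‖Complex.exp (i * τ - flowExponent A τ p.1 ξ.1 + e)‖ ≤ growthBound γ₀ A := fun i e hi he =>
    norm_exp_sub_flowExponent_le hk.A_nonneg hk.γ₀_nonneg hk.γ₀_lt hp hτ
      ((norm_fst_le ξ).trans hξ') (by linarith [norm_snd_le ξ]) hi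
  have hbound := (growthBound_pos γ₀ A).le
  refine norm_prod_le_iff.2 ⟨?_, ?_⟩
  · rw [flowMap, norm_mul, mul_comm]
    exact mul_le_mul (hexp _ _ (by simp [hk.j_re]) (norm_fst_le ξ.2)) (norm_fst_le p.2)
      (norm_nonneg _) hbound
  · rw [flowMap, norm_mul, mul_comm]
    exact mul_le_mul (hexp _ _ hk.j_re (norm_snd_le ξ.2)) (norm_snd_le p.2) (norm_nonneg _) hbound

theorem norm_flowMap_fst_le (hk : IsFlowConstants j A γ₀ γ₁ r₀ r₁ ρ₀ ρ₁ κ) {p : Phase}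
    (hp : p.1 ∈ cosSector γ₀ r₀) {τ : ℝ} (hτ : 0 ≤ τ) {ξ : Phase} (hξ : ‖ξ‖ ≤ 2 * κ) :
    ‖(flowMap j A τ p ξ).1‖ ≤ 4 / (1 - γ₀) * (‖p.1‖ / (1 + τ * ‖p.1‖)) :=
  norm_div_one_add_mul_le hk.γ₀_nonneg hk.γ₀_lt hp hτ
    (((norm_fst_le ξ).trans hξ).trans hk.κ_le)

theorem flowMap_mem (hk : IsFlowConstants j A γ₀ γ₁ r₀ r₁ ρ₀ ρ₁ κ) {p : Phase}
    (hp : p ∈ cosDomain γ₀ r₀ ρ₀) {τ : ℝ} (hτ : 0 ≤ τ) {ξ : Phase} (hξ : ‖ξ‖ ≤ 2 * κ) :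
    flowMap j A τ p ξ ∈ cosDomain γ₁ r₁ ρ₁ := by
  have hω : ‖ξ.1‖ ≤ 2 * κ := (norm_fst_le ξ).trans hξ
  have hangle := hk.angle
  have hγ₁ : 0 ≤ 1 + γ₁ := by nlinarith [hk.κ_pos, hk.γ₀_nonneg, hk.κ_le]
  refine ⟨div_one_add_mul_mem_cosSector hk.γ₀_nonneg hk.γ₀_lt hp.1 hτ (hω.trans hk.κ_le) ?_
    hk.radius, (hk.norm_flowMap_snd_le hp.1 hτ hξ).trans_lt (lt_of_lt_of_le ?_ hk.polyradius)⟩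
  · linarith [mul_le_mul_of_nonneg_right hω hγ₁]
  · exact mul_lt_mul_of_pos_left hp.2 (growthBound_pos _ _)

theorem one_add_mem_slitPlane (hk : IsFlowConstants j A γ₀ γ₁ r₀ r₁ ρ₀ ρ₁ κ) {ξ : Phase}
    (hξ : ‖ξ‖ ≤ 2 * κ) : 1 + ξ.1 ∈ Complex.slitPlane :=
  SaddleNode.one_add_mem_slitPlane (((norm_fst_le ξ).trans hξ).trans hk.κ_le)

theorem isHolomorphicFamily_flowMap (hk : IsFlowConstants j A γ₀ γ₁ r₀ r₁ ρ₀ ρ₁ κ)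
    {ξ : ℝ → Phase → Phase} (hξ : IsHolomorphicFamily (cosDomain γ₀ r₀ ρ₀) (2 * κ) ξ) :
    IsHolomorphicFamily (cosDomain γ₀ r₀ ρ₀) (max r₁ ρ₁) fun s p => flowMap j A s p (ξ s p) := by
  have hω : ∀ s ≥ 0, ∀ p ∈ cosDomain γ₀ r₀ ρ₀, 1 + (ξ s p).1 ∈ Complex.slitPlane :=
    fun s hs p hp => hk.one_add_mem_slitPlane (hξ.bound s hs p hp)
  refine ⟨fun q hq => ?_, fun s hs p hp => ?_, fun s hs p hp => ?_⟩
  · exact ContinuousAt.comp_continuousWithinAt (f := fun q : ℝ × Phase => (q.1, q.2, ξ q.1 q.2))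
      (continuousAt_flowMap (one_add_mul_mem_slitPlane hk.γ₀_lt.le hq.2.1 hq.1)
        (hω _ hq.1 _ hq.2))
      (continuous_fst.continuousWithinAt.prodMk
        (continuous_snd.continuousWithinAt.prodMk (hξ.continuousOn q hq)))
  · exact DifferentiableAt.comp_differentiableWithinAt (f := fun p : Phase => (p, ξ s p)) p
      (differentiableAt_flowMap (one_add_mul_mem_slitPlane hk.γ₀_lt.le hp.1 hs) (hω s hs p hp))
      (differentiableWithinAt_id.prodMk (hξ.differentiableOn s hs p hp))
  · obtain ⟨hfst, hsnd⟩ := hk.flowMap_mem hp hs (hξ.bound s hs p hp)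
    exact norm_prod_le_iff.2
      ⟨hfst.2.1.le.trans (le_max_left _ _), hsnd.le.trans (le_max_right _ _)⟩

theorem isHolomorphicFamily_comp_flowMap (hk : IsFlowConstants j A γ₀ γ₁ r₀ r₁ ρ₀ ρ₁ κ)
    {ξ : ℝ → Phase → Phase} (hξ : IsHolomorphicFamily (cosDomain γ₀ r₀ ρ₀) κ ξ) {φ : Phase → ℂ}
    {M : ℝ} (hφ : DifferentiableOn ℂ φ (cosDomain γ₁ r₁ ρ₁))
    (hM : ∀ p ∈ cosDomain γ₁ r₁ ρ₁, ‖φ p‖ ≤ M) :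
    IsHolomorphicFamily (cosDomain γ₀ r₀ ρ₀) M fun s p => φ (flowMap j A s p (ξ s p)) := by
  have hξ' := hξ.mono_bound (by linarith [hk.κ_pos] : κ ≤ 2 * κ)
  exact (hk.isHolomorphicFamily_flowMap hξ').comp hφ hM fun s hs p hp =>
    hk.flowMap_mem hp hs (hξ'.bound s hs p hp)

theorem norm_comp_flowMap_sub_le (hk : IsFlowConstants j A γ₀ γ₁ r₀ r₁ ρ₀ ρ₁ κ)
    {φ : Phase → ℂ} {M : ℝ} (hφ : DifferentiableOn ℂ φ (cosDomain γ₁ r₁ ρ₁)) {p : Phase}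
    (hp : p ∈ cosDomain γ₀ r₀ ρ₀) {τ : ℝ} (hτ : 0 ≤ τ)
    (hM : ∀ ξ : Phase, ‖ξ‖ ≤ 2 * κ → ‖φ (flowMap j A τ p ξ)‖ ≤ M)
    {ξ ζ : Phase} (hξ : ‖ξ‖ ≤ κ) (hζ : ‖ζ‖ ≤ κ) :
    ‖φ (flowMap j A τ p ξ) - φ (flowMap j A τ p ζ)‖ ≤ 2 * M / κ * ‖ξ - ζ‖ := by
  have hdiff : DifferentiableOn ℂ (fun ξ => φ (flowMap j A τ p ξ)) (ball 0 (2 * κ)) := by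
    refine hφ.comp (fun ξ hξ => ?_) fun ξ hξ => hk.flowMap_mem hp hτ (mem_ball_zero_iff.1 hξ).le
    exact (DifferentiableAt.comp (f := fun ξ : Phase => (p, ξ)) ξ
      (differentiableAt_flowMap (one_add_mul_mem_slitPlane hk.γ₀_lt.le hp.1 hτ)
        (hk.one_add_mem_slitPlane (mem_ball_zero_iff.1 hξ).le))
      (by fun_prop)).differentiableWithinAt
  exact norm_sub_le_of_bounded hk.κ_pos hdiff (fun z hz => hM z (mem_ball_zero_iff.1 hz).le)
    (mem_closedBall_zero_iff.2 hξ) (mem_closedBall_zero_iff.2 hζ)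

theorem norm_comp_flowMap_le (hk : IsFlowConstants j A γ₀ γ₁ r₀ r₁ ρ₀ ρ₁ κ) {φ : Phase → ℂ}
    {C : ℝ} (hC : 0 ≤ C) (hφ : ∀ p ∈ cosDomain γ₁ r₁ ρ₁, ‖φ p‖ ≤ C * ‖p.1‖ ^ 2) {p : Phase}
    (hp : p ∈ cosDomain γ₀ r₀ ρ₀) {τ : ℝ} (hτ : 0 ≤ τ) {ξ : Phase} (hξ : ‖ξ‖ ≤ 2 * κ) :
    ‖φ (flowMap j A τ p ξ)‖ ≤ C * (4 / (1 - γ₀)) ^ 2 * (‖p.1‖ / (1 + τ * ‖p.1‖)) ^ 2 := by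
  refine (hφ _ (hk.flowMap_mem hp hτ hξ)).trans ?_
  rw [mul_assoc, ← mul_pow]
  gcongr
  exact hk.norm_flowMap_fst_le hp.1 hτ hξ

end IsFlowConstants

end Flow

/-! ### The flow as a fixed point -/

section Picard

/-- The vector field `-h² G ∂_h + (-j - A h G + B₁) y₁ ∂_{y₁} + (j - A h G + B₂) y₂ ∂_{y₂}`. -/
def radialField (j A : ℂ) (G B₁ B₂ : Phase → ℂ) (p : Phase) : Phase :=
  (-p.1 ^ 2 * G p, p.2.1 * (-j - A * p.1 * G p + B₁ p), p.2.2 * (j - A * p.1 * G p + B₂ p))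

/-- The coefficients of `radialField` are holomorphic on `cosDomain γ r ρ`, with `G` within `δ`
of `1` and `B₁`, `B₂` of order two in the first variable. -/
structure IsRadialData (γ r ρ δ C : ℝ) (G B₁ B₂ : Phase → ℂ) : Prop where
  δ_nonneg : 0 ≤ δ
  C_nonneg : 0 ≤ C
  diffG : DifferentiableOn ℂ G (cosDomain γ r ρ)
  diffB₁ : DifferentiableOn ℂ B₁ (cosDomain γ r ρ)
  diffB₂ : DifferentiableOn ℂ B₂ (cosDomain γ r ρ)
  boundG : ∀ p ∈ cosDomain γ r ρ, ‖G p - 1‖ ≤ δ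
  boundB₁ : ∀ p ∈ cosDomain γ r ρ, ‖B₁ p‖ ≤ C * ‖p.1‖ ^ 2
  boundB₂ : ∀ p ∈ cosDomain γ r ρ, ‖B₂ p‖ ≤ C * ‖p.1‖ ^ 2

/-- The operator whose fixed point encodes the flow of `radialField`: substituting
`flowMap j A τ p (ω, e₁, e₂)` into the differential equation gives
`((1 + τ h) ω / h)' = G - 1`, `e₁' = B₁` and `e₂' = B₂`. -/
def picardOperator (j A : ℂ) (G B₁ B₂ : Phase → ℂ) (ξ : ℝ → Phase → Phase) (τ : ℝ) (p : Phase) :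
    Phase :=
  (p.1 / (1 + τ * p.1) * ∫ s in (0 : ℝ)..τ, (G (flowMap j A s p (ξ s p)) - 1),
    ∫ s in (0 : ℝ)..τ, B₁ (flowMap j A s p (ξ s p)),
    ∫ s in (0 : ℝ)..τ, B₂ (flowMap j A s p (ξ s p)))

variable {j A : ℂ} {γ₀ γ₁ r₀ r₁ ρ₀ ρ₁ κ δ C : ℝ} {φ G B₁ B₂ : Phase → ℂ}

theorem norm_le_of_norm_le_sq {γ r ρ : ℝ} (hC : 0 ≤ C)
    (hφ : ∀ p ∈ cosDomain γ r ρ, ‖φ p‖ ≤ C * ‖p.1‖ ^ 2) :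
    ∀ p ∈ cosDomain γ r ρ, ‖φ p‖ ≤ C * r ^ 2 := fun p hp => by
  have hlt := hp.1.2.1.le
  exact (hφ p hp).trans (by gcongr)

theorem norm_div_mul_integral_le (hγ0 : 0 ≤ γ₀) (hγ1 : γ₀ < 1) {h : ℂ}
    (hh : h ∈ cosSector γ₀ r₀) {τ : ℝ} (hτ : 0 ≤ τ) {f : ℝ → ℂ} (hδ : 0 ≤ δ)
    (hf : ∀ s ∈ Ioc 0 τ, ‖f s‖ ≤ δ) :
    ‖h / (1 + τ * h) * ∫ s in (0 : ℝ)..τ, f s‖ ≤ 2 / (1 - γ₀) * δ := by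
  have hfactor := le_norm_one_add_mul hγ0 hγ1 hh hτ
  have hintegral : ‖∫ s in (0 : ℝ)..τ, f s‖ ≤ δ * |τ - 0| :=
    intervalIntegral.norm_integral_le_of_norm_le_const (by rwa [uIoc_of_le hτ])
  rw [sub_zero, abs_of_nonneg hτ] at hintegral
  have hγ' : 0 < 1 - γ₀ := by linarith
  rw [norm_mul, norm_div]
  calc ‖h‖ / ‖1 + τ * h‖ * ‖∫ s in (0 : ℝ)..τ, f s‖
      ≤ ‖h‖ / ((1 - γ₀) / 2 * (1 + τ * ‖h‖)) * (δ * τ) := by gcongr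
    _ = 2 / (1 - γ₀) * δ * (τ * ‖h‖ / (1 + τ * ‖h‖)) := by field_simp
    _ ≤ 2 / (1 - γ₀) * δ * 1 := by
        gcongr
        rw [div_le_one (by positivity)]
        linarith
    _ = 2 / (1 - γ₀) * δ := mul_one _

namespace IsFlowConstants

theorem norm_integral_flowMap_le (hk : IsFlowConstants j A γ₀ γ₁ r₀ r₁ ρ₀ ρ₁ κ) (hC : 0 ≤ C)
    (hφ : ∀ p ∈ cosDomain γ₁ r₁ ρ₁, ‖φ p‖ ≤ C * ‖p.1‖ ^ 2) {ξ : ℝ → Phase → Phase}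
    (hξ : IsHolomorphicFamily (cosDomain γ₀ r₀ ρ₀) κ ξ) {τ : ℝ} (hτ : 0 ≤ τ) {p : Phase}
    (hp : p ∈ cosDomain γ₀ r₀ ρ₀) :
    ‖∫ s in (0 : ℝ)..τ, φ (flowMap j A s p (ξ s p))‖ ≤ C * (4 / (1 - γ₀)) ^ 2 * r₀ := by
  have hκ := hk.κ_pos
  have hlt := hp.1.2.1.le
  rw [intervalIntegral.integral_of_le hτ]
  exact (norm_setIntegral_le_mul hp.1.1 (by positivity) measurableSet_Ioc (fun s hs => hs.1)
    fun s hs => hk.norm_comp_flowMap_le hC hφ hp hs.1.le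
      ((hξ.bound s hs.1.le p hp).trans (by linarith))).trans (by gcongr)

theorem norm_integral_flowMap_sub_le (hk : IsFlowConstants j A γ₀ γ₁ r₀ r₁ ρ₀ ρ₁ κ)
    (hC : 0 ≤ C) (hdφ : DifferentiableOn ℂ φ (cosDomain γ₁ r₁ ρ₁))
    (hφ : ∀ p ∈ cosDomain γ₁ r₁ ρ₁, ‖φ p‖ ≤ C * ‖p.1‖ ^ 2) {ξ ζ : ℝ → Phase → Phase}
    (hξ : IsHolomorphicFamily (cosDomain γ₀ r₀ ρ₀) κ ξ)
    (hζ : IsHolomorphicFamily (cosDomain γ₀ r₀ ρ₀) κ ζ) {p : Phase}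
    (hp : p ∈ cosDomain γ₀ r₀ ρ₀) {d : ℝ} (hd : ∀ τ ≥ 0, ‖ξ τ p - ζ τ p‖ ≤ d) {τ : ℝ}
    (hτ : 0 ≤ τ) :
    ‖(∫ s in (0 : ℝ)..τ, φ (flowMap j A s p (ξ s p))) -
      ∫ s in (0 : ℝ)..τ, φ (flowMap j A s p (ζ s p))‖ ≤
        C * (4 / (1 - γ₀)) ^ 2 * r₀ * (2 * d / κ) := by
  have hκ := hk.κ_pos
  have hd0 : 0 ≤ d := (norm_nonneg _).trans (hd τ hτ)
  have hlt := hp.1.2.1.le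
  have hint : ∀ ξ, IsHolomorphicFamily (cosDomain γ₀ r₀ ρ₀) κ ξ →
      IntervalIntegrable (fun s => φ (flowMap j A s p (ξ s p))) volume 0 τ := fun ξ hξ =>
    (hk.isHolomorphicFamily_comp_flowMap hξ hdφ (norm_le_of_norm_le_sq hC hφ)).intervalIntegrable
      hp le_rfl hτ
  rw [← intervalIntegral.integral_sub (hint ξ hξ) (hint ζ hζ), intervalIntegral.integral_of_le hτ]
  calc ‖∫ s in Ioc 0 τ, (φ (flowMap j A s p (ξ s p)) - φ (flowMap j A s p (ζ s p)))‖
      ≤ C * (4 / (1 - γ₀)) ^ 2 * (2 * d / κ) * ‖p.1‖ := by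
        refine norm_setIntegral_le_mul hp.1.1 (by positivity) measurableSet_Ioc
          (fun s hs => hs.1) fun s hs => ?_
        refine (hk.norm_comp_flowMap_sub_le hdφ hp hs.1.le
          (fun ξ hξ => hk.norm_comp_flowMap_le hC hφ hp hs.1.le hξ) (hξ.bound s hs.1.le p hp)
          (hζ.bound s hs.1.le p hp)).trans ?_
        calc 2 * (C * (4 / (1 - γ₀)) ^ 2 * (‖p.1‖ / (1 + s * ‖p.1‖)) ^ 2) / κ * ‖ξ s p - ζ s p‖
            ≤ 2 * (C * (4 / (1 - γ₀)) ^ 2 * (‖p.1‖ / (1 + s * ‖p.1‖)) ^ 2) / κ * d := by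
              gcongr; exact hd s hs.1.le
          _ = C * (4 / (1 - γ₀)) ^ 2 * (2 * d / κ) * (‖p.1‖ / (1 + s * ‖p.1‖)) ^ 2 := by ring
    _ ≤ C * (4 / (1 - γ₀)) ^ 2 * (2 * d / κ) * r₀ := by gcongr
    _ = C * (4 / (1 - γ₀)) ^ 2 * r₀ * (2 * d / κ) := by ring

theorem norm_div_mul_integral_flowMap_sub_le
    (hk : IsFlowConstants j A γ₀ γ₁ r₀ r₁ ρ₀ ρ₁ κ)
    (hdφ : DifferentiableOn ℂ φ (cosDomain γ₁ r₁ ρ₁))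
    (hφ : ∀ p ∈ cosDomain γ₁ r₁ ρ₁, ‖φ p‖ ≤ δ) {ξ ζ : ℝ → Phase → Phase}
    (hξ : IsHolomorphicFamily (cosDomain γ₀ r₀ ρ₀) κ ξ)
    (hζ : IsHolomorphicFamily (cosDomain γ₀ r₀ ρ₀) κ ζ) {p : Phase}
    (hp : p ∈ cosDomain γ₀ r₀ ρ₀) {d : ℝ} (hd : ∀ τ ≥ 0, ‖ξ τ p - ζ τ p‖ ≤ d) {τ : ℝ}
    (hτ : 0 ≤ τ) :
    ‖p.1 / (1 + τ * p.1) * (∫ s in (0 : ℝ)..τ, φ (flowMap j A s p (ξ s p))) -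
      p.1 / (1 + τ * p.1) * ∫ s in (0 : ℝ)..τ, φ (flowMap j A s p (ζ s p))‖ ≤
        2 / (1 - γ₀) * δ * (2 * d / κ) := by
  have hκ := hk.κ_pos
  have hd0 : 0 ≤ d := (norm_nonneg _).trans (hd τ hτ)
  have hδ : 0 ≤ δ := (norm_nonneg _).trans
    (hφ _ (hk.flowMap_mem hp hτ (ξ := 0) (by simpa using hκ.le)))
  have hint : ∀ ξ, IsHolomorphicFamily (cosDomain γ₀ r₀ ρ₀) κ ξ →
      IntervalIntegrable (fun s => φ (flowMap j A s p (ξ s p))) volume 0 τ := fun ξ hξ =>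
    (hk.isHolomorphicFamily_comp_flowMap hξ hdφ hφ).intervalIntegrable hp le_rfl hτ
  rw [← mul_sub, ← intervalIntegral.integral_sub (hint ξ hξ) (hint ζ hζ), mul_assoc]
  refine norm_div_mul_integral_le hk.γ₀_nonneg hk.γ₀_lt hp.1 hτ (by positivity) fun s hs => ?_
  calc ‖φ (flowMap j A s p (ξ s p)) - φ (flowMap j A s p (ζ s p))‖
      ≤ 2 * δ / κ * ‖ξ s p - ζ s p‖ :=
        hk.norm_comp_flowMap_sub_le hdφ hp hs.1.le
          (fun ξ hξ => hφ _ (hk.flowMap_mem hp hs.1.le hξ)) (hξ.bound s hs.1.le p hp)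
          (hζ.bound s hs.1.le p hp)
    _ ≤ 2 * δ / κ * d := by gcongr; exact hd s hs.1.le
    _ = δ * (2 * d / κ) := by ring

theorem norm_picardOperator_le (hk : IsFlowConstants j A γ₀ γ₁ r₀ r₁ ρ₀ ρ₁ κ)
    (hX : IsRadialData γ₁ r₁ ρ₁ δ C G B₁ B₂) (hδ : 2 / (1 - γ₀) * δ ≤ κ / 4)
    (hC : C * (4 / (1 - γ₀)) ^ 2 * r₀ ≤ κ / 4) {ξ : ℝ → Phase → Phase}
    (hξ : IsHolomorphicFamily (cosDomain γ₀ r₀ ρ₀) κ ξ) {τ : ℝ} (hτ : 0 ≤ τ) {p : Phase}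
    (hp : p ∈ cosDomain γ₀ r₀ ρ₀) : ‖picardOperator j A G B₁ B₂ ξ τ p‖ ≤ κ := by
  have hκ : κ / 4 ≤ κ := by linarith [hk.κ_pos]
  refine norm_prod_le_iff.2 ⟨(norm_div_mul_integral_le hk.γ₀_nonneg hk.γ₀_lt hp.1 hτ hX.δ_nonneg
    fun s hs => ?_).trans (hδ.trans hκ), norm_prod_le_iff.2 ⟨?_, ?_⟩⟩
  · exact hX.boundG _ (hk.flowMap_mem hp hs.1.le
      ((hξ.bound s hs.1.le p hp).trans (by linarith)))
  · exact (hk.norm_integral_flowMap_le hX.C_nonneg hX.boundB₁ hξ hτ hp).trans (hC.trans hκ)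
  · exact (hk.norm_integral_flowMap_le hX.C_nonneg hX.boundB₂ hξ hτ hp).trans (hC.trans hκ)

theorem isHolomorphicFamily_picardOperator (hk : IsFlowConstants j A γ₀ γ₁ r₀ r₁ ρ₀ ρ₁ κ)
    (hX : IsRadialData γ₁ r₁ ρ₁ δ C G B₁ B₂) (hδ : 2 / (1 - γ₀) * δ ≤ κ / 4)
    (hC : C * (4 / (1 - γ₀)) ^ 2 * r₀ ≤ κ / 4) {ξ : ℝ → Phase → Phase}
    (hξ : IsHolomorphicFamily (cosDomain γ₀ r₀ ρ₀) κ ξ) :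
    IsHolomorphicFamily (cosDomain γ₀ r₀ ρ₀) κ (picardOperator j A G B₁ B₂ ξ) := by
  have hopen := isOpen_cosDomain γ₀ r₀ ρ₀
  have hG := hk.isHolomorphicFamily_comp_flowMap hξ (hX.diffG.sub_const 1) hX.boundG
  have hB₁ := hk.isHolomorphicFamily_comp_flowMap hξ hX.diffB₁
    (norm_le_of_norm_le_sq hX.C_nonneg hX.boundB₁)
  have hB₂ := hk.isHolomorphicFamily_comp_flowMap hξ hX.diffB₂
    (norm_le_of_norm_le_sq hX.C_nonneg hX.boundB₂)
  have hne : ∀ τ : ℝ, 0 ≤ τ → ∀ p ∈ cosDomain γ₀ r₀ ρ₀, 1 + (τ : ℂ) * p.1 ≠ 0 := fun τ hτ p hp =>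
    Complex.slitPlane_ne_zero (one_add_mul_mem_slitPlane hk.γ₀_lt.le hp.1 hτ)
  refine ⟨?_, fun τ hτ => ?_, fun τ hτ p hp => hk.norm_picardOperator_le hX hδ hC hξ hτ hp⟩
  · exact ContinuousOn.prodMk (ContinuousOn.mul (ContinuousOn.div (by fun_prop) (by fun_prop)
      fun q hq => hne q.1 hq.1 q.2 hq.2) (hG.continuousOn_primitive hopen))
      ((hB₁.continuousOn_primitive hopen).prodMk (hB₂.continuousOn_primitive hopen))
  · have hdiv : DifferentiableOn ℂ (fun p : Phase => p.1 / (1 + τ * p.1))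
        (cosDomain γ₀ r₀ ρ₀) := by
      simp only [div_eq_mul_inv]
      exact DifferentiableOn.fun_mul (by fun_prop)
        (DifferentiableOn.fun_inv (by fun_prop) fun p hp => hne τ hτ p hp)
    exact (hdiv.mul (hG.differentiableOn_primitive hopen hτ)).prodMk
      ((hB₁.differentiableOn_primitive hopen hτ).prodMk (hB₂.differentiableOn_primitive hopen hτ))

theorem norm_picardOperator_sub_le (hk : IsFlowConstants j A γ₀ γ₁ r₀ r₁ ρ₀ ρ₁ κ)
    (hX : IsRadialData γ₁ r₁ ρ₁ δ C G B₁ B₂) (hδ : 2 / (1 - γ₀) * δ ≤ κ / 4)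
    (hC : C * (4 / (1 - γ₀)) ^ 2 * r₀ ≤ κ / 4) {ξ ζ : ℝ → Phase → Phase}
    (hξ : IsHolomorphicFamily (cosDomain γ₀ r₀ ρ₀) κ ξ)
    (hζ : IsHolomorphicFamily (cosDomain γ₀ r₀ ρ₀) κ ζ) {p : Phase}
    (hp : p ∈ cosDomain γ₀ r₀ ρ₀) {d : ℝ} (hd : ∀ τ ≥ 0, ‖ξ τ p - ζ τ p‖ ≤ d) {τ : ℝ}
    (hτ : 0 ≤ τ) :
    ‖picardOperator j A G B₁ B₂ ξ τ p - picardOperator j A G B₁ B₂ ζ τ p‖ ≤ d / 2 := by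
  have hκ := hk.κ_pos
  have hd0 : 0 ≤ d := (norm_nonneg _).trans (hd τ hτ)
  have hhalf : ∀ K ≤ κ / 4, K * (2 * d / κ) ≤ d / 2 := fun K hK =>
    calc K * (2 * d / κ) ≤ κ / 4 * (2 * d / κ) := by gcongr
      _ = d / 2 := by field_simp; norm_num
  exact norm_prod_le_iff.2
    ⟨(hk.norm_div_mul_integral_flowMap_sub_le (hX.diffG.sub_const 1) hX.boundG hξ hζ hp hd
        hτ).trans (hhalf _ hδ),
      norm_prod_le_iff.2
        ⟨(hk.norm_integral_flowMap_sub_le hX.C_nonneg hX.diffB₁ hX.boundB₁ hξ hζ hp hd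
            hτ).trans (hhalf _ hC),
          (hk.norm_integral_flowMap_sub_le hX.C_nonneg hX.diffB₂ hX.boundB₂ hξ hζ hp hd
            hτ).trans (hhalf _ hC)⟩⟩

theorem exists_picardOperator_eq (hk : IsFlowConstants j A γ₀ γ₁ r₀ r₁ ρ₀ ρ₁ κ)
    (hX : IsRadialData γ₁ r₁ ρ₁ δ C G B₁ B₂) (hδ : 2 / (1 - γ₀) * δ ≤ κ / 4)
    (hC : C * (4 / (1 - γ₀)) ^ 2 * r₀ ≤ κ / 4) :
    ∃ ξ, IsHolomorphicFamily (cosDomain γ₀ r₀ ρ₀) κ ξ ∧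
      ∀ τ ≥ 0, ∀ p ∈ cosDomain γ₀ r₀ ρ₀, picardOperator j A G B₁ B₂ ξ τ p = ξ τ p :=
  exists_fixedPoint_of_contraction (isOpen_cosDomain _ _ _) hk.κ_pos.le _
    (fun _ hξ => hk.isHolomorphicFamily_picardOperator hX hδ hC hξ)
    fun _ _ hξ hζ _ hd _ hτ _ hp =>
      hk.norm_picardOperator_sub_le hX hδ hC hξ hζ hp (fun s hs => hd s hs _ hp) hτ

end IsFlowConstants

end Picard

section FlowEquation

variable {j A h : ℂ} {p : Phase} {τ : ℝ}

theorem hasDerivWithinAt_one_add_mul (h : ℂ) (τ : ℝ) (s : Set ℝ) :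
    HasDerivWithinAt (fun t : ℝ => 1 + (t : ℂ) * h) h s τ := by
  simpa using (((hasDerivAt_id τ).ofReal_comp.mul_const h).const_add 1).hasDerivWithinAt

theorem hasDerivWithinAt_div_one_add_mul_mul {ω J : ℝ → ℂ} {g : ℂ} {s : Set ℝ} (hτ : τ ∈ s)
    (hω : ∀ t ∈ s, ω t = h / (1 + t * h) * J t) (hne : 1 + τ * h ≠ 0)
    (hJ : HasDerivWithinAt J (g - 1) s τ) :
    HasDerivWithinAt ω (h * (g - 1 - ω τ) / (1 + τ * h)) s τ := by
  refine (((hasDerivWithinAt_const τ s h).fun_div (hasDerivWithinAt_one_add_mul h τ s)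
    hne).fun_mul hJ).congr_deriv ?_ |>.congr hω (hω τ hτ)
  rw [hω τ hτ]
  field_simp
  ring

theorem hasDerivWithinAt_flowExponent {ω : ℝ → ℂ} {g : ℂ} {s : Set ℝ}
    (hτ : 1 + τ * h ∈ Complex.slitPlane) (hω : 1 + ω τ ∈ Complex.slitPlane)
    (hω' : HasDerivWithinAt ω (h * (g - 1 - ω τ) / (1 + τ * h)) s τ) :
    HasDerivWithinAt (fun t => flowExponent A t h (ω t))
      (A * (h / ((1 + τ * h) * (1 + ω τ))) * g) s τ := by
  have := Complex.slitPlane_ne_zero hτ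
  have hω0 := Complex.slitPlane_ne_zero hω
  refine ((((hasDerivWithinAt_one_add_mul h τ s).clog_real hτ).fun_add
    ((hω'.const_add 1).clog_real hω)).const_mul A).congr_deriv ?_
  field_simp
  ring

theorem hasDerivWithinAt_flowMap {G B₁ B₂ : Phase → ℂ} {ξ : ℝ → Phase} {s : Set ℝ}
    (hτ : 1 + τ * p.1 ∈ Complex.slitPlane) (hω : 1 + (ξ τ).1 ∈ Complex.slitPlane)
    (hω' : HasDerivWithinAt (fun t => (ξ t).1)
      (p.1 * (G (flowMap j A τ p (ξ τ)) - 1 - (ξ τ).1) / (1 + τ * p.1)) s τ)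
    (he₁ : HasDerivWithinAt (fun t => (ξ t).2.1) (B₁ (flowMap j A τ p (ξ τ))) s τ)
    (he₂ : HasDerivWithinAt (fun t => (ξ t).2.2) (B₂ (flowMap j A τ p (ξ τ))) s τ) :
    HasDerivWithinAt (fun t => flowMap j A t p (ξ t))
      (radialField j A G B₁ B₂ (flowMap j A τ p (ξ τ))) s τ := by
  have hτ0 := Complex.slitPlane_ne_zero hτ
  have hω0 := Complex.slitPlane_ne_zero hω
  have hid : HasDerivWithinAt (fun t : ℝ => (t : ℂ)) 1 s τ :=
    (hasDerivAt_id τ).ofReal_comp.hasDerivWithinAt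
  have hexponent := hasDerivWithinAt_flowExponent (A := A) hτ hω hω'
  refine HasDerivWithinAt.prodMk ?_ (HasDerivWithinAt.prodMk ?_ ?_)
  · refine ((hasDerivWithinAt_const τ s p.1).fun_div ((hasDerivWithinAt_one_add_mul p.1 τ s).fun_mul
      (hω'.const_add 1)) (mul_ne_zero hτ0 hω0)).congr_deriv ?_
    generalize G (flowMap j A τ p (ξ τ)) = g
    simp only [flowMap]
    field_simp
    ring
  · refine ((((hid.const_mul (-j)).fun_sub hexponent).fun_add he₁).cexp.const_mul
      p.2.1).congr_deriv ?_
    simp only [flowMap, mul_one]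
    ring
  · refine ((((hid.const_mul j).fun_sub hexponent).fun_add he₂).cexp.const_mul
      p.2.2).congr_deriv ?_
    simp only [flowMap, mul_one]
    ring

end FlowEquation

theorem hasDerivWithinAt_primitive {f : ℝ → ℂ} (hf : ContinuousOn f (Ici 0)) {τ : ℝ}
    (hτ : 0 ≤ τ) : HasDerivWithinAt (fun t => ∫ s in (0 : ℝ)..t, f s) (f τ) (Ici τ) τ := by
  have hsub : Ioi τ ⊆ Ici 0 := fun s hs => hτ.trans (le_of_lt hs)
  have hint : IntervalIntegrable f volume 0 τ :=
    (hf.mono fun s hs => (uIcc_of_le hτ ▸ hs).1).intervalIntegrable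
  exact intervalIntegral.integral_hasDerivWithinAt_right hint
    ((hf.mono hsub).stronglyMeasurableAtFilter_nhdsWithin measurableSet_Ioi τ)
    ((hf τ hτ).mono hsub)

/-! ### Attracted semiflows -/

/-- A holomorphic semiflow of `X`, defined on `Ω` with values in `U`, attracted by `{x = 0}` at
the rate `1 / τ` and with bounded growth in `𝐲`. -/
structure IsAttractedSemiflow (Ω U : Set Phase) (X : Phase → Phase) (K : ℝ)
    (Φ : ℝ → Phase → Phase) : Prop where
  continuousOn : ContinuousOn (fun q : ℝ × Phase => Φ q.1 q.2) (Ici 0 ×ˢ Ω)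
  differentiableOn : ∀ τ ≥ 0, DifferentiableOn ℂ (Φ τ) Ω
  mapsTo : ∀ τ ≥ 0, ∀ p ∈ Ω, Φ τ p ∈ U
  map_zero : ∀ p ∈ Ω, Φ 0 p = p
  deriv : ∀ τ ≥ 0, ∀ p ∈ Ω, HasDerivWithinAt (fun t => Φ t p) (X (Φ τ p)) (Ici τ) τ
  norm_fst_le : ∀ τ ≥ 0, ∀ p ∈ Ω, ‖(Φ τ p).1‖ ≤ K * (‖p.1‖ / (1 + τ * ‖p.1‖))
  norm_snd_le : ∀ τ ≥ 0, ∀ p ∈ Ω, ‖(Φ τ p).2‖ ≤ K * ‖p.2‖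

namespace IsFlowConstants

variable {j A : ℂ} {γ₀ γ₁ r₀ r₁ ρ₀ ρ₁ κ δ C : ℝ} {G B₁ B₂ : Phase → ℂ}

theorem hasDerivWithinAt_flowMap_of_picardOperator_eq
    (hk : IsFlowConstants j A γ₀ γ₁ r₀ r₁ ρ₀ ρ₁ κ) (hX : IsRadialData γ₁ r₁ ρ₁ δ C G B₁ B₂)
    {ξ : ℝ → Phase → Phase} (hξ : IsHolomorphicFamily (cosDomain γ₀ r₀ ρ₀) (2 * κ) ξ)
    (hfix : ∀ τ ≥ 0, ∀ p ∈ cosDomain γ₀ r₀ ρ₀, picardOperator j A G B₁ B₂ ξ τ p = ξ τ p)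
    {τ : ℝ} (hτ : 0 ≤ τ) {p : Phase} (hp : p ∈ cosDomain γ₀ r₀ ρ₀) :
    HasDerivWithinAt (fun t => flowMap j A t p (ξ t p))
      (radialField j A G B₁ B₂ (flowMap j A τ p (ξ τ p))) (Ici τ) τ := by
  have hslit := one_add_mul_mem_slitPlane hk.γ₀_lt.le hp.1 hτ
  have hprimitive : ∀ φ : Phase → ℂ, DifferentiableOn ℂ φ (cosDomain γ₁ r₁ ρ₁) →
      HasDerivWithinAt (fun t => ∫ s in (0 : ℝ)..t, φ (flowMap j A s p (ξ s p)))
        (φ (flowMap j A τ p (ξ τ p))) (Ici τ) τ := fun φ hφ =>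
    hasDerivWithinAt_primitive (hφ.continuousOn.comp
      ((hk.isHolomorphicFamily_flowMap hξ).continuousOn_time hp)
      fun s hs => hk.flowMap_mem hp hs (hξ.bound s hs p hp)) hτ
  have hfix' : ∀ t ∈ Ici τ, ξ t p = picardOperator j A G B₁ B₂ ξ t p := fun t ht =>
    (hfix t (hτ.trans ht) p hp).symm
  refine hasDerivWithinAt_flowMap (ξ := fun t => ξ t p) hslit
    (hk.one_add_mem_slitPlane (hξ.bound τ hτ p hp)) ?_ ?_ ?_
  · exact hasDerivWithinAt_div_one_add_mul_mul self_mem_Ici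
      (fun t ht => congrArg Prod.fst (hfix' t ht)) (Complex.slitPlane_ne_zero hslit)
      (hprimitive _ (hX.diffG.sub_const 1))
  · exact (hprimitive _ hX.diffB₁).congr (fun t ht => congrArg (fun q => q.2.1) (hfix' t ht))
      (congrArg (fun q => q.2.1) (hfix' τ self_mem_Ici))
  · exact (hprimitive _ hX.diffB₂).congr (fun t ht => congrArg (fun q => q.2.2) (hfix' t ht))
      (congrArg (fun q => q.2.2) (hfix' τ self_mem_Ici))

theorem exists_isAttractedSemiflow (hk : IsFlowConstants j A γ₀ γ₁ r₀ r₁ ρ₀ ρ₁ κ)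
    (hX : IsRadialData γ₁ r₁ ρ₁ δ C G B₁ B₂) (hδ : 2 / (1 - γ₀) * δ ≤ κ / 4)
    (hC : C * (4 / (1 - γ₀)) ^ 2 * r₀ ≤ κ / 4) :
    ∃ Φ, IsAttractedSemiflow (cosDomain γ₀ r₀ ρ₀) (cosDomain γ₁ r₁ ρ₁)
      (radialField j A G B₁ B₂) (max (4 / (1 - γ₀)) (growthBound γ₀ A)) Φ := by
  obtain ⟨ξ, hξκ, hfix⟩ := hk.exists_picardOperator_eq hX hδ hC
  have hξ := hξκ.mono_bound (by linarith [hk.κ_pos] : κ ≤ 2 * κ)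
  have hflow := hk.isHolomorphicFamily_flowMap hξ
  have hinit : ∀ p ∈ cosDomain γ₀ r₀ ρ₀, ξ 0 p = 0 := fun p hp => by
    rw [← hfix 0 le_rfl p hp]
    simp [picardOperator]
  refine ⟨fun τ p => flowMap j A τ p (ξ τ p), hflow.continuousOn, hflow.differentiableOn,
    fun τ hτ p hp => hk.flowMap_mem hp hτ (hξ.bound τ hτ p hp),
    fun p hp => by simp [hinit p hp, flowMap, flowExponent],
    fun τ hτ p hp => hk.hasDerivWithinAt_flowMap_of_picardOperator_eq hX hξ hfix hτ hp,
    fun τ hτ p hp => (hk.norm_flowMap_fst_le hp.1 hτ (hξ.bound τ hτ p hp)).trans ?_,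
    fun τ hτ p hp => (hk.norm_flowMap_snd_le hp.1 hτ (hξ.bound τ hτ p hp)).trans ?_⟩
  · gcongr
    exact le_max_left _ _
  · gcongr
    exact le_max_right _ _

end IsFlowConstants

/-- Along trajectories of the vector field `Y`, issued from `Ω` and staying in `U`, one can
integrate: `Y χ = f` has a solution with `χ = O(x ^ (m + 1) 𝐲)` whenever `f = O(x ^ (m + 2) 𝐲)`. -/
def IsHomologicallySolvable (Y : Phase → Phase) (U Ω : Set Phase) : Prop :=
  ∀ (f : Phase → ℂ) (m : ℕ) (C : ℝ), 0 ≤ C → DifferentiableOn ℂ f U →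
    (∀ p ∈ U, ‖f p‖ ≤ C * ‖p.1‖ ^ (m + 2) * ‖p.2‖) →
    ∃ χ : Phase → ℂ, DifferentiableOn ℂ χ Ω ∧ (∀ p ∈ Ω, fderiv ℂ χ p (Y p) = f p) ∧
      ∃ C' ≥ 0, ∀ p ∈ Ω, ‖χ p‖ ≤ C' * ‖p.1‖ ^ (m + 1) * ‖p.2‖

namespace IsAttractedSemiflow

variable {Ω U : Set Phase} {X : Phase → Phase} {K C : ℝ} {Φ : ℝ → Phase → Phase} {f : Phase → ℂ}
  {m : ℕ} {p : Phase} {τ : ℝ}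

theorem continuousOn_curve (hΦ : IsAttractedSemiflow Ω U X K Φ) (hp : p ∈ Ω) :
    ContinuousOn (fun t => Φ t p) (Ici 0) :=
  hΦ.continuousOn.comp (f := fun t : ℝ => (t, p)) (by fun_prop) fun _ ht => ⟨ht, hp⟩

theorem hasDerivWithinAt_shift (hΦ : IsAttractedSemiflow Ω U X K Φ) (hp : p ∈ Ω) {t : ℝ}
    (ht : 0 ≤ τ + t) :
    HasDerivWithinAt (fun t => Φ (τ + t) p) (X (Φ (τ + t) p)) (Ici t) t := by
  have hadd : HasDerivWithinAt (fun t => τ + t) 1 (Ici t) t :=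
    ((hasDerivAt_id t).const_add τ).hasDerivWithinAt
  have hcomp := HasDerivWithinAt.scomp (t' := Ici (τ + t)) t (hΦ.deriv (τ + t) ht p hp) hadd
    fun u hu => add_le_add_right (mem_Ici.1 hu) τ
  rwa [one_smul] at hcomp

theorem map_add (hΦ : IsAttractedSemiflow Ω U X K Φ) (hU : IsOpen U)
    (hX : DifferentiableOn ℂ X U) (hp : p ∈ Ω) (hτ : 0 ≤ τ) (hq : Φ τ p ∈ Ω) {s : ℝ}
    (hs : 0 ≤ s) : Φ s (Φ τ p) = Φ (τ + s) p := by
  have hcont : ContinuousOn (fun t => Φ t (Φ τ p)) (Icc 0 s) :=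
    (hΦ.continuousOn_curve hq).mono fun t ht => ht.1
  have hcont_shift : ContinuousOn (fun t => Φ (τ + t) p) (Icc 0 s) :=
    (hΦ.continuousOn_curve hp).comp (f := fun t => τ + t) (by fun_prop) fun t ht =>
      add_nonneg hτ ht.1
  set S := (fun t => Φ t (Φ τ p)) '' Icc 0 s ∪ (fun t => Φ (τ + t) p) '' Icc 0 s
  have hS : IsCompact S := (isCompact_Icc.image_of_continuousOn hcont).union
    (isCompact_Icc.image_of_continuousOn hcont_shift)
  have hSU : S ⊆ U := by
    rintro _ (⟨t, ht, rfl⟩ | ⟨t, ht, rfl⟩)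
    · exact hΦ.mapsTo t ht.1 _ hq
    · exact hΦ.mapsTo _ (add_nonneg hτ ht.1) _ hp
  obtain ⟨L, hL⟩ := LocallyLipschitzOn.exists_lipschitzOnWith_of_compact hS
    ((locallyLipschitzOn_of_differentiableOn hU hX).mono hSU)
  exact ODE_solution_unique_of_mem_Icc_right (v := fun _ => X) (s := fun _ => S) (K := L)
    (fun _ _ => hL) hcont (fun t ht => hΦ.deriv t ht.1 _ hq)
    (fun t ht => Or.inl ⟨t, Ico_subset_Icc_self ht, rfl⟩) hcont_shift
    (fun t ht => hΦ.hasDerivWithinAt_shift hp (add_nonneg hτ ht.1))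
    (fun t ht => Or.inr ⟨t, Ico_subset_Icc_self ht, rfl⟩) (by simp [hΦ.map_zero _ hq])
    (right_mem_Icc.2 hs)

theorem norm_comp_le (hΦ : IsAttractedSemiflow Ω U X K Φ) (hK : 0 ≤ K) (hC : 0 ≤ C)
    (hf : ∀ p ∈ U, ‖f p‖ ≤ C * ‖p.1‖ ^ (m + 2) * ‖p.2‖) (hp : p ∈ Ω) {s : ℝ} (hs : 0 ≤ s) :
    ‖f (Φ s p)‖ ≤
      C * K ^ (m + 3) * ‖p.1‖ ^ m * ‖p.2‖ * (‖p.1‖ / (1 + s * ‖p.1‖)) ^ 2 := by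
  have hfst := hΦ.norm_fst_le s hs p hp
  have hsnd := hΦ.norm_snd_le s hs p hp
  have hdiv : ‖p.1‖ / (1 + s * ‖p.1‖) ≤ ‖p.1‖ :=
    div_le_self (norm_nonneg _) (le_add_of_nonneg_right (by positivity))
  calc ‖f (Φ s p)‖
      ≤ C * ‖(Φ s p).1‖ ^ (m + 2) * ‖(Φ s p).2‖ := hf _ (hΦ.mapsTo s hs p hp)
    _ ≤ C * (K * (‖p.1‖ / (1 + s * ‖p.1‖))) ^ (m + 2) * (K * ‖p.2‖) := by gcongr
    _ = C * K ^ (m + 3) * (‖p.1‖ / (1 + s * ‖p.1‖)) ^ m * ‖p.2‖ *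
        (‖p.1‖ / (1 + s * ‖p.1‖)) ^ 2 := by ring
    _ ≤ C * K ^ (m + 3) * ‖p.1‖ ^ m * ‖p.2‖ * (‖p.1‖ / (1 + s * ‖p.1‖)) ^ 2 := by gcongr

theorem continuousOn_comp (hΦ : IsAttractedSemiflow Ω U X K Φ) (hf : ContinuousOn f U)
    (hp : p ∈ Ω) : ContinuousOn (fun s => f (Φ s p)) (Ici 0) :=
  hf.comp (hΦ.continuousOn_curve hp) fun s hs => hΦ.mapsTo s hs p hp

theorem integrableOn_comp (hΦ : IsAttractedSemiflow Ω U X K Φ) (hK : 0 ≤ K) (hC : 0 ≤ C)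
    (hf : ContinuousOn f U) (hfC : ∀ p ∈ U, ‖f p‖ ≤ C * ‖p.1‖ ^ (m + 2) * ‖p.2‖) (hp : p ∈ Ω)
    (hp₀ : p.1 ≠ 0) : IntegrableOn (fun s => f (Φ s p)) (Ioi 0) := by
  refine Integrable.mono' ((integrableOn_div_one_add_mul_sq (norm_pos_iff.2 hp₀)).const_mul
    (C * K ^ (m + 3) * ‖p.1‖ ^ m * ‖p.2‖))
    (((hΦ.continuousOn_comp hf hp).mono Ioi_subset_Ici_self).aestronglyMeasurable
      measurableSet_Ioi) ?_
  filter_upwards [ae_restrict_mem measurableSet_Ioi] with s hs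
    using hΦ.norm_comp_le hK hC hfC hp (le_of_lt hs)

theorem differentiableOn_integral_comp (hΦ : IsAttractedSemiflow Ω U X K Φ) (hΩ : IsOpen Ω)
    (hΩ₀ : ∀ p ∈ Ω, p.1 ≠ 0) (hΩb : Bornology.IsBounded Ω) (hK : 0 ≤ K) (hC : 0 ≤ C)
    (hf : DifferentiableOn ℂ f U) (hfC : ∀ p ∈ U, ‖f p‖ ≤ C * ‖p.1‖ ^ (m + 2) * ‖p.2‖) :
    DifferentiableOn ℂ (fun p => ∫ s in Ioi (0 : ℝ), f (Φ s p)) Ω := by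
  obtain ⟨R, hR, hΩR⟩ := hΩb.exists_pos_norm_le
  refine differentiableOn_integral hΩ
    (fun p hp => (hΦ.integrableOn_comp hK hC hf.continuousOn hfC hp (hΩ₀ p hp)).1)
    (bound := fun s => C * K ^ (m + 3) * R ^ m * R * (R / (1 + s * R)) ^ 2) ?_ ?_
    ((integrableOn_div_one_add_mul_sq hR).const_mul _)
  · filter_upwards [ae_restrict_mem measurableSet_Ioi] with s hs
    exact hf.comp (hΦ.differentiableOn s (le_of_lt hs)) fun p hp =>
      hΦ.mapsTo s (le_of_lt hs) p hp
  · filter_upwards [ae_restrict_mem measurableSet_Ioi] with s hs p hp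
    have hs0 : 0 ≤ s := le_of_lt hs
    have hfst : ‖p.1‖ ≤ R := (_root_.norm_fst_le p).trans (hΩR p hp)
    have hsnd : ‖p.2‖ ≤ R := (_root_.norm_snd_le p).trans (hΩR p hp)
    have hdiv : ‖p.1‖ / (1 + s * ‖p.1‖) ≤ R / (1 + s * R) := by
      rw [div_le_div_iff₀ (by positivity) (by positivity)]
      nlinarith
    refine (hΦ.norm_comp_le hK hC hfC hp hs0).trans ?_
    gcongr

theorem setIntegral_comp_map (hΦ : IsAttractedSemiflow Ω U X K Φ) (hU : IsOpen U)
    (hX : DifferentiableOn ℂ X U) (hp : p ∈ Ω) (hτ : 0 ≤ τ) (hq : Φ τ p ∈ Ω)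
    (f : Phase → ℂ) : ∫ s in Ioi (0 : ℝ), f (Φ s (Φ τ p)) = ∫ s in Ioi τ, f (Φ s p) := by
  have htranslate := (measurePreserving_add_right volume τ).setIntegral_preimage_emb
    (measurableEmbedding_addRight τ) (fun s => f (Φ s p)) (Ioi τ)
  rw [preimage_add_const_Ioi, sub_self] at htranslate
  rw [← htranslate]
  refine setIntegral_congr_fun measurableSet_Ioi fun s hs => ?_
  simp only [hΦ.map_add hU hX hp hτ hq (le_of_lt (mem_Ioi.1 hs)), add_comm τ s]

theorem hasDerivWithinAt_neg_integral_comp (hΦ : IsAttractedSemiflow Ω U X K Φ)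
    (hΩ : IsOpen Ω) (hU : IsOpen U) (hX : DifferentiableOn ℂ X U) (hf : ContinuousOn f U)
    (hp : p ∈ Ω) (hint : IntegrableOn (fun s => f (Φ s p)) (Ioi 0)) :
    HasDerivWithinAt (fun t => -∫ s in Ioi (0 : ℝ), f (Φ s (Φ t p))) (f p) (Ici 0) 0 := by
  have hstay : ∀ᶠ t in 𝓝[Ici 0] (0 : ℝ), Φ t p ∈ Ω := by
    have htendsto := (hΦ.deriv 0 le_rfl p hp).continuousWithinAt.tendsto
    rw [hΦ.map_zero p hp] at htendsto
    exact htendsto (hΩ.mem_nhds hp)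
  have hsplit : ∀ t ≥ 0, Φ t p ∈ Ω → -∫ s in Ioi (0 : ℝ), f (Φ s (Φ t p)) =
      (∫ s in (0 : ℝ)..t, f (Φ s p)) - ∫ s in Ioi (0 : ℝ), f (Φ s p) := fun t ht hq => by
    rw [hΦ.setIntegral_comp_map hU hX hp ht hq, ← intervalIntegral.integral_Ioi_sub_Ioi hint ht]
    ring
  have hprimitive := (hasDerivWithinAt_primitive (hΦ.continuousOn_comp hf hp) le_rfl).sub_const
    (∫ s in Ioi (0 : ℝ), f (Φ s p))
  simp only [hΦ.map_zero p hp] at hprimitive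
  refine hprimitive.congr_of_eventuallyEq ?_ (hsplit 0 le_rfl (by rwa [hΦ.map_zero p hp]))
  filter_upwards [hstay, self_mem_nhdsWithin] with t ht ht0 using hsplit t ht0 ht

theorem hasDerivWithinAt_comp (hΦ : IsAttractedSemiflow Ω U X K Φ) {χ : Phase → ℂ} (hp : p ∈ Ω)
    (hχ : DifferentiableAt ℂ χ p) :
    HasDerivWithinAt (fun t => χ (Φ t p)) (fderiv ℂ χ p (X p)) (Ici 0) 0 := by
  have hχ' := hχ.hasFDerivAt.restrictScalars ℝ
  rw [← hΦ.map_zero p hp] at hχ'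
  have hcomp := hχ'.comp_hasDerivWithinAt (0 : ℝ) (hΦ.deriv 0 le_rfl p hp)
  rwa [hΦ.map_zero p hp] at hcomp

/-- The solution is `χ = -∫₀^∞ f ∘ Φ_s ds`. -/
theorem isHomologicallySolvable (hΦ : IsAttractedSemiflow Ω U X K Φ) (hΩ : IsOpen Ω)
    (hΩ₀ : ∀ p ∈ Ω, p.1 ≠ 0) (hΩb : Bornology.IsBounded Ω) (hU : IsOpen U)
    (hX : DifferentiableOn ℂ X U) (hK : 0 ≤ K) : IsHomologicallySolvable X U Ω := by
  intro f m C hC hf hfC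
  have hχ := (hΦ.differentiableOn_integral_comp hΩ hΩ₀ hΩb hK hC hf hfC).neg
  refine ⟨_, hχ, fun p hp => ?_, C * K ^ (m + 3), by positivity, fun p hp => ?_⟩
  · exact (uniqueDiffOn_Ici (0 : ℝ) 0 self_mem_Ici).eq_deriv _
      (hΦ.hasDerivWithinAt_comp hp (hχ.differentiableAt (hΩ.mem_nhds hp)))
      (hΦ.hasDerivWithinAt_neg_integral_comp hΩ hU hX hf.continuousOn hp
        (hΦ.integrableOn_comp hK hC hf.continuousOn hfC hp (hΩ₀ p hp)))
  · calc ‖-∫ s in Ioi (0 : ℝ), f (Φ s p)‖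
        ≤ C * K ^ (m + 3) * ‖p.1‖ ^ m * ‖p.2‖ * ‖p.1‖ := by
          rw [norm_neg]
          exact norm_setIntegral_le_mul (norm_pos_iff.2 (hΩ₀ p hp)) (by positivity)
            measurableSet_Ioi subset_rfl fun s hs => hΦ.norm_comp_le hK hC hfC hp (le_of_lt hs)
      _ = C * K ^ (m + 3) * ‖p.1‖ ^ (m + 1) * ‖p.2‖ := by ring

end IsAttractedSemiflow

/-! ### The homological equation -/

section RadialHomological

variable {j A : ℂ} {γ₀ γ₁ r₁ ρ₁ δ C : ℝ} {G B₁ B₂ : Phase → ℂ}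

theorem isBounded_cosDomain (γ r ρ : ℝ) : Bornology.IsBounded (cosDomain γ r ρ) :=
  isBounded_iff_forall_norm_le.2 ⟨max r ρ, fun _ hp => max_le_max hp.1.2.1.le hp.2.le⟩

theorem IsRadialData.differentiableOn_radialField (hX : IsRadialData γ₁ r₁ ρ₁ δ C G B₁ B₂) :
    DifferentiableOn ℂ (radialField j A G B₁ B₂) (cosDomain γ₁ r₁ ρ₁) := by
  have hG := hX.diffG
  have hB₁ := hX.diffB₁
  have hB₂ := hX.diffB₂
  unfold radialField
  fun_prop

theorem exists_isFlowConstants (hj : j.re = 0) (hA : 0 ≤ A.re) (hγ₀ : 0 ≤ γ₀) (hγ : γ₀ < γ₁)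
    (hγ₁ : γ₁ < 1) (hC : 0 ≤ C) (hr₁ : 0 < r₁) (hρ₁ : 0 < ρ₁) :
    ∃ r₀ ∈ Ioc 0 r₁, ∃ ρ₀ ∈ Ioc 0 ρ₁, IsFlowConstants j A γ₀ γ₁ r₀ r₁ ρ₀ ρ₁ ((γ₁ - γ₀) / 8) ∧
      C * (4 / (1 - γ₀)) ^ 2 * r₀ ≤ (γ₁ - γ₀) / 8 / 4 := by
  have hγ' : 0 < γ₁ - γ₀ := by linarith
  have hγ₀' : 0 < 1 - γ₀ := by linarith
  have hgrowth := growthBound_pos γ₀ A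
  set Q := C * (4 / (1 - γ₀)) ^ 2
  have hQ : 0 ≤ Q := by positivity
  refine ⟨min r₁ (min (r₁ * ((1 - γ₀) / 4)) ((γ₁ - γ₀) / 8 / 4 / (Q + 1))),
    ⟨by positivity, min_le_left _ _⟩, min ρ₁ (ρ₁ / growthBound γ₀ A),
    ⟨by positivity, min_le_left _ _⟩,
    ⟨hj, hA, hγ₀, by linarith, by linarith, by linarith, by nlinarith, ?_, ?_⟩, ?_⟩
  · calc 4 / (1 - γ₀) * min r₁ (min (r₁ * ((1 - γ₀) / 4)) ((γ₁ - γ₀) / 8 / 4 / (Q + 1)))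
        ≤ 4 / (1 - γ₀) * (r₁ * ((1 - γ₀) / 4)) := by
          gcongr
          exact (min_le_right _ _).trans (min_le_left _ _)
      _ = r₁ := by field_simp
  · calc growthBound γ₀ A * min ρ₁ (ρ₁ / growthBound γ₀ A)
        ≤ growthBound γ₀ A * (ρ₁ / growthBound γ₀ A) := by
          gcongr
          exact min_le_right _ _
      _ = ρ₁ := by field_simp
  · calc Q * min r₁ (min (r₁ * ((1 - γ₀) / 4)) ((γ₁ - γ₀) / 8 / 4 / (Q + 1)))
        ≤ (Q + 1) * ((γ₁ - γ₀) / 8 / 4 / (Q + 1)) := by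
          gcongr
          · linarith
          · exact (min_le_right _ _).trans (min_le_right _ _)
      _ = (γ₁ - γ₀) / 8 / 4 := by field_simp

theorem IsRadialData.exists_isHomologicallySolvable (hX : IsRadialData γ₁ r₁ ρ₁ δ C G B₁ B₂)
    (hj : j.re = 0) (hA : 0 ≤ A.re) (hγ₀ : 0 ≤ γ₀) (hγ : γ₀ < γ₁) (hγ₁ : γ₁ < 1)
    (hδ : δ ≤ (1 - γ₀) * (γ₁ - γ₀) / 64) (hr₁ : 0 < r₁) (hρ₁ : 0 < ρ₁) :
    ∃ r₀ ∈ Ioc 0 r₁, ∃ ρ₀ ∈ Ioc 0 ρ₁,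
      IsHomologicallySolvable (radialField j A G B₁ B₂) (cosDomain γ₁ r₁ ρ₁)
        (cosDomain γ₀ r₀ ρ₀) := by
  obtain ⟨r₀, hr₀, ρ₀, hρ₀, hk, hC⟩ :=
    exists_isFlowConstants (C := C) hj hA hγ₀ hγ hγ₁ hX.C_nonneg hr₁ hρ₁
  have hγ₀' : 0 < 1 - γ₀ := by linarith
  have hδ' : 2 / (1 - γ₀) * δ ≤ (γ₁ - γ₀) / 8 / 4 :=
    calc 2 / (1 - γ₀) * δ ≤ 2 / (1 - γ₀) * ((1 - γ₀) * (γ₁ - γ₀) / 64) := by gcongr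
      _ = (γ₁ - γ₀) / 8 / 4 := by field_simp; ring
  obtain ⟨Φ, hΦ⟩ := hk.exists_isAttractedSemiflow hX hδ' hC
  exact ⟨r₀, hr₀, ρ₀, hρ₀, hΦ.isHomologicallySolvable (isOpen_cosDomain _ _ _)
    (fun p hp => norm_pos_iff.1 hp.1.1) (isBounded_cosDomain _ _ _) (isOpen_cosDomain _ _ _)
    hX.differentiableOn_radialField ((growthBound_pos γ₀ A).le.trans (le_max_right _ _))⟩

end RadialHomological

/-- The linear map `(x, 𝐲) ↦ (ν x, 𝐲)`. -/
def scaleFst (ν : ℂ) : Phase →L[ℂ] Phase :=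
  (ν • ContinuousLinearMap.fst ℂ ℂ (ℂ × ℂ)).prod (ContinuousLinearMap.snd ℂ ℂ (ℂ × ℂ))

theorem scaleFst_apply (ν : ℂ) (p : Phase) : scaleFst ν p = (ν * p.1, p.2) := rfl

theorem scaleFst_scaleFst (μ ν : ℂ) (p : Phase) :
    scaleFst μ (scaleFst ν p) = scaleFst (μ * ν) p := by
  simp only [scaleFst_apply, mul_assoc]

theorem scaleFst_one (p : Phase) : scaleFst 1 p = p := by
  rw [scaleFst_apply, one_mul]

namespace IsHomologicallySolvable

variable {X Y : Phase → Phase} {U U' Ω Ω' : Set Phase}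

theorem mono (hY : IsHomologicallySolvable Y U Ω) (hU : U ⊆ U') (hΩ : Ω' ⊆ Ω) :
    IsHomologicallySolvable Y U' Ω' := by
  intro f m C hC hf hfC
  obtain ⟨χ, hχ, hχY, C', hC', hχC'⟩ := hY f m C hC (hf.mono hU) fun p hp => hfC p (hU hp)
  exact ⟨χ, hχ.mono hΩ, fun p hp => hχY p (hΩ hp), C', hC', fun p hp => hχC' p (hΩ hp)⟩

theorem of_smul (hX : IsHomologicallySolvable X U Ω) {g : Phase → ℂ} {M : ℝ} (hM : 0 ≤ M)
    (hg : DifferentiableOn ℂ g U) (hgM : ∀ p ∈ U, ‖g p‖ ≤ M) (hg₀ : ∀ p ∈ Ω, g p ≠ 0)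
    (hXY : ∀ p ∈ Ω, X p = g p • Y p) : IsHomologicallySolvable Y U Ω := by
  intro f m C hC hf hfC
  obtain ⟨χ, hχ, hχX, hχC'⟩ := hX (fun p => g p * f p) m (M * C) (by positivity) (hg.fun_mul hf)
    fun p hp => by
      calc ‖g p * f p‖ ≤ M * (C * ‖p.1‖ ^ (m + 2) * ‖p.2‖) := by
            rw [norm_mul]
            gcongr
            exacts [hgM p hp, hfC p hp]
        _ = M * C * ‖p.1‖ ^ (m + 2) * ‖p.2‖ := by ring
  refine ⟨χ, hχ, fun p hp => mul_left_cancel₀ (hg₀ p hp) ?_, hχC'⟩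
  rw [← hχX p hp, hXY p hp, map_smul, smul_eq_mul]

theorem rescale {ν : ℂ} (hν : ν ≠ 0) (hΩ : IsOpen Ω)
    (hY : IsHomologicallySolvable (fun q => scaleFst ν⁻¹ (Y (scaleFst ν q))) U Ω) :
    IsHomologicallySolvable Y (scaleFst ν⁻¹ ⁻¹' U) (scaleFst ν⁻¹ ⁻¹' Ω) := by
  have hleft : ∀ q, scaleFst ν⁻¹ (scaleFst ν q) = q := fun q => by
    rw [scaleFst_scaleFst, inv_mul_cancel₀ hν, scaleFst_one]
  have hright : ∀ p, scaleFst ν (scaleFst ν⁻¹ p) = p := fun p => by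
    rw [scaleFst_scaleFst, mul_inv_cancel₀ hν, scaleFst_one]
  have hmaps : MapsTo (scaleFst ν) U (scaleFst ν⁻¹ ⁻¹' U) := fun q hq => by
    rwa [mem_preimage, hleft]
  intro f m C hC hf hfC
  obtain ⟨χ, hχ, hχY, C', hC', hχC'⟩ := hY (f ∘ scaleFst ν) m (C * ‖ν‖ ^ (m + 2)) (by positivity)
    (hf.comp (scaleFst ν).differentiable.differentiableOn hmaps) fun q hq => by
      calc ‖f (scaleFst ν q)‖ ≤ C * ‖ν * q.1‖ ^ (m + 2) * ‖q.2‖ := hfC _ (hmaps hq)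
        _ = C * ‖ν‖ ^ (m + 2) * ‖q.1‖ ^ (m + 2) * ‖q.2‖ := by rw [norm_mul, mul_pow]; ring
  refine ⟨χ ∘ scaleFst ν⁻¹, hχ.comp (scaleFst ν⁻¹).differentiable.differentiableOn fun p hp => hp,
    fun p hp => ?_, C' * ‖ν⁻¹‖ ^ (m + 1), by positivity, fun p hp => ?_⟩
  · rw [((hχ.differentiableAt (hΩ.mem_nhds hp)).hasFDerivAt.comp p
      (scaleFst ν⁻¹).hasFDerivAt).fderiv, ContinuousLinearMap.comp_apply]
    simpa only [hright, Function.comp_apply] using hχY _ hp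
  · calc ‖χ (scaleFst ν⁻¹ p)‖ ≤ C' * ‖ν⁻¹ * p.1‖ ^ (m + 1) * ‖p.2‖ := hχC' _ hp
      _ = C' * ‖ν⁻¹‖ ^ (m + 1) * ‖p.1‖ ^ (m + 1) * ‖p.2‖ := by rw [norm_mul, mul_pow]; ring

end IsHomologicallySolvable

/-- For `ν ≠ 0`, the image of `cosDomain γ r ρ` under `(h, 𝐲) ↦ (ν h, 𝐲)`. -/
def scaledDomain (ν : ℂ) (γ r ρ : ℝ) : Set Phase := scaleFst ν⁻¹ ⁻¹' cosDomain γ r ρ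

section ScaledDomain

variable {ν : ℂ} {γ r ρ : ℝ}

theorem isOpen_scaledDomain (ν : ℂ) (γ r ρ : ℝ) : IsOpen (scaledDomain ν γ r ρ) :=
  (isOpen_cosDomain γ r ρ).preimage (scaleFst ν⁻¹).continuous

theorem scaledDomain_mono {γ' r' ρ' : ℝ} (hγ : γ ≤ γ') (hr : r ≤ r') (hρ : ρ ≤ ρ') :
    scaledDomain ν γ r ρ ⊆ scaledDomain ν γ' r' ρ' :=
  preimage_mono (cosDomain_mono hγ hr hρ)

theorem mapsTo_scaleFst_cosDomain (hν : ν ≠ 0) :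
    MapsTo (scaleFst ν) (cosDomain γ r ρ) (scaledDomain ν γ r ρ) := fun q hq => by
  rwa [scaledDomain, mem_preimage, scaleFst_scaleFst, inv_mul_cancel₀ hν, scaleFst_one]

theorem norm_fst_lt_of_mem_scaledDomain (hν : ν ≠ 0) {p : Phase}
    (hp : p ∈ scaledDomain ν γ r ρ) : ‖p.1‖ < ‖ν‖ * r := by
  have hlt : ‖ν⁻¹ * p.1‖ < r := hp.1.2.1
  rwa [norm_mul, norm_inv, inv_mul_lt_iff₀ (norm_pos_iff.2 hν)] at hlt

theorem exists_scaledDomain_subset_ball (hν : ν ≠ 0) (γ : ℝ) (hr : 0 < r) (hρ : 0 < ρ) {ε : ℝ}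
    (hε : 0 < ε) : ∃ r' ∈ Ioc 0 r, ∃ ρ' ∈ Ioc 0 ρ, scaledDomain ν γ r' ρ' ⊆ ball 0 ε := by
  refine ⟨min r (ε / ‖ν‖), ⟨by positivity, min_le_left _ _⟩, min ρ ε,
    ⟨by positivity, min_le_left _ _⟩, fun p hp => mem_ball_zero_iff.2 (max_lt ?_ ?_)⟩
  · calc ‖p.1‖ < ‖ν‖ * min r (ε / ‖ν‖) := norm_fst_lt_of_mem_scaledDomain hν hp
      _ ≤ ‖ν‖ * (ε / ‖ν‖) := by gcongr; exact min_le_right _ _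
      _ = ε := by field_simp
  · exact hp.2.trans_le (min_le_right _ _)

end ScaledDomain

/-- `f` is holomorphic on `U` and bounded there by `L ‖𝐲‖`. -/
def IsRemainderOn (U : Set Phase) (L : ℝ) (f : Phase → ℂ) : Prop :=
  DifferentiableOn ℂ f U ∧ ∀ p ∈ U, ‖f p‖ ≤ L * ‖p.2‖

namespace IsRemainderOn

variable {U U' : Set Phase} {L L' : ℝ} {f g : Phase → ℂ}

theorem mono (hf : IsRemainderOn U L f) (hU : U' ⊆ U) : IsRemainderOn U' L f :=
  ⟨hf.1.mono hU, fun p hp => hf.2 p (hU hp)⟩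

theorem add (hf : IsRemainderOn U L f) (hg : IsRemainderOn U L' g) :
    IsRemainderOn U (L + L') fun p => f p + g p :=
  ⟨hf.1.fun_add hg.1, fun p hp =>
    (norm_add_le_of_le (hf.2 p hp) (hg.2 p hp)).trans_eq (add_mul L L' _).symm⟩

theorem sub (hf : IsRemainderOn U L f) (hg : IsRemainderOn U L' g) :
    IsRemainderOn U (L + L') fun p => f p - g p :=
  ⟨hf.1.fun_sub hg.1, fun p hp =>
    (norm_sub_le_of_le (hf.2 p hp) (hg.2 p hp)).trans_eq (add_mul L L' _).symm⟩

end IsRemainderOn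

/-- The unit by which `normalizedUpTo M l a₁ a₂ c D R` is multiplied to become a `radialField`,
for `j = ± i` and `b = (a₂ - a₁) / 2`: on `{x = 0}` it makes the eigenvalues purely imaginary,
and the term `b x` equalizes the real parts of their first order variations. -/
def timeChange (j l b : ℂ) (c : ℂ → ℂ) (p : Phase) : ℂ :=
  j / (l + (c (p.2.1 * p.2.2) + b * p.1))

section TimeChange

variable {j l a₁ a₂ b : ℂ} {c : ℂ → ℂ} {D R : Phase → ℂ} {M : ℕ} {γ₀ γ₁ r ρ δ L : ℝ}

theorem radialField_eq_smul (hl : l ≠ 0) (hj : j ^ 2 = -1) (q : Phase)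
    (hg : timeChange j l ((a₂ - a₁) / 2) c (scaleFst (j * l) q) ≠ 0) :
    let g := fun q => timeChange j l ((a₂ - a₁) / 2) c (scaleFst (j * l) q)
    radialField j ((a₁ + a₂) / 2) (fun q => -(j * l) * g q)
      (fun q => g q * ((j * l * q.1) ^ M * (R (scaleFst (j * l) q) - D (scaleFst (j * l) q))))
      (fun q => g q * ((j * l * q.1) ^ M * (R (scaleFst (j * l) q) + D (scaleFst (j * l) q)))) q =
    g q • scaleFst (j * l)⁻¹ (normalizedUpTo M l a₁ a₂ c D R (scaleFst (j * l) q)) := by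
  have hj₀ : j ≠ 0 := by rintro rfl; norm_num at hj
  have hmul : timeChange j l ((a₂ - a₁) / 2) c (scaleFst (j * l) q) *
      (l + (c (q.2.1 * q.2.2) + (a₂ - a₁) / 2 * (j * l * q.1))) = j :=
    div_mul_cancel₀ _ (div_ne_zero_iff.1 hg).2
  simp only [radialField, scaleFst_apply, normalizedUpTo, fieldY₀, fieldC, fieldR, Prod.smul_mk,
    Prod.mk_add_mk, smul_eq_mul, mul_zero, zero_add, add_zero, Prod.mk.injEq] at hmul ⊢
  refine ⟨?_, ?_, ?_⟩
  · field_simp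
  · linear_combination q.2.1 * hmul
  · linear_combination -q.2.2 * hmul

theorem exists_ball_timeChange (hl : l ≠ 0) (hj : j ^ 2 = -1) (b : ℂ) (hc : AnalyticAt ℂ c 0)
    (hc₀ : c 0 = 0) (hδ : 0 < δ) :
    ∃ ε > 0, DifferentiableOn ℂ (timeChange j l b c) (ball 0 ε) ∧
      ∀ p ∈ ball (0 : Phase) ε, ‖-(j * l) * timeChange j l b c p - 1‖ ≤ δ := by
  have hprod : AnalyticAt ℂ (fun p : Phase => p.2.1 * p.2.2) 0 :=
    (analyticAt_fst.comp analyticAt_snd).fun_mul (analyticAt_snd.comp analyticAt_snd)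
  have hcomp : AnalyticAt ℂ (fun p : Phase => c (p.2.1 * p.2.2)) 0 :=
    AnalyticAt.fun_comp (by simpa using hc) hprod
  have hg : AnalyticAt ℂ (timeChange j l b c) 0 :=
    analyticAt_const.fun_div
      (analyticAt_const.fun_add (hcomp.fun_add (analyticAt_const.fun_mul analyticAt_fst)))
      (by simpa [hc₀] using hl)
  have hvalue : -(j * l) * timeChange j l b c 0 - 1 = 0 := by
    simp only [timeChange, Prod.fst_zero, Prod.snd_zero, mul_zero, hc₀, add_zero]
    field_simp
    linear_combination -hj
  have hsmall : ∀ᶠ p in 𝓝 (0 : Phase), ‖-(j * l) * timeChange j l b c p - 1‖ ≤ δ := by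
    have hcont : ContinuousAt (fun p => ‖-(j * l) * timeChange j l b c p - 1‖) 0 :=
      ((hg.continuousAt.const_mul _).sub_const _).norm
    refine hcont.eventually_le_const ?_
    simpa only [hvalue, norm_zero] using hδ
  obtain ⟨ε, hε, hball⟩ :=
    Metric.eventually_nhds_iff_ball.1 (hg.eventually_analyticAt.and hsmall)
  exact ⟨ε, hε, fun p hp => (hball p hp).1.differentiableAt.differentiableWithinAt,
    fun p hp => (hball p hp).2⟩

theorem norm_le_of_norm_neg_mul_sub_one_le {ν g : ℂ} (hν : ν ≠ 0) (hδ : δ ≤ 1)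
    (hg : ‖-ν * g - 1‖ ≤ δ) : ‖g‖ ≤ 2 / ‖ν‖ := by
  have htriangle := norm_sub_norm_le (-ν * g) 1
  rw [norm_mul, norm_neg, norm_one] at htriangle
  rw [le_div_iff₀' (norm_pos_iff.2 hν)]
  linarith

theorem ne_zero_of_norm_neg_mul_sub_one_le {ν g : ℂ} (hδ : δ < 1) (hg : ‖-ν * g - 1‖ ≤ δ) :
    g ≠ 0 := by
  rintro rfl
  norm_num at hg
  linarith

theorem norm_mul_pow_mul_le {ν g h : ℂ} {φ : ℂ} {K : ℝ} (hν : ν ≠ 0) (hM : 2 ≤ M)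
    (hg : ‖g‖ ≤ 2 / ‖ν‖) (hh : ‖ν * h‖ ≤ 1) (hφ : ‖φ‖ ≤ K) :
    ‖g * ((ν * h) ^ M * φ)‖ ≤ 2 * ‖ν‖ * K * ‖h‖ ^ 2 := by
  calc ‖g * ((ν * h) ^ M * φ)‖ = ‖g‖ * (‖ν * h‖ ^ M * ‖φ‖) := by simp only [norm_mul, norm_pow]
    _ ≤ 2 / ‖ν‖ * (‖ν * h‖ ^ 2 * K) := by
        gcongr ?_ * (?_ * ?_)
        exact pow_le_pow_of_le_one (norm_nonneg _) hh hM
    _ = 2 * ‖ν‖ * K * ‖h‖ ^ 2 := by rw [norm_mul]; field_simp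

theorem isRadialData_comp_scaleFst {ν : ℂ} {g : Phase → ℂ} (hν : ν ≠ 0) (hM : 2 ≤ M)
    (hL : 0 ≤ L) (hδ₀ : 0 ≤ δ) (hδ : δ ≤ 1) (hball : scaledDomain ν γ₁ r ρ ⊆ ball 0 1)
    (hg : DifferentiableOn ℂ g (scaledDomain ν γ₁ r ρ))
    (hgδ : ∀ p ∈ scaledDomain ν γ₁ r ρ, ‖-ν * g p - 1‖ ≤ δ) {φ₁ φ₂ : Phase → ℂ}
    (hφ₁ : IsRemainderOn (scaledDomain ν γ₁ r ρ) L φ₁)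
    (hφ₂ : IsRemainderOn (scaledDomain ν γ₁ r ρ) L φ₂) :
    IsRadialData γ₁ r ρ δ (2 * ‖ν‖ * L) (fun q => -ν * g (scaleFst ν q))
      (fun q => g (scaleFst ν q) * ((ν * q.1) ^ M * φ₁ (scaleFst ν q)))
      (fun q => g (scaleFst ν q) * ((ν * q.1) ^ M * φ₂ (scaleFst ν q))) := by
  have hmaps := mapsTo_scaleFst_cosDomain (γ := γ₁) (r := r) (ρ := ρ) hν
  have hcomp : ∀ φ : Phase → ℂ, DifferentiableOn ℂ φ (scaledDomain ν γ₁ r ρ) →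
      DifferentiableOn ℂ (fun q => φ (scaleFst ν q)) (cosDomain γ₁ r ρ) := fun φ hφ =>
    hφ.comp (scaleFst ν).differentiable.differentiableOn hmaps
  have hdiff : ∀ φ : Phase → ℂ, IsRemainderOn (scaledDomain ν γ₁ r ρ) L φ → DifferentiableOn ℂ
      (fun q => g (scaleFst ν q) * ((ν * q.1) ^ M * φ (scaleFst ν q))) (cosDomain γ₁ r ρ) :=
    fun φ hφ => (hcomp g hg).fun_mul (DifferentiableOn.fun_mul (by fun_prop) (hcomp φ hφ.1))
  have hbound : ∀ φ : Phase → ℂ, IsRemainderOn (scaledDomain ν γ₁ r ρ) L φ →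
      ∀ q ∈ cosDomain γ₁ r ρ,
        ‖g (scaleFst ν q) * ((ν * q.1) ^ M * φ (scaleFst ν q))‖ ≤ 2 * ‖ν‖ * L * ‖q.1‖ ^ 2 :=
    fun φ hφ q hq => by
      have hone : ‖scaleFst ν q‖ ≤ 1 := (mem_ball_zero_iff.1 (hball (hmaps hq))).le
      exact norm_mul_pow_mul_le hν hM
        (norm_le_of_norm_neg_mul_sub_one_le hν hδ (hgδ _ (hmaps hq)))
        ((norm_fst_le (scaleFst ν q)).trans hone) ((hφ.2 _ (hmaps hq)).trans
          (mul_le_of_le_one_right hL ((norm_snd_le (scaleFst ν q)).trans hone)))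
  exact ⟨hδ₀, by positivity, (hcomp g hg).const_mul _, hdiff φ₁ hφ₁, hdiff φ₂ hφ₂,
    fun q hq => hgδ _ (hmaps hq), hbound φ₁ hφ₁, hbound φ₂ hφ₂⟩

theorem exists_isHomologicallySolvable_normalizedUpTo (hl : l ≠ 0) (hj : j ^ 2 = -1)
    (hj_re : j.re = 0) (ha : 0 ≤ (a₁ + a₂).re) (hc : AnalyticAt ℂ c 0) (hc₀ : c 0 = 0)
    (hγ₀ : 0 ≤ γ₀) (hγ : γ₀ < γ₁) (hγ₁ : γ₁ < 1) (hr : 0 < r) (hρ : 0 < ρ) (hM : 2 ≤ M)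
    (hL : 0 ≤ L) (hD : IsRemainderOn (scaledDomain (j * l) γ₁ r ρ) L D)
    (hR : IsRemainderOn (scaledDomain (j * l) γ₁ r ρ) L R) :
    ∃ r₀ ∈ Ioc 0 r, ∃ ρ₀ ∈ Ioc 0 ρ, IsHomologicallySolvable (normalizedUpTo M l a₁ a₂ c D R)
      (scaledDomain (j * l) γ₁ r ρ) (scaledDomain (j * l) γ₀ r₀ ρ₀) := by
  have hν : j * l ≠ 0 := mul_ne_zero (by rintro rfl; norm_num at hj) hl
  have hA : 0 ≤ ((a₁ + a₂) / 2).re := by simpa only [Complex.div_ofNat_re] using by positivity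
  set δ := (1 - γ₀) * (γ₁ - γ₀) / 64 with hδ
  have hδ₀ : 0 < δ := by
    have := mul_pos (sub_pos.2 (hγ.trans hγ₁)) (sub_pos.2 hγ)
    positivity
  have hδ₁ : δ < 1 := by nlinarith
  obtain ⟨ε, hε, hg, hgδ⟩ := exists_ball_timeChange hl hj ((a₂ - a₁) / 2) hc hc₀ hδ₀
  obtain ⟨r₁, hr₁, ρ₁, hρ₁, hball⟩ :=
    exists_scaledDomain_subset_ball hν γ₁ hr hρ (lt_min hε one_pos)
  have hballε := hball.trans (ball_subset_ball (min_le_left ε 1))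
  have hsub : scaledDomain (j * l) γ₁ r₁ ρ₁ ⊆ scaledDomain (j * l) γ₁ r ρ :=
    scaledDomain_mono le_rfl hr₁.2 hρ₁.2
  have hX := isRadialData_comp_scaleFst hν hM (add_nonneg hL hL) hδ₀.le hδ₁.le
    (hball.trans (ball_subset_ball (min_le_right ε 1))) (hg.mono hballε)
    (fun p hp => hgδ p (hballε hp)) ((hR.sub hD).mono hsub) ((hR.add hD).mono hsub)
  obtain ⟨r₀, hr₀, ρ₀, hρ₀, hsolve⟩ := hX.exists_isHomologicallySolvable hj_re hA hγ₀ hγ hγ₁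
    hδ.le hr₁.1 hρ₁.1
  have hmaps := mapsTo_scaleFst_cosDomain (γ := γ₁) (r := r₁) (ρ := ρ₁) hν
  have hg₀ : ∀ q ∈ cosDomain γ₀ r₀ ρ₀,
      timeChange j l ((a₂ - a₁) / 2) c (scaleFst (j * l) q) ≠ 0 := fun q hq =>
    ne_zero_of_norm_neg_mul_sub_one_le hδ₁
      (hgδ _ (hballε (hmaps (cosDomain_mono hγ.le hr₀.2 hρ₀.2 hq))))
  have hsolve' := hsolve.of_smul (by positivity)
    ((hg.mono hballε).comp (scaleFst (j * l)).differentiable.differentiableOn hmaps)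
    (fun q hq => norm_le_of_norm_neg_mul_sub_one_le hν hδ₁.le (hgδ _ (hballε (hmaps hq)))) hg₀
    fun q hq => radialField_eq_smul hl hj q (hg₀ q hq)
  exact ⟨r₀, ⟨hr₀.1, hr₀.2.trans hr₁.2⟩, ρ₀, ⟨hρ₀.1, hρ₀.2.trans hρ₁.2⟩,
    (hsolve'.rescale hν (isOpen_cosDomain _ _ _)).mono hsub subset_rfl⟩

end TimeChange

/-! ### The exponents of the conjugacy -/

section Exponents

theorem norm_snd_fst_mul_snd_snd_le (p : Phase) : ‖p.2.1 * p.2.2‖ ≤ ‖p.2‖ ^ 2 := by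
  rw [norm_mul, sq]
  exact mul_le_mul (norm_fst_le p.2) (norm_snd_le p.2) (norm_nonneg _) (norm_nonneg _)

theorem mul_pow_succ_mul_le {C r x y : ℝ} (hC : 0 ≤ C) (hx₀ : 0 ≤ x) (hx : x ≤ r) (hy : 0 ≤ y)
    (m : ℕ) : C * x ^ (m + 1) * y ≤ C * r * x ^ m * y :=
  calc C * x ^ (m + 1) * y = C * x * x ^ m * y := by ring
    _ ≤ C * r * x ^ m * y := by gcongr

theorem exists_scaledDomain_mul_pow_mul_le {ν : ℂ} (hν : ν ≠ 0) {γ r ρ C ε : ℝ} (hr : 0 ≤ r)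
    (hρ : 0 < ρ) (hC : 0 ≤ C) (hε : 0 < ε) (m : ℕ) :
    ∃ ρ' ∈ Ioc 0 ρ, ∀ p ∈ scaledDomain ν γ r ρ', C * ‖p.1‖ ^ m * ‖p.2‖ ≤ ε := by
  set K := C * (‖ν‖ * r) ^ m
  have hK : 0 ≤ K := by positivity
  refine ⟨min ρ (ε / (K + 1)), ⟨by positivity, min_le_left _ _⟩, fun p hp => ?_⟩
  have hfst := (norm_fst_lt_of_mem_scaledDomain hν hp).le
  have hsnd : ‖p.2‖ ≤ ε / (K + 1) := hp.2.le.trans (min_le_right _ _)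
  calc C * ‖p.1‖ ^ m * ‖p.2‖ ≤ K * (ε / (K + 1)) := by
        gcongr
        exact mul_le_mul_of_nonneg_left (pow_le_pow_left₀ (norm_nonneg _) hfst m) hC
    _ ≤ (K + 1) * (ε / (K + 1)) := by gcongr; linarith
    _ = ε := by field_simp

theorem exists_lipschitz_of_analyticAt {c : ℂ → ℂ} (hc : AnalyticAt ℂ c 0) :
    ∃ t > 0, ∃ L ≥ 0, DifferentiableOn ℂ c (ball 0 t) ∧
      ∀ z ∈ ball (0 : ℂ) t, ∀ w ∈ ball (0 : ℂ) t, ‖c z - c w‖ ≤ L * ‖z - w‖ := by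
  obtain ⟨K, s, hs, hK⟩ := hc.hasStrictFDerivAt.exists_lipschitzOnWith
  obtain ⟨t, ht, hsub⟩ := Metric.mem_nhds_iff.1 (inter_mem hs hc.eventually_analyticAt)
  exact ⟨t, ht, K, K.2, fun z hz => (hsub hz).2.differentiableAt.differentiableWithinAt,
    fun z hz w hw => hK.norm_sub_le (hsub hz).1 (hsub hw).1⟩

theorem norm_mul_exp_le {v s : ℂ} (hs : ‖s‖ ≤ 1) : ‖v * Complex.exp s‖ ≤ 3 * ‖v‖ := by
  have hexp : ‖Complex.exp s‖ ≤ 3 := by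
    have htriangle := norm_add_le (Complex.exp s - 1) 1
    rw [sub_add_cancel, norm_one] at htriangle
    linarith [Complex.norm_exp_sub_one_le hs]
  rw [norm_mul, mul_comm]
  gcongr

theorem norm_sub_mul_exp_le {v s : ℂ} (hs : ‖s‖ ≤ 1) :
    ‖v - v * Complex.exp s‖ ≤ 2 * ‖v‖ * ‖s‖ :=
  calc ‖v - v * Complex.exp s‖ = ‖v‖ * ‖Complex.exp s - 1‖ := by
        rw [← norm_mul, ← norm_neg]; ring_nf
    _ ≤ ‖v‖ * (2 * ‖s‖) := by gcongr; exact Complex.norm_exp_sub_one_le hs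
    _ = 2 * ‖v‖ * ‖s‖ := by ring

theorem exists_norm_comp_sub_comp_mul_exp_le {c : ℂ → ℂ} (hc : AnalyticAt ℂ c 0) {ν : ℂ}
    (hν : ν ≠ 0) {γ r ρ C : ℝ} (hr : 0 ≤ r) (hρ : 0 < ρ) (hC : 0 ≤ C) {s : Phase → ℂ} {m : ℕ}
    (hs : DifferentiableOn ℂ s (scaledDomain ν γ r ρ))
    (hsC : ∀ p ∈ scaledDomain ν γ r ρ, ‖s p‖ ≤ C * ‖p.1‖ ^ m * ‖p.2‖) :
    ∃ ρ' ∈ Ioc 0 ρ, ∃ K ≥ 0,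
      DifferentiableOn ℂ (fun p => c (p.2.1 * p.2.2) - c (p.2.1 * p.2.2 * Complex.exp (s p)))
        (scaledDomain ν γ r ρ') ∧
      ∀ p ∈ scaledDomain ν γ r ρ',
        ‖c (p.2.1 * p.2.2) - c (p.2.1 * p.2.2 * Complex.exp (s p))‖ ≤
          K * ‖p.1‖ ^ m * ‖p.2‖ := by
  obtain ⟨t, ht, L, hL, hct, hcL⟩ := exists_lipschitz_of_analyticAt hc
  obtain ⟨ρ₁, hρ₁, hsmall⟩ :=
    exists_scaledDomain_mul_pow_mul_le (γ := γ) hν hr hρ hC one_pos m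
  set ρ' := min ρ₁ (min 1 (t / 4))
  have hρ' : 0 < ρ' := lt_min hρ₁.1 (by positivity)
  have hsub₁ : scaledDomain ν γ r ρ' ⊆ scaledDomain ν γ r ρ₁ :=
    scaledDomain_mono le_rfl le_rfl (min_le_left _ _)
  have hsub := hsub₁.trans (scaledDomain_mono le_rfl le_rfl hρ₁.2)
  have hs₁ : ∀ p ∈ scaledDomain ν γ r ρ', ‖s p‖ ≤ 1 := fun p hp =>
    (hsC p (hsub hp)).trans (hsmall p (hsub₁ hp))
  have hv : ∀ p ∈ scaledDomain ν γ r ρ', ‖p.2.1 * p.2.2‖ ≤ min 1 (t / 4) := fun p hp => by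
    have hy : ‖p.2‖ ≤ min 1 (t / 4) := hp.2.le.trans (min_le_right _ _)
    nlinarith [norm_snd_fst_mul_snd_snd_le p, norm_nonneg p.2, min_le_left 1 (t / 4)]
  have hvt : ∀ p ∈ scaledDomain ν γ r ρ', p.2.1 * p.2.2 ∈ ball (0 : ℂ) t := fun p hp =>
    mem_ball_zero_iff.2 (by linarith [hv p hp, min_le_right 1 (t / 4)])
  have hvst : ∀ p ∈ scaledDomain ν γ r ρ', p.2.1 * p.2.2 * Complex.exp (s p) ∈ ball (0 : ℂ) t :=
    fun p hp => mem_ball_zero_iff.2 (by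
      linarith [norm_mul_exp_le (v := p.2.1 * p.2.2) (hs₁ p hp), hv p hp, min_le_right 1 (t / 4)])
  refine ⟨ρ', ⟨hρ', (min_le_left _ _).trans hρ₁.2⟩, L * (2 * C), by positivity, ?_,
    fun p hp => ?_⟩
  · exact (hct.fun_comp (by fun_prop) hvt).fun_sub
      (hct.fun_comp (DifferentiableOn.fun_mul (by fun_prop) (hs.mono hsub).cexp) hvst)
  · calc ‖c (p.2.1 * p.2.2) - c (p.2.1 * p.2.2 * Complex.exp (s p))‖
        ≤ L * (2 * ‖p.2.1 * p.2.2‖ * ‖s p‖) :=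
          (hcL _ (hvt p hp) _ (hvst p hp)).trans (by gcongr; exact norm_sub_mul_exp_le (hs₁ p hp))
      _ ≤ L * (2 * 1 * (C * ‖p.1‖ ^ m * ‖p.2‖)) := by
          gcongr
          exacts [(hv p hp).trans (min_le_left _ _), hsC p (hsub hp)]
      _ = L * (2 * C) * ‖p.1‖ ^ m * ‖p.2‖ := by ring

theorem IsHomologicallySolvable.exists_pow_mul {Y : Phase → Phase} {U Ω : Set Phase}
    (hY : IsHomologicallySolvable Y U Ω) {L : ℝ} (hL : 0 ≤ L) {f : Phase → ℂ}
    (hf : IsRemainderOn U L f) (m : ℕ) :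
    ∃ χ : Phase → ℂ, DifferentiableOn ℂ χ Ω ∧
      (∀ p ∈ Ω, fderiv ℂ χ p (Y p) = p.1 ^ (m + 2) * f p) ∧
      ∃ C ≥ 0, ∀ p ∈ Ω, ‖χ p‖ ≤ C * ‖p.1‖ ^ (m + 1) * ‖p.2‖ := by
  refine hY _ m L hL (DifferentiableOn.fun_mul (by fun_prop) hf.1) fun p hp => ?_
  calc ‖p.1 ^ (m + 2) * f p‖ ≤ ‖p.1‖ ^ (m + 2) * (L * ‖p.2‖) := by
        rw [norm_mul, norm_pow]
        gcongr
        exact hf.2 p hp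
    _ = L * ‖p.1‖ ^ (m + 2) * ‖p.2‖ := by ring

/-- The exponents `χ₁`, `χ₂` of a conjugacy `(x, y₁ e^{χ₁}, y₂ e^{χ₂})` from
`normalizedUpTo M l a₁ a₂ c D R` to the normal form on `Ω`, of size `O(x^m 𝐲)`. -/
structure IsNormalizingExponents (M : ℕ) (l a₁ a₂ : ℂ) (c : ℂ → ℂ) (D R : Phase → ℂ) (m : ℕ)
    (C : ℝ) (Ω : Set Phase) (χ₁ χ₂ : Phase → ℂ) : Prop where
  diff₁ : DifferentiableOn ℂ χ₁ Ω
  diff₂ : DifferentiableOn ℂ χ₂ Ω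
  fderiv₁ : ∀ p ∈ Ω, fderiv ℂ χ₁ p (normalizedUpTo M l a₁ a₂ c D R p) =
    p.1 ^ M * (D p - R p) +
      (c (p.2.1 * p.2.2) - c (p.2.1 * p.2.2 * Complex.exp (χ₁ p + χ₂ p)))
  fderiv₂ : ∀ p ∈ Ω, fderiv ℂ χ₂ p (normalizedUpTo M l a₁ a₂ c D R p) =
    -p.1 ^ M * (D p + R p) -
      (c (p.2.1 * p.2.2) - c (p.2.1 * p.2.2 * Complex.exp (χ₁ p + χ₂ p)))
  norm_le₁ : ∀ p ∈ Ω, ‖χ₁ p‖ ≤ C * ‖p.1‖ ^ m * ‖p.2‖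
  norm_le₂ : ∀ p ∈ Ω, ‖χ₂ p‖ ≤ C * ‖p.1‖ ^ m * ‖p.2‖

variable {l a₁ a₂ : ℂ} {c : ℂ → ℂ} {D R : Phase → ℂ} {n : ℕ}

theorem exists_isNormalizingExponents_of_sum {U Ω : Set Phase} (hΩ : IsOpen Ω) (hΩU : Ω ⊆ U)
    (hY : IsHomologicallySolvable (normalizedUpTo (n + 3) l a₁ a₂ c D R) U Ω) {r L Cs K : ℝ}
    (hr : ∀ p ∈ U, ‖p.1‖ ≤ r) (hr₀ : 0 ≤ r) (hL : 0 ≤ L) (hCs : 0 ≤ Cs) (hK : 0 ≤ K)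
    (hDR : IsRemainderOn U L fun p => D p - R p) {s : Phase → ℂ} (hs : DifferentiableOn ℂ s U)
    (hsY : ∀ p ∈ U, fderiv ℂ s p (normalizedUpTo (n + 3) l a₁ a₂ c D R p) =
      p.1 ^ (n + 3) * (-2 * R p))
    (hsC : ∀ p ∈ U, ‖s p‖ ≤ Cs * ‖p.1‖ ^ (n + 2) * ‖p.2‖)
    (hg : DifferentiableOn ℂ
      (fun p => c (p.2.1 * p.2.2) - c (p.2.1 * p.2.2 * Complex.exp (s p))) U)
    (hgK : ∀ p ∈ U, ‖c (p.2.1 * p.2.2) - c (p.2.1 * p.2.2 * Complex.exp (s p))‖ ≤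
      K * ‖p.1‖ ^ (n + 2) * ‖p.2‖) :
    ∃ χ₁ χ₂ : Phase → ℂ, ∃ C ≥ 0,
      IsNormalizingExponents (n + 3) l a₁ a₂ c D R (n + 1) C Ω χ₁ χ₂ := by
  obtain ⟨χ, hχ, hχY, C, hC, hχC⟩ := hY
    (fun p => p.1 ^ (n + 3) * (D p - R p) +
      (c (p.2.1 * p.2.2) - c (p.2.1 * p.2.2 * Complex.exp (s p)))) n (L * r + K) (by positivity)
    ((DifferentiableOn.fun_mul (by fun_prop) hDR.1).fun_add hg) fun p hp => by
      refine (norm_add_le_of_le (?_ : _ ≤ L * r * ‖p.1‖ ^ (n + 2) * ‖p.2‖)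
        (hgK p hp)).trans_eq (by ring)
      refine le_trans ?_
        (mul_pow_succ_mul_le hL (norm_nonneg _) (hr p hp) (norm_nonneg _) (n + 2))
      calc ‖p.1 ^ (n + 3) * (D p - R p)‖ ≤ ‖p.1‖ ^ (n + 3) * (L * ‖p.2‖) := by
            rw [norm_mul, norm_pow]
            gcongr
            exact hDR.2 p hp
        _ = L * ‖p.1‖ ^ (n + 3) * ‖p.2‖ := by ring
  have hsC' : ∀ p ∈ Ω, ‖s p‖ ≤ Cs * r * ‖p.1‖ ^ (n + 1) * ‖p.2‖ := fun p hp =>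
    (hsC p (hΩU hp)).trans
      (mul_pow_succ_mul_le hCs (norm_nonneg _) (hr p (hΩU hp)) (norm_nonneg _) (n + 1))
  refine ⟨χ, fun p => s p - χ p, Cs * r + C, by positivity, hχ, (hs.mono hΩU).fun_sub hχ,
    fun p hp => ?_, fun p hp => ?_, fun p hp => (hχC p hp).trans ?_, fun p hp =>
      (norm_sub_le_of_le (hsC' p hp) (hχC p hp)).trans_eq (by ring)⟩
  · rw [hχY p hp, add_sub_cancel]
  · rw [fderiv_fun_sub ((hs.mono hΩU).differentiableAt (hΩ.mem_nhds hp))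
      (hχ.differentiableAt (hΩ.mem_nhds hp)), sub_apply, hχY p hp, hsY p (hΩU hp), add_sub_cancel]
    ring
  · gcongr
    exact le_add_of_nonneg_left (by positivity)

theorem exists_isNormalizingExponents {j : ℂ} {γ₀ γ₁ r ρ L : ℝ} (hl : l ≠ 0) (hj : j ^ 2 = -1)
    (hj_re : j.re = 0) (ha : 0 ≤ (a₁ + a₂).re) (hc : AnalyticAt ℂ c 0) (hc₀ : c 0 = 0)
    (hγ₀ : 0 ≤ γ₀) (hγ : γ₀ < γ₁) (hγ₁ : γ₁ < 1) (hr : 0 < r) (hρ : 0 < ρ) (hL : 0 ≤ L)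
    (hD : IsRemainderOn (scaledDomain (j * l) γ₁ r ρ) L D)
    (hR : IsRemainderOn (scaledDomain (j * l) γ₁ r ρ) L R) (n : ℕ) :
    ∃ r₀ > 0, ∃ ρ₀ > 0, ∃ χ₁ χ₂ : Phase → ℂ, ∃ C ≥ 0, IsNormalizingExponents (n + 3) l a₁ a₂ c D R
      (n + 1) C (scaledDomain (j * l) γ₀ r₀ ρ₀) χ₁ χ₂ := by
  have hν : j * l ≠ 0 := mul_ne_zero (by rintro rfl; norm_num at hj) hl
  obtain ⟨γ, hγ₀γ, hγγ₁⟩ := exists_between hγ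
  obtain ⟨r₁, hr₁, ρ₁, hρ₁, hsolve₁⟩ := exists_isHomologicallySolvable_normalizedUpTo (M := n + 3)
    hl hj hj_re ha hc hc₀ (hγ₀.trans hγ₀γ.le) hγγ₁ hγ₁ hr hρ (by omega) hL hD hR
  have hR₂ : IsRemainderOn (scaledDomain (j * l) γ₁ r ρ) (2 * L) fun p => -2 * R p := by
    refine ⟨hR.1.const_mul _, fun p hp => ?_⟩
    rw [norm_mul, norm_neg, Complex.norm_ofNat, mul_assoc]
    gcongr
    exact hR.2 p hp
  obtain ⟨s, hs, hsY, Cs, hCs, hsC⟩ := hsolve₁.exists_pow_mul (by positivity) hR₂ (n + 1)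
  obtain ⟨ρ₂, hρ₂, K, hK, hg, hgK⟩ :=
    exists_norm_comp_sub_comp_mul_exp_le hc hν hr₁.1.le hρ₁.1 hCs hs hsC
  have hsub₁ : scaledDomain (j * l) γ r₁ ρ₂ ⊆ scaledDomain (j * l) γ r₁ ρ₁ :=
    scaledDomain_mono le_rfl le_rfl hρ₂.2
  have hsub : scaledDomain (j * l) γ r₁ ρ₂ ⊆ scaledDomain (j * l) γ₁ r ρ :=
    hsub₁.trans (scaledDomain_mono hγγ₁.le hr₁.2 hρ₁.2)
  obtain ⟨r₀, hr₀, ρ₀, hρ₀, hsolve₀⟩ := exists_isHomologicallySolvable_normalizedUpTo (M := n + 3)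
    hl hj hj_re ha hc hc₀ hγ₀ hγ₀γ (hγγ₁.trans hγ₁) hr₁.1 hρ₂.1 (by omega) hL (hD.mono hsub)
    (hR.mono hsub)
  exact ⟨r₀, hr₀.1, ρ₀, hρ₀.1, exists_isNormalizingExponents_of_sum (isOpen_scaledDomain _ _ _ _)
    (scaledDomain_mono hγ₀γ.le hr₀.2 hρ₀.2) hsolve₀
    (fun p hp => (norm_fst_lt_of_mem_scaledDomain hν hp).le)
    (mul_nonneg (norm_nonneg _) hr₁.1.le) (add_nonneg hL hL) hCs hK ((hD.sub hR).mono hsub)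
    (hs.mono hsub₁) (fun p hp => hsY p (hsub₁ hp)) (fun p hp => hsC p (hsub₁ hp)) hg hgK⟩

end Exponents

/-! ### Sectors given by intervals of arguments -/

section Sectors

variable {r r' α α' β β' ρ η : ℝ} {ν z x : ℂ}

theorem sector_mono (hr : r ≤ r') (hα : α' ≤ α) (hβ : β ≤ β') :
    sector r α β ⊆ sector r' α' β' := by
  rintro x ⟨hpos, hlt, t, ht, hx⟩
  exact ⟨hpos, hlt.trans_le hr, t, ⟨hα.trans_lt ht.1, ht.2.trans_le hβ⟩, hx⟩

theorem polydisc_mono {ρ₁ ρ₁' ρ₂ ρ₂' : ℝ} (h₁ : ρ₁ ≤ ρ₁') (h₂ : ρ₂ ≤ ρ₂') :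
    polydisc ρ₁ ρ₂ ⊆ polydisc ρ₁' ρ₂' :=
  fun _ hy => ⟨hy.1.trans_le h₁, hy.2.trans_le h₂⟩

theorem mul_mem_sector {τ : ℝ} (hν : ν ≠ 0)
    (hτ : ν = (‖ν‖ : ℂ) * Complex.exp ((τ : ℂ) * Complex.I)) (hx : x ∈ sector r α β) :
    ν * x ∈ sector (‖ν‖ * r) (τ + α) (τ + β) := by
  obtain ⟨hpos, hlt, t, ht, hxt⟩ := hx
  refine ⟨by rw [norm_mul]; positivity, by rw [norm_mul]; gcongr, τ + t,
    ⟨by linarith [ht.1], by linarith [ht.2]⟩, ?_⟩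
  calc ν * x = ‖ν‖ * Complex.exp (τ * Complex.I) * (‖x‖ * Complex.exp (t * Complex.I)) := by
        rw [← hτ, ← hxt]
    _ = (‖ν * x‖ : ℂ) * Complex.exp ((τ + t : ℝ) * Complex.I) := by
        rw [norm_mul]
        push_cast
        rw [add_mul, Complex.exp_add]
        ring

theorem mem_sector_arg_iff (hν : ν ≠ 0) :
    x ∈ sector (‖ν‖ * r) (ν.arg + α) (ν.arg + β) ↔ ν⁻¹ * x ∈ sector r α β := by
  have hpolar := (Complex.norm_mul_exp_arg_mul_I ν).symm
  constructor <;> intro hx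
  · have hinv : ν⁻¹ = (‖ν⁻¹‖ : ℂ) * Complex.exp ((-ν.arg : ℝ) * Complex.I) := by
      nth_rewrite 1 [hpolar]
      rw [mul_inv, norm_inv, ← Complex.exp_neg]
      push_cast
      rw [neg_mul]
    simpa only [norm_inv, inv_mul_cancel_left₀ (norm_ne_zero_iff.2 hν), neg_add_cancel_left]
      using mul_mem_sector (inv_ne_zero hν) hinv hx
  · simpa only [mul_inv_cancel_left₀ hν] using mul_mem_sector hν hpolar hx

theorem sector_neg_eq_cosSector (hβ : β ∈ Ioo 0 Real.pi) :
    sector r (-β) β = cosSector (-Real.cos β) r := by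
  ext z
  simp only [sector, cosSector, mem_ofPred_eq, neg_neg]
  refine and_congr_right fun hz => and_congr_right fun _ => ⟨?_, fun hre => ?_⟩
  · rintro ⟨t, ht, hzt⟩
    rw [hzt, Complex.re_ofReal_mul, Complex.exp_ofReal_mul_I_re, ← hzt, mul_comm, ← Real.cos_abs t]
    exact mul_lt_mul_of_pos_left
      (Real.cos_lt_cos_of_nonneg_of_le_pi (abs_nonneg _) hβ.2.le (abs_lt.2 ht)) hz
  · refine ⟨z.arg, abs_lt.1 ?_, (Complex.norm_mul_exp_arg_mul_I z).symm⟩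
    by_contra! hle
    have hcos := Real.cos_le_cos_of_nonneg_of_le_pi hβ.1.le (Complex.abs_arg_le_pi z) hle
    rw [Real.cos_abs, Complex.cos_arg (norm_pos_iff.1 hz), div_le_iff₀ hz] at hcos
    linarith

theorem sector_prod_polydisc (hν : ν ≠ 0) (hβ : β ∈ Ioo 0 Real.pi) :
    sector (‖ν‖ * r) (ν.arg - β) (ν.arg + β) ×ˢ polydisc ρ ρ =
      scaledDomain ν (-Real.cos β) r ρ := by
  ext p
  rw [mem_prod, sub_eq_add_neg, mem_sector_arg_iff hν, sector_neg_eq_cosSector hβ]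
  simp only [scaledDomain, mem_preimage, scaleFst_apply, cosDomain, polydisc, mem_ofPred_eq,
    Prod.norm_def, max_lt_iff]

theorem IsSectorialNhd.inter {θ : ℝ} {S T : Set Phase} (hS : IsSectorialNhd θ η S)
    (hT : IsSectorialNhd θ η T) : IsSectorialNhd θ η (S ∩ T) := by
  obtain ⟨hS, r, hr, ρ₁, hρ₁, ρ₂, hρ₂, ε, hε, hsubS⟩ := hS
  obtain ⟨hT, r', hr', ρ₁', hρ₁', ρ₂', hρ₂', ε', hε', hsubT⟩ := hT
  have hε_le := min_le_left ε ε'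
  have hε_le' := min_le_right ε ε'
  refine ⟨hS.inter hT, min r r', lt_min hr hr', min ρ₁ ρ₁', lt_min hρ₁ hρ₁', min ρ₂ ρ₂',
    lt_min hρ₂ hρ₂', min ε ε', lt_min hε hε', subset_inter (Subset.trans ?_ hsubS)
      (Subset.trans ?_ hsubT)⟩
  · exact prod_mono (sector_mono (min_le_left _ _) (by linarith) (by linarith))
      (polydisc_mono (min_le_left _ _) (min_le_left _ _))
  · exact prod_mono (sector_mono (min_le_right _ _) (by linarith) (by linarith))
      (polydisc_mono (min_le_right _ _) (min_le_right _ _))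

theorem IsSectorialNhd.exists_scaledDomain_subset {S : Set Phase} (hν : ν ≠ 0) (hη₀ : 0 < η)
    (hη : η < 2 * Real.pi) (hS : IsSectorialNhd ν.arg η S) :
    ∃ β ∈ Ioo (η / 2) Real.pi, ∃ r > 0, ∃ ρ > 0, scaledDomain ν (-Real.cos β) r ρ ⊆ S := by
  obtain ⟨-, r, hr, ρ₁, hρ₁, ρ₂, hρ₂, ε, hε, hsub⟩ := hS
  obtain ⟨β, hβ, hβ_lt⟩ := exists_between
    (lt_min (by linarith : η / 2 < η / 2 + ε) (by linarith : η / 2 < Real.pi))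
  have hβε : β < η / 2 + ε := hβ_lt.trans_le (min_le_left _ _)
  have hβπ : β < Real.pi := hβ_lt.trans_le (min_le_right _ _)
  refine ⟨β, ⟨hβ, hβπ⟩, r / ‖ν‖, div_pos hr (norm_pos_iff.2 hν), min ρ₁ ρ₂, lt_min hρ₁ hρ₂, ?_⟩
  rw [← sector_prod_polydisc hν ⟨by linarith, hβπ⟩, mul_div_cancel₀ _ (norm_ne_zero_iff.2 hν)]
  exact (prod_mono (sector_mono le_rfl (by linarith) (by linarith))
    (polydisc_mono (min_le_left _ _) (min_le_right _ _))).trans hsub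

theorem exists_isRemainderOn_scaledDomain (hν : ν ≠ 0) (hη₀ : 0 < η) (hη : η < 2 * Real.pi)
    {D R : Phase → ℂ} (hD : IsSectorialRemainder ν.arg η D) (hR : IsSectorialRemainder ν.arg η R) :
    ∃ β ∈ Ioo (η / 2) Real.pi, ∃ r > 0, ∃ ρ > 0, ∃ L ≥ 0,
      IsRemainderOn (scaledDomain ν (-Real.cos β) r ρ) L D ∧
        IsRemainderOn (scaledDomain ν (-Real.cos β) r ρ) L R := by
  obtain ⟨S, hS, hDd, K, hK⟩ := hD
  obtain ⟨T, hT, hRd, K', hK'⟩ := hR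
  obtain ⟨β, hβ, r, hr, ρ, hρ, hsub⟩ := (hS.inter hT).exists_scaledDomain_subset hν hη₀ hη
  refine ⟨β, hβ, r, hr, ρ, hρ, max |K| |K'|, (abs_nonneg K).trans (le_max_left _ _),
    ⟨hDd.mono fun p hp => (hsub hp).1, fun p hp => (hK p (hsub hp).1).trans ?_⟩,
    ⟨hRd.mono fun p hp => (hsub hp).2, fun p hp => (hK' p (hsub hp).2).trans ?_⟩⟩
  · gcongr
    exact (le_abs_self K).trans (le_max_left _ _)
  · gcongr
    exact (le_abs_self K').trans (le_max_right _ _)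

end Sectors

/-! ### Fibred perturbations of the identity -/

section Biholomorphism

variable {E : Type*} [NormedAddCommGroup E] [NormedSpace ℂ E] [FiniteDimensional ℂ E]
  {f : E → E} {U : Set E}

theorem exists_equiv_eq_of_injective (T : E →L[ℂ] E) (hT : Function.Injective T) :
    ∃ L : E ≃L[ℂ] E, (L : E →L[ℂ] E) = T :=
  ⟨(LinearEquiv.ofInjectiveEndo (T : E →ₗ[ℂ] E) hT).toContinuousLinearEquiv, by ext; rfl⟩

theorem isOpenMap_domRestrict_of_injective_fderiv (hU : IsOpen U) (hf : DifferentiableOn ℂ f U)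
    (hf' : ∀ x ∈ U, Function.Injective (fderiv ℂ f x)) : IsOpenMap (U.domRestrict f) := by
  have : CompleteSpace E := FiniteDimensional.complete ℂ E
  rw [isOpenMap_iff_nhds_le]
  rintro ⟨x, hx⟩
  obtain ⟨L, hL⟩ := exists_equiv_eq_of_injective _ (hf' x hx)
  have hstrict := hasStrictFDerivAt_of_differentiableOn hU hf hx
  rw [← hL] at hstrict
  have hmap : map (U.domRestrict f) (𝓝 ⟨x, hx⟩) = map f (𝓝 x) := by
    rw [← map_nhds_subtype_coe_eq_nhds hx (hU.mem_nhds hx), map_map]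
    rfl
  rw [hmap, hstrict.map_nhds_eq_of_equiv]
  rfl

theorem exists_openPartialHomeomorph_of_injOn (hU : IsOpen U) (hf : DifferentiableOn ℂ f U)
    (hinj : InjOn f U) (hf' : ∀ x ∈ U, Function.Injective (fderiv ℂ f x)) :
    ∃ e : OpenPartialHomeomorph E E,
      e.source = U ∧ ⇑e = f ∧ DifferentiableOn ℂ e.symm e.target := by
  set e := OpenPartialHomeomorph.ofContinuousOpenRestrict (hinj.toPartialEquiv f U)
    hf.continuousOn (isOpenMap_domRestrict_of_injective_fderiv hU hf hf') hU
  refine ⟨e, rfl, rfl, fun q hq => ?_⟩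
  have hmem : e.symm q ∈ U := e.map_target hq
  obtain ⟨L, hL⟩ := exists_equiv_eq_of_injective _ (hf' _ hmem)
  have hderiv := (hf.differentiableAt (hU.mem_nhds hmem)).hasFDerivAt
  rw [← hL] at hderiv
  exact (e.hasFDerivAt_symm hq hderiv).differentiableAt.differentiableWithinAt

end Biholomorphism

section FibredPerturbation

variable {E F : Type*} [NormedAddCommGroup E] [NormedSpace ℂ E] [NormedAddCommGroup F]
  [NormedSpace ℂ F]

/-- `Ψ` is holomorphic on `U`, of the form `(x, y) ↦ (x, y + ψ (x, y))`, and `ψ (x, ·)` is a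
contraction for every `x`. -/
structure IsFibredPerturbation (Ψ : E × F → E × F) (U : Set (E × F)) : Prop where
  diff : DifferentiableOn ℂ Ψ U
  fst_eq : ∀ p, (Ψ p).1 = p.1
  norm_sub_le : ∀ p ∈ U, ∀ q ∈ U, p.1 = q.1 →
    ‖((Ψ p).2 - p.2) - ((Ψ q).2 - q.2)‖ ≤ 1 / 2 * ‖p.2 - q.2‖

namespace IsFibredPerturbation

variable {Ψ : E × F → E × F} {U : Set (E × F)}

theorem injOn (hΨ : IsFibredPerturbation Ψ U) : InjOn Ψ U := by
  intro p hp q hq hpq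
  have hfst : p.1 = q.1 := by rw [← hΨ.fst_eq p, ← hΨ.fst_eq q, hpq]
  have hcontract := hΨ.norm_sub_le p hp q hq hfst
  rw [hpq, sub_sub_sub_cancel_left, norm_sub_rev] at hcontract
  have hsnd : ‖p.2 - q.2‖ = 0 := by linarith [norm_nonneg (p.2 - q.2)]
  exact Prod.ext hfst (sub_eq_zero.1 (norm_eq_zero.1 hsnd))

theorem fderiv_apply_fst (hΨ : IsFibredPerturbation Ψ U) (hU : IsOpen U) {p : E × F} (hp : p ∈ U)
    (w : E × F) : (fderiv ℂ Ψ p w).1 = w.1 := by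
  have hfst : HasFDerivAt (fun q => (Ψ q).1)
      ((ContinuousLinearMap.fst ℂ E F).comp (fderiv ℂ Ψ p)) p :=
    hasFDerivAt_fst.comp p (hΨ.diff.differentiableAt (hU.mem_nhds hp)).hasFDerivAt
  simp only [hΨ.fst_eq] at hfst
  simpa using congrArg (fun T : E × F →L[ℂ] E => T w) (hfst.unique hasFDerivAt_fst)

theorem norm_fderiv_apply_snd_sub_le (hΨ : IsFibredPerturbation Ψ U) (hU : IsOpen U) {p : E × F}
    (hp : p ∈ U) (v : F) : ‖(fderiv ℂ Ψ p (0, v)).2 - v‖ ≤ 1 / 2 * ‖v‖ := by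
  have hderiv : HasFDerivAt (fun y => (Ψ (p.1, y)).2 - y)
      (((ContinuousLinearMap.snd ℂ E F).comp
        ((fderiv ℂ Ψ p).comp (ContinuousLinearMap.inr ℂ E F))) - ContinuousLinearMap.id ℂ F) p.2 :=
    (hasFDerivAt_snd.comp p.2 ((hΨ.diff.differentiableAt (hU.mem_nhds hp)).hasFDerivAt.comp p.2
      (hasFDerivAt_prodMk_right p.1 p.2))).sub (hasFDerivAt_id _)
  have hfibre : Continuous fun y : F => (p.1, y) := by fun_prop
  have hnorm := hderiv.le_of_lip' (C := 1 / 2) (by norm_num) (by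
    filter_upwards [hfibre.continuousAt.preimage_mem_nhds (hU.mem_nhds hp)] with y hy
    exact hΨ.norm_sub_le (p.1, y) hy p hp rfl)
  exact ContinuousLinearMap.le_of_opNorm_le _ hnorm v

theorem injective_fderiv (hΨ : IsFibredPerturbation Ψ U) (hU : IsOpen U) {p : E × F}
    (hp : p ∈ U) : Function.Injective (fderiv ℂ Ψ p) := by
  refine (injective_iff_map_eq_zero _).2 fun w hw => ?_
  have hfst : w.1 = 0 := by rw [← hΨ.fderiv_apply_fst hU hp w, hw]; rfl
  have hsnd := hΨ.norm_fderiv_apply_snd_sub_le hU hp w.2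
  rw [← hfst, Prod.mk.eta, hw, Prod.snd_zero, zero_sub, norm_neg] at hsnd
  exact Prod.ext hfst (norm_eq_zero.1 (by linarith [norm_nonneg w.2]))

theorem exists_openPartialHomeomorph [FiniteDimensional ℂ E] [FiniteDimensional ℂ F]
    (hΨ : IsFibredPerturbation Ψ U) (hU : IsOpen U) :
    ∃ e : OpenPartialHomeomorph (E × F) (E × F),
      e.source = U ∧ ⇑e = Ψ ∧ DifferentiableOn ℂ e.symm e.target :=
  exists_openPartialHomeomorph_of_injOn hU hΨ.diff hΨ.injOn fun _ hp => hΨ.injective_fderiv hU hp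

theorem of_norm_sub_le {S : Set E} {ρ : ℝ} (hρ : 0 < ρ)
    (hΨ : DifferentiableOn ℂ Ψ (S ×ˢ ball 0 (2 * ρ))) (hfst : ∀ p, (Ψ p).1 = p.1)
    (hclose : ∀ p ∈ S ×ˢ ball (0 : F) (2 * ρ), ‖(Ψ p).2 - p.2‖ ≤ ρ / 4) :
    IsFibredPerturbation Ψ (S ×ˢ ball 0 ρ) := by
  refine ⟨hΨ.mono (prod_mono subset_rfl (ball_subset_ball (by linarith))), hfst, ?_⟩
  rintro ⟨x, y⟩ ⟨hx, hy⟩ ⟨x', z⟩ ⟨-, hz⟩ rfl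
  have hmem : MapsTo (fun y => (x, y)) (ball (0 : F) (2 * ρ)) (S ×ˢ ball 0 (2 * ρ)) :=
    fun y hy => ⟨hx, hy⟩
  have hd : DifferentiableOn ℂ (fun y => (Ψ (x, y)).2 - y) (ball 0 (2 * ρ)) :=
    (hΨ.fun_comp (by fun_prop) hmem).snd.fun_sub differentiableOn_id
  calc ‖((Ψ (x, y)).2 - y) - ((Ψ (x, z)).2 - z)‖ ≤ 2 * (ρ / 4) / ρ * ‖y - z‖ :=
        norm_sub_le_of_bounded hρ hd (fun y hy => hclose _ (hmem hy))
          (ball_subset_closedBall hy) (ball_subset_closedBall hz)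
    _ = 1 / 2 * ‖y - z‖ := by field_simp; norm_num

end IsFibredPerturbation

end FibredPerturbation

/-! ### The conjugacy -/

section Conjugacy

/-- The map `(x, y₁, y₂) ↦ (x, y₁ e^{χ₁}, y₂ e^{χ₂})`, the shape of all the conjugacies to the
normal form built here. -/
def expMap (χ₁ χ₂ : Phase → ℂ) (p : Phase) : Phase :=
  (p.1, p.2.1 * Complex.exp (χ₁ p), p.2.2 * Complex.exp (χ₂ p))

section ExpMap

variable {χ₁ χ₂ : Phase → ℂ} {U : Set Phase} {p : Phase}

theorem differentiableOn_expMap (hχ₁ : DifferentiableOn ℂ χ₁ U) (hχ₂ : DifferentiableOn ℂ χ₂ U) :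
    DifferentiableOn ℂ (expMap χ₁ χ₂) U :=
  DifferentiableOn.prodMk (by fun_prop) (DifferentiableOn.prodMk
    (DifferentiableOn.fun_mul (by fun_prop) hχ₁.cexp)
    (DifferentiableOn.fun_mul (by fun_prop) hχ₂.cexp))

theorem fderiv_expMap_apply (hχ₁ : DifferentiableAt ℂ χ₁ p) (hχ₂ : DifferentiableAt ℂ χ₂ p)
    (w : Phase) :
    fderiv ℂ (expMap χ₁ χ₂) p w =
      (w.1, Complex.exp (χ₁ p) * (w.2.1 + p.2.1 * fderiv ℂ χ₁ p w),
        Complex.exp (χ₂ p) * (w.2.2 + p.2.2 * fderiv ℂ χ₂ p w)) := by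
  have hy₁ : HasFDerivAt (fun p : Phase => p.2.1) ((ContinuousLinearMap.fst ℂ ℂ ℂ).comp
      (ContinuousLinearMap.snd ℂ ℂ (ℂ × ℂ))) p := hasFDerivAt_fst.comp p hasFDerivAt_snd
  have hy₂ : HasFDerivAt (fun p : Phase => p.2.2) ((ContinuousLinearMap.snd ℂ ℂ ℂ).comp
      (ContinuousLinearMap.snd ℂ ℂ (ℂ × ℂ))) p := hasFDerivAt_snd.comp p hasFDerivAt_snd
  have hderiv : HasFDerivAt (expMap χ₁ χ₂) _ p := (hasFDerivAt_fst (p := p)).prodMk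
    ((hy₁.mul hχ₁.hasFDerivAt.cexp).prodMk (hy₂.mul hχ₂.hasFDerivAt.cexp))
  rw [hderiv.fderiv]
  simp only [ContinuousLinearMap.prod_apply, ContinuousLinearMap.coe_fst', add_apply, smul_apply,
    ContinuousLinearMap.comp_apply, ContinuousLinearMap.coe_snd', smul_eq_mul]
  refine Prod.ext rfl (Prod.ext ?_ ?_) <;> simp only <;> ring

theorem norm_expMap_snd_sub_le {B : ℝ} (hχ₁ : ‖χ₁ p‖ ≤ B) (hχ₂ : ‖χ₂ p‖ ≤ B) (hB : B ≤ 1) :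
    ‖(expMap χ₁ χ₂ p).2 - p.2‖ ≤ 2 * B * ‖p.2‖ := by
  have hB₀ : 0 ≤ B := (norm_nonneg _).trans hχ₁
  have hcoord : ∀ y z : ℂ, ‖y‖ ≤ ‖p.2‖ → ‖z‖ ≤ B → ‖y * Complex.exp z - y‖ ≤ 2 * B * ‖p.2‖ := by
    intro y z hy hz
    calc ‖y * Complex.exp z - y‖ = ‖Complex.exp z - 1‖ * ‖y‖ := by rw [← norm_mul]; ring_nf
      _ ≤ 2 * ‖z‖ * ‖y‖ := by gcongr; exact Complex.norm_exp_sub_one_le (hz.trans hB)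
      _ ≤ 2 * B * ‖p.2‖ := by gcongr
  exact norm_prod_le_iff.2 ⟨hcoord _ _ (norm_fst_le _) hχ₁, hcoord _ _ (norm_snd_le _) hχ₂⟩

end ExpMap

theorem scaledDomain_eq_prod (ν : ℂ) (γ r ρ : ℝ) :
    scaledDomain ν γ r ρ = {x | ν⁻¹ * x ∈ cosSector γ r} ×ˢ ball (0 : ℂ × ℂ) ρ := by
  ext p
  simp only [mem_prod, mem_ball_zero_iff]
  rfl

section Fibred

variable {Ψ : Phase → Phase} {U : Set Phase} {K : ℝ}

theorem isBigO_sub_of_norm_snd_sub_le (hfst : ∀ p ∈ U, (Ψ p).1 = p.1)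
    (hK : ∀ p ∈ U, ‖(Ψ p).2 - p.2‖ ≤ K * ‖p.2‖ ^ 2) :
    (fun p => Ψ p - p) =O[𝓝[U] 0] fun p => ‖p‖ ^ 2 := by
  refine IsBigO.of_bound |K| (eventually_mem_nhdsWithin.mono fun p hp => ?_)
  calc ‖Ψ p - p‖ = ‖(Ψ p).2 - p.2‖ := by
        rw [Prod.norm_def, Prod.fst_sub, hfst p hp, sub_self, norm_zero, Prod.snd_sub]
        exact max_eq_right (norm_nonneg _)
    _ ≤ |K| * ‖p‖ ^ 2 := (hK p hp).trans (by gcongr; exacts [le_abs_self K, norm_snd_le p])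
    _ = |K| * ‖‖p‖ ^ 2‖ := by rw [norm_pow, norm_norm]

theorem exists_eq_add_pow_smul {m : ℕ} (hU : ∀ p ∈ U, p.1 ≠ 0) (hΨ : DifferentiableOn ℂ Ψ U)
    (hfst : ∀ p ∈ U, (Ψ p).1 = p.1)
    (hK : ∀ p ∈ U, ‖(Ψ p).2 - p.2‖ ≤ K * ‖p.1‖ ^ m * ‖p.2‖ ^ 2) :
    ∃ P : Phase → ℂ × ℂ, DifferentiableOn ℂ P U ∧
      (∀ p ∈ U, Ψ p = p + p.1 ^ m • ((0, P p) : Phase)) ∧ ∀ p ∈ U, ‖P p‖ ≤ K * ‖p.2‖ ^ 2 := by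
  refine ⟨fun p => (p.1 ^ m)⁻¹ • ((Ψ p).2 - p.2), ?_, fun p hp => Prod.ext ?_ ?_, fun p hp => ?_⟩
  · exact (DifferentiableOn.fun_inv (by fun_prop) fun p hp => pow_ne_zero m (hU p hp)).fun_smul
      (hΨ.snd.fun_sub differentiableOn_snd)
  · rw [hfst p hp, Prod.fst_add, Prod.smul_fst, smul_zero, add_zero]
  · rw [Prod.snd_add, Prod.smul_snd, smul_inv_smul₀ (pow_ne_zero m (hU p hp)), add_sub_cancel]
  · rw [norm_smul, norm_inv, norm_pow, inv_mul_le_iff₀ (pow_pos (norm_pos_iff.2 (hU p hp)) m)]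
    exact (hK p hp).trans_eq (by ring)

end Fibred

namespace IsNormalizingExponents

variable {M m : ℕ} {l a₁ a₂ : ℂ} {c : ℂ → ℂ} {D R χ₁ χ₂ : Phase → ℂ} {C : ℝ} {Ω : Set Phase}

theorem fderiv_expMap (hχ : IsNormalizingExponents M l a₁ a₂ c D R m C Ω χ₁ χ₂) (hΩ : IsOpen Ω)
    {p : Phase} (hp : p ∈ Ω) :
    fderiv ℂ (expMap χ₁ χ₂) p (normalizedUpTo M l a₁ a₂ c D R p) =
      normalForm l a₁ a₂ c (expMap χ₁ χ₂ p) := by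
  have hv : p.2.1 * Complex.exp (χ₁ p) * (p.2.2 * Complex.exp (χ₂ p)) =
      p.2.1 * p.2.2 * Complex.exp (χ₁ p + χ₂ p) := by rw [Complex.exp_add]; ring
  rw [fderiv_expMap_apply (hχ.diff₁.differentiableAt (hΩ.mem_nhds hp))
    (hχ.diff₂.differentiableAt (hΩ.mem_nhds hp)), hχ.fderiv₁ p hp, hχ.fderiv₂ p hp]
  simp only [normalForm, expMap, hv, normalizedUpTo, fieldY₀, fieldC, fieldR, Prod.smul_mk,
    Prod.mk_add_mk, smul_eq_mul]
  refine Prod.ext ?_ (Prod.ext ?_ ?_) <;> simp only <;> ring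

theorem eqOn_pushforward (hχ : IsNormalizingExponents M l a₁ a₂ c D R m C Ω χ₁ χ₂) (hΩ : IsOpen Ω)
    {Ψ : OpenPartialHomeomorph Phase Phase} (hΨ : ⇑Ψ = expMap χ₁ χ₂) (hsource : Ψ.source ⊆ Ω) :
    EqOn (pushforward Ψ (normalizedUpTo M l a₁ a₂ c D R)) (normalForm l a₁ a₂ c) Ψ.target :=
  fun q hq => by
    rw [pushforward, hΨ, hχ.fderiv_expMap hΩ (hsource (Ψ.map_target hq)), ← hΨ, Ψ.right_inv hq]

theorem exists_openPartialHomeomorph {ν : ℂ} {γ r ρ₀ : ℝ}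
    (hχ : IsNormalizingExponents M l a₁ a₂ c D R m C (scaledDomain ν γ r ρ₀) χ₁ χ₂) (hν : ν ≠ 0)
    (hr : 0 ≤ r) (hρ₀ : 0 < ρ₀) (hC : 0 ≤ C) :
    ∃ ρ ∈ Ioc 0 ρ₀, ∃ Ψ : OpenPartialHomeomorph Phase Phase,
      Ψ.source = scaledDomain ν γ r ρ ∧ ⇑Ψ = expMap χ₁ χ₂ ∧
      DifferentiableOn ℂ Ψ.symm Ψ.target ∧
      ∀ p ∈ Ψ.source, ‖(Ψ p).2 - p.2‖ ≤ 2 * C * ‖p.1‖ ^ m * ‖p.2‖ ^ 2 := by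
  obtain ⟨ρ₁, hρ₁, hsmall⟩ := exists_scaledDomain_mul_pow_mul_le (γ := γ) hν hr hρ₀ hC
    (by norm_num : (0 : ℝ) < 1 / 16) m
  obtain ⟨ρ, rfl⟩ : ∃ ρ, ρ₁ = 2 * ρ := ⟨ρ₁ / 2, by ring⟩
  have hρ : 0 < ρ := by linarith [hρ₁.1]
  have hsub := scaledDomain_mono (ν := ν) (γ := γ) le_rfl (le_refl r) hρ₁.2
  have hnorm : ∀ p ∈ scaledDomain ν γ r (2 * ρ),
      ‖(expMap χ₁ χ₂ p).2 - p.2‖ ≤ 2 * (C * ‖p.1‖ ^ m * ‖p.2‖) * ‖p.2‖ := fun p hp =>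
    norm_expMap_snd_sub_le (hχ.norm_le₁ p (hsub hp)) (hχ.norm_le₂ p (hsub hp))
      ((hsmall p hp).trans (by norm_num))
  have hpert : IsFibredPerturbation (expMap χ₁ χ₂) (scaledDomain ν γ r ρ) := by
    rw [scaledDomain_eq_prod]
    refine IsFibredPerturbation.of_norm_sub_le hρ ?_ (fun _ => rfl) ?_ <;>
      rw [← scaledDomain_eq_prod]
    · exact (differentiableOn_expMap hχ.diff₁ hχ.diff₂).mono hsub
    · intro p hp
      calc ‖(expMap χ₁ χ₂ p).2 - p.2‖ ≤ 2 * (1 / 16) * (2 * ρ) :=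
            (hnorm p hp).trans (by gcongr; exacts [hsmall p hp, hp.2.le])
        _ = ρ / 4 := by ring
  obtain ⟨Ψ, hsource, hΨ, hsymm⟩ := hpert.exists_openPartialHomeomorph (isOpen_scaledDomain _ _ _ _)
  refine ⟨ρ, ⟨hρ, by linarith [hρ₁.2]⟩, Ψ, hsource, hΨ, hsymm, fun p hp => ?_⟩
  rw [hsource] at hp
  rw [hΨ]
  exact (hnorm p (scaledDomain_mono le_rfl le_rfl (by linarith) hp)).trans_eq (by ring)

end IsNormalizingExponents

theorem isSectorialNhd_scaledDomain {ν : ℂ} {η β r ρ : ℝ} (hν : ν ≠ 0)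
    (hη₀ : 0 < η) (hβ : β ∈ Ioo (η / 2) Real.pi) (hr : 0 < r) (hρ : 0 < ρ) :
    IsSectorialNhd ν.arg η (scaledDomain ν (-Real.cos β) r ρ) := by
  refine ⟨isOpen_scaledDomain _ _ _ _, ‖ν‖ * r, by positivity, ρ, hρ, ρ, hρ, β - η / 2,
    sub_pos.2 hβ.1, ?_⟩
  rw [← sector_prod_polydisc hν ⟨by linarith [hβ.1], hβ.2⟩]
  exact prod_mono (sector_mono le_rfl (by linarith) (by linarith)) subset_rfl

theorem exists_neg_cos_lt_neg_cos {η β₁ : ℝ} (hη : Real.pi < η) (hβ₁ : β₁ ∈ Ioo (η / 2) Real.pi) :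
    ∃ β ∈ Ioo (η / 2) Real.pi,
      0 ≤ -Real.cos β ∧ -Real.cos β < -Real.cos β₁ ∧ -Real.cos β₁ < 1 := by
  have hπ := Real.pi_pos
  obtain ⟨β, hβ, hββ₁⟩ := exists_between hβ₁.1
  have hcos := Real.cos_nonpos_of_pi_div_two_le_of_le (x := β) (by linarith) (by linarith [hβ₁.2])
  have hcos_lt := Real.cos_lt_cos_of_nonneg_of_le_pi (by linarith) hβ₁.2.le hββ₁
  have hcos_pi := Real.cos_lt_cos_of_nonneg_of_le_pi (by linarith [hβ₁.1]) le_rfl hβ₁.2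
  rw [Real.cos_pi] at hcos_pi
  exact ⟨β, ⟨hβ, hββ₁.trans hβ₁.2⟩, by linarith, by linarith, by linarith⟩

theorem units_mul_I_sq (σ : ℤˣ) : (((σ : ℤ) : ℂ) * Complex.I) ^ 2 = -1 := by
  rw [mul_pow, Complex.I_sq, ← Int.cast_pow, ← Units.val_pow_eq_pow_val, Int.units_sq,
    Units.val_one, Int.cast_one, one_mul]

theorem exists_isSectorialDiffeo {l a₁ a₂ j : ℂ} {c : ℂ → ℂ} {D R : Phase → ℂ} {η : ℝ}
    (hl : l ≠ 0) (hj : j ^ 2 = -1) (hj_re : j.re = 0) (ha : 0 ≤ (a₁ + a₂).re)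
    (hc : AnalyticAt ℂ c 0) (hc₀ : c 0 = 0) (hη : η ∈ Ioo Real.pi (2 * Real.pi))
    (hD : IsSectorialRemainder (j * l).arg η D) (hR : IsSectorialRemainder (j * l).arg η R)
    (n : ℕ) :
    ∃ Ψ : OpenPartialHomeomorph Phase Phase, IsSectorialDiffeo (j * l).arg η Ψ ∧
      EqOn (pushforward Ψ (normalizedUpTo (n + 3) l a₁ a₂ c D R)) (normalForm l a₁ a₂ c)
        Ψ.target ∧
      (∃ K, ∀ p ∈ Ψ.source, ‖(Ψ p).2 - p.2‖ ≤ K * ‖p.2‖ ^ 2) ∧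
      ∃ β ∈ Ioo (η / 2) Real.pi, ∃ r > 0, ∃ ρ > 0,
        Ψ.source = sector r ((j * l).arg - β) ((j * l).arg + β) ×ˢ polydisc ρ ρ ∧
        ∃ K, ∀ p ∈ Ψ.source, ‖(Ψ p).2 - p.2‖ ≤ K * ‖p.1‖ ^ (n + 1) * ‖p.2‖ ^ 2 := by
  have hν : j * l ≠ 0 := mul_ne_zero (by rintro rfl; norm_num at hj) hl
  have hη₀ : 0 < η := Real.pi_pos.trans hη.1
  obtain ⟨β₁, hβ₁, r₁, hr₁, ρ₁, hρ₁, L, hL, hD', hR'⟩ :=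
    exists_isRemainderOn_scaledDomain hν hη₀ hη.2 hD hR
  obtain ⟨β, hβ, hβ_cos, hββ₁_cos, hβ₁_cos⟩ := exists_neg_cos_lt_neg_cos hη.1 hβ₁
  obtain ⟨r, hr, ρ₀, hρ₀, χ₁, χ₂, C, hC, hχ⟩ := exists_isNormalizingExponents hl hj hj_re ha hc hc₀
    hβ_cos hββ₁_cos hβ₁_cos hr₁ hρ₁ hL hD' hR' n
  obtain ⟨ρ, hρ, Ψ, hsource, hΨ, hsymm, hK⟩ := hχ.exists_openPartialHomeomorph hν hr.le hρ₀ hC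
  have hsub : Ψ.source ⊆ scaledDomain (j * l) (-Real.cos β) r ρ₀ :=
    hsource.subset.trans (scaledDomain_mono le_rfl le_rfl hρ.2)
  have hfst : ∀ p ∈ Ψ.source, (Ψ p).1 = p.1 := fun p _ => by rw [hΨ]; rfl
  have hK' : ∀ p ∈ Ψ.source,
      ‖(Ψ p).2 - p.2‖ ≤ 2 * C * (‖j * l‖ * r) ^ (n + 1) * ‖p.2‖ ^ 2 := fun p hp =>
    (hK p hp).trans (by gcongr; exact (norm_fst_lt_of_mem_scaledDomain hν (hsub hp)).le)
  refine ⟨Ψ, ⟨?_, ?_, hsymm, hfst, isBigO_sub_of_norm_snd_sub_le hfst hK'⟩,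
    hχ.eqOn_pushforward (isOpen_scaledDomain _ _ _ _) hΨ hsub, ⟨_, hK'⟩, β, hβ, ‖j * l‖ * r,
    by positivity, ρ, hρ.1, ?_, 2 * C, hK⟩
  · exact hsource ▸ isSectorialNhd_scaledDomain hν hη₀ hβ hr hρ.1
  · exact hΨ ▸ (differentiableOn_expMap hχ.diff₁ hχ.diff₂).mono hsub
  · rw [hsource, sector_prod_polydisc hν ⟨by linarith [hβ.1], hβ.2⟩]

end Conjugacy

end SaddleNode

end

open SaddleNode in
theorem mainTheorem6_general (l a₁ a₂ : ℂ) (hl : l ≠ 0) (ha : 0 ≤ (a₁ + a₂).re)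
    (N : ℕ) (hN : 0 < N) (c : ℂ → ℂ) (hc : AnalyticAt ℂ c 0) (hc0 : c 0 = 0) (σ : ℤˣ)
    (D R : Phase → ℂ) (η : ℝ) (hη : η ∈ Ioo Real.pi (2 * Real.pi))
    (hD : IsSectorialRemainder (direction l σ) η D)
    (hR : IsSectorialRemainder (direction l σ) η R) :
    ∃ Ψ : OpenPartialHomeomorph Phase Phase,
      IsSectorialDiffeo (direction l σ) η Ψ ∧
      EqOn (pushforward Ψ (normalizedUpTo (N + 2) l a₁ a₂ c D R)) (normalForm l a₁ a₂ c)
        Ψ.target ∧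
      (∃ K : ℝ, ∀ p ∈ Ψ.source, ‖(Ψ p).2 - p.2‖ ≤ K * ‖p.2‖ ^ 2) ∧
      ∃ r > 0, ∃ ε ∈ Ioo 0 (Real.pi / 2), η < Real.pi + 2 * ε ∧
        ∃ ρ₁ > 0, ∃ ρ₂ > 0, ∃ P : Phase → ℂ × ℂ, ∃ K : ℝ,
          Ψ.source = wideSector l σ r ε ×ˢ polydisc ρ₁ ρ₂ ∧
          DifferentiableOn ℂ P Ψ.source ∧
          (∀ p ∈ Ψ.source, Ψ p = p + p.1 ^ N • ((0, P p) : Phase)) ∧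
          ∀ p ∈ Ψ.source, ‖P p‖ ≤ K * ‖p.2‖ ^ 2 := by
  obtain ⟨n, rfl⟩ : ∃ n, N = n + 1 := ⟨N - 1, by omega⟩
  have hdir : direction l σ = (((σ : ℤ) : ℂ) * Complex.I * l).arg := by rw [direction, mul_assoc]
  have hre : (((σ : ℤ) : ℂ) * Complex.I).re = 0 := by simp
  rw [hdir] at hD hR
  obtain ⟨Ψ, hΨ, hpush, hquad, β, hβ, r, hr, ρ, hρ, hsource, K, hK⟩ :=
    exists_isSectorialDiffeo hl (units_mul_I_sq σ) hre ha hc hc0 hη hD hR n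
  rw [← hdir] at hΨ hsource
  have hsource' : Ψ.source = wideSector l σ r (β - Real.pi / 2) ×ˢ polydisc ρ ρ := by
    rw [hsource, wideSector, sub_sub, add_assoc, add_sub_cancel]
  have hx : ∀ p ∈ Ψ.source, p.1 ≠ 0 := fun p hp => norm_pos_iff.1 (hsource.subset hp).1.1
  obtain ⟨P, hP, hΨP, hPK⟩ := exists_eq_add_pow_smul hx hΨ.holomorphic hΨ.fibered hK
  have hε : β - Real.pi / 2 ∈ Ioo 0 (Real.pi / 2) :=
    ⟨by linarith [hη.1, hβ.1], by linarith [hβ.2]⟩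
  exact ⟨Ψ, hΨ, hpush, hquad, r, hr, β - Real.pi / 2, hε, by linarith [hβ.1], ρ, hρ, ρ, hρ, P, K,
    hsource', hP, hΨP, hPK⟩

theorem mainTheorem6 (l a₁ a₂ : ℂ) (hl : l ≠ 0) (ha : 0 < (a₁ + a₂).re)
    (N : ℕ) (hN : 0 < N) (c : ℂ → ℂ) (hc : AnalyticAt ℂ c 0) (hc0 : c 0 = 0)
    (D R : ℤˣ → SaddleNode.Phase → ℂ)
    (η : ℝ) (hη : η ∈ Set.Ioo Real.pi (2 * Real.pi))
    (hD : ∀ σ : ℤˣ, SaddleNode.IsSectorialRemainder (SaddleNode.direction l σ) η (D σ))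
    (hR : ∀ σ : ℤˣ, SaddleNode.IsSectorialRemainder (SaddleNode.direction l σ) η (R σ)) :
    ∀ σ : ℤˣ, ∃ Ψ : OpenPartialHomeomorph SaddleNode.Phase SaddleNode.Phase,
      SaddleNode.IsSectorialDiffeo (SaddleNode.direction l σ) η Ψ ∧
      Set.EqOn
        (SaddleNode.pushforward Ψ (SaddleNode.normalizedUpTo (N + 2) l a₁ a₂ c (D σ) (R σ)))
        (SaddleNode.normalForm l a₁ a₂ c) Ψ.target ∧
      (∃ K : ℝ, ∀ p ∈ Ψ.source, ‖(Ψ p).2 - p.2‖ ≤ K * ‖p.2‖ ^ 2) ∧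
      ∃ r > 0, ∃ ε ∈ Set.Ioo 0 (Real.pi / 2), η < Real.pi + 2 * ε ∧
        ∃ ρ₁ > 0, ∃ ρ₂ > 0, ∃ P : SaddleNode.Phase → ℂ × ℂ, ∃ K : ℝ,
          Ψ.source = SaddleNode.wideSector l σ r ε ×ˢ SaddleNode.polydisc ρ₁ ρ₂ ∧
          DifferentiableOn ℂ P Ψ.source ∧
          (∀ p ∈ Ψ.source, Ψ p = p + p.1 ^ N • ((0, P p) : SaddleNode.Phase)) ∧
          ∀ p ∈ Ψ.source, ‖P p‖ ≤ K * ‖p.2‖ ^ 2 :=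
  fun σ => mainTheorem6_general l a₁ a₂ hl ha.le N hN c hc hc0 σ (D σ) (R σ) η hη (hD σ) (hR σ)
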